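/- **Definitions.** Let $\Sigma$ be a finite non-empty alphabet and $w\ge 1$ an integer. A *$(\Sigma,w)$-layer* is a tuple $B=(\ell,r,T,I,F,\iota,\phi)$ with left states $\ell\subseteq\{0,\dots,w-1\}$, right states $r\subseteq\{0,\dots,w-1\}$, transitions $T\subseteq \ell\times\Sigma\times r$, initial states $I\subseteq \ell$, final states $F\subseteq r$ and flags $\iota,\phi\in\{0,1\}$ such that $I=\emptyset$ if $\iota=0$ and $F=\emptyset$ if $\phi=0$. The finite set of all $(\Sigma,w)$-layers is denoted $\mathcal B(\Sigma,w)$. A layer is *deterministic* if ($\iota=1$ implies $I=\ell$ and $|\ell|=1$) and for all $p\in\ell$, $a\in\Sigma$ there is at most one $q$ with $(p,a,q)\in T$; it is *complete* if ($\iota=1$ implies $I\ne\emptyset$) and for all $p\in\ell$, $a\in\Sigma$ there is at least one $q$ with $(p,a,q)\in T$. A *$(\Sigma,w)$-ODD* is a string $D=B_1\cdots B_k$ of $k\ge1$ layers such that the right states of $B_i$ are the left states of $B_{i+1}$ for $1\le i<k$, exactly $B_1$ has initial flag $1$, and exactly $B_k$ has final flag $1$. Its language $\mathcal L(D)$ is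 the pair of the length $k$ and the set of all $s_1\cdots s_k\in\Sigma^k$ for which there are $p_0,\dots,p_k$ with $p_0$ initial in $B_1$, $p_k$ final in $B_k$ and $(p_{i-1},s_i,p_i)$ a transition of $B_i$ for all $i$. An ODD is deterministic (complete) if all its layers are. A *$(\Sigma,w)$-SOFA* (second-order finite automaton) is a nondeterministic finite automaton $\mathcal F$ (with a finite non-empty set of states and possibly several initial states) over the alphabet $\mathcal B(\Sigma,w)$ all of whose accepted strings are $(\Sigma,w)$-ODDs. Its *second language* is $\mathcal L_2(\mathcal F)=\{\mathcal L(D): D \text{ is accepted by } \mathcal F\}$. Its *size* is $|\mathcal F|=(\text{number of states})+(\text{number of transitions})\cdot\log_2|\mathcal B(\Sigma,w)|$. Time is the number of instructions executed by a unit-cost random access machine with addition, subtraction and indirect addressing, the input being $\Sigma$, $w$ and the two automata, with their states numbered, their transitions listed in any order, and each set occurring in a layer given by its bits. **Statement.** 1. There are an algorithm and a constant $C$ such that, for every finite non-empty alphabet $\Sigma$, every $w\ge1$ and all $(\Sigma,w)$-SOFAs $\mathcal F_1,\mathcal F_2$, the algorithm decides whether $\mathcal L_2(\mathcal F_1)\cap\mathcal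 L_2(\mathcal F_2)\neq\emptyset$ in time at most $2^{C|\Sigma|w2^w}\cdot|\mathcal F_1|\cdot|\mathcal F_2|$. 2. There are an algorithm and constants $K,C$ such that, for every finite non-empty alphabet $\Sigma$, every $w\ge1$ and all $(\Sigma,w)$-SOFAs $\mathcal F_1,\mathcal F_2$ for which all accepted ODDs are deterministic and complete, the algorithm decides whether $\mathcal L_2(\mathcal F_1)\cap\mathcal L_2(\mathcal F_2)\neq\emptyset$ in time at most $K\cdot2^{C|\Sigma|w\log_2 w}\cdot|\mathcal F_1|\cdot|\mathcal F_2|$. -/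

import Mathlib

namespace SecondOrder

/-! ### Layers and ordered decision diagrams -/

/-- An `(α, w)`-layer; the states are elements of `{0, …, w - 1}`. -/
@[ext]
structure Layer (α : Type*) (w : ℕ) where
  /-- left states -/
  left : Finset (Fin w)
  /-- right states -/
  right : Finset (Fin w)
  /-- transitions -/
  trans : Finset (Fin w × α × Fin w)
  /-- initial states -/
  init : Finset (Fin w)
  /-- final states -/
  final : Finset (Fin w)
  /-- initial flag -/
  initFlag : Bool
  /-- final flag -/
  finalFlag : Bool
  trans_subset : ∀ t ∈ trans, t.1 ∈ left ∧ t.2.2 ∈ right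
  init_subset : init ⊆ left
  final_subset : final ⊆ right
  init_eq_empty : initFlag = false → init = ∅
  final_eq_empty : finalFlag = false → final = ∅

/-- Over a finite alphabet there are only finitely many layers, so that layers form an alphabet. -/
instance {α : Type*} [Finite α] {w : ℕ} : Finite (Layer α w) := by
  let f : Layer α w → Finset (Fin w) × Finset (Fin w) × Finset (Fin w × α × Fin w) ×
      Finset (Fin w) × Finset (Fin w) × Bool × Bool :=
    fun L => (L.left, L.right, L.trans, L.init, L.final, L.initFlag, L.finalFlag)
  refine Finite.of_injective f fun L L' h => ?_
  simp only [f, Prod.mk.injEq] at h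
  obtain ⟨h1, h2, h3, h4, h5, h6, h7⟩ := h
  exact Layer.ext h1 h2 h3 h4 h5 h6 h7

/-- Deterministic layers. -/
def Layer.IsDeterministic {α : Type*} {w : ℕ} (L : Layer α w) : Prop :=
  (L.initFlag = true → L.init = L.left ∧ L.left.card = 1) ∧
    ∀ p ∈ L.left, ∀ a : α, ∀ q ∈ L.right, ∀ q' ∈ L.right,
      (p, a, q) ∈ L.trans → (p, a, q') ∈ L.trans → q = q'

/-- Complete layers. -/
def Layer.IsComplete {α : Type*} {w : ℕ} (L : Layer α w) : Prop :=
  (L.initFlag = true → L.init ≠ ∅) ∧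
    ∀ p ∈ L.left, ∀ a : α, ∃ q ∈ L.right, (p, a, q) ∈ L.trans

/-- A string of layers is an ordered decision diagram (ODD) if it is non-empty, consecutive
frontiers agree, exactly the first layer has its initial flag set, and exactly the last layer has
its final flag set. -/
def IsODD {α : Type*} {w : ℕ} (D : List (Layer α w)) : Prop :=
  D ≠ [] ∧
    (∀ (i : ℕ) (hi : i + 1 < D.length), (D[i + 1]).left = (D[i]).right) ∧
    (∀ (i : ℕ) (hi : i < D.length), (D[i]).initFlag = true ↔ i = 0) ∧
    (∀ (i : ℕ) (hi : i < D.length), (D[i]).finalFlag = true ↔ i + 1 = D.length)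

/-- `D` accepts `s`: there is an accepting sequence of transitions, given here by the states
`p 0, p 1, …, p k` it visits. -/
def Accepts {α : Type*} {w : ℕ} (D : List (Layer α w)) (s : Fin D.length → α) : Prop :=
  ∃ p : Fin (D.length + 1) → Fin w,
    (∀ L ∈ D.head?, p 0 ∈ L.init) ∧
    (∀ L ∈ D.getLast?, p (Fin.last D.length) ∈ L.final) ∧
    ∀ i : Fin D.length, (p i.castSucc, s i, p i.succ) ∈ (D.get i).trans

/-- The language of an ODD, as a set of strings typed with their length. -/
def oddLanguage {α : Type*} {w : ℕ} (D : List (Layer α w)) : Σ k : ℕ, Set (Fin k → α) :=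
  ⟨D.length, {s | Accepts D s}⟩

/-! ### Second-order finite automata

Finite automata (nondeterministic, several initial states) are Mathlib's `NFA`s on a finite
type of states. -/

/-- The automaton `M` over the alphabet of `(α, w)`-layers is a second-order finite automaton. -/
def IsSOFA {α σ : Type*} {w : ℕ} (M : NFA (Layer α w) σ) : Prop :=
  ∀ D ∈ M.accepts, IsODD D

/-- The second language of `M`. -/
def secondLanguage {α σ : Type*} {w : ℕ} (M : NFA (Layer α w) σ) :
    Set (Σ k : ℕ, Set (Fin k → α)) :=
  {X | ∃ D ∈ M.accepts, X = oddLanguage D}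

/-- All ODDs accepted by `M` are deterministic and complete. -/
def AllDetComplete {α σ : Type*} {w : ℕ} (M : NFA (Layer α w) σ) : Prop :=
  ∀ D ∈ M.accepts, ∀ L ∈ D, L.IsDeterministic ∧ L.IsComplete

/-- The set of transitions of a finite automaton. -/
def transitions {Γ σ : Type*} (M : NFA Γ σ) : Set (σ × Γ × σ) :=
  {t | t.2.2 ∈ M.step t.1 t.2.1}

/-- The size of a finite automaton over the alphabet `Γ`:
number of states plus number of transitions times `log₂ |Γ|`. -/
noncomputable def size {Γ σ : Type*} (M : NFA Γ σ) : ℝ :=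
  (Nat.card σ : ℝ) + ((transitions M).ncard : ℝ) * Real.logb 2 (Nat.card Γ)

/-! ### Random access machines

A unit-cost random access machine: natural-number registers (a program mentions only finitely
many of them), a memory of natural numbers with indirect addressing; the only arithmetic
operations are addition and (truncated) subtraction. -/

inductive Instr where
  /-- `r := c` -/
  | const (r c : ℕ)
  /-- `r := a + b` -/
  | add (r a b : ℕ)
  /-- `r := a - b`, truncated at zero -/
  | sub (r a b : ℕ)
  /-- `r := mem[a]` -/
  | load (r a : ℕ)
  /-- `mem[a] := r` -/
  | store (a r : ℕ)
  /-- jump to instruction number `l` if `r` is zero -/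
  | jumpZero (r l : ℕ)
  /-- halt with answer yes -/
  | accept
  /-- halt with answer no -/
  | reject

/-- A configuration: program counter, registers, memory. -/
structure Config where
  pc : ℕ
  reg : ℕ → ℕ
  mem : ℕ → ℕ

/-- The initial configuration: the input is in the memory, from address `0` on; everything else
is zero. -/
def Config.initial (x : List ℕ) : Config where
  pc := 0
  reg := fun _ => 0
  mem := fun i => x.getD i 0

/-- `run P t c = some b` if the program `P`, started in `c`, halts with answer `b` after executing
at most `t` instructions; otherwise `none` (also when control leaves the program). -/
def run (P : List Instr) : ℕ → Config → Option Bool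
  | 0, _ => none
  | t + 1, c =>
    match P[c.pc]? with
    | none => none
    | some .accept => some true
    | some .reject => some false
    | some (.const r k) =>
        run P t ⟨c.pc + 1, Function.update c.reg r k, c.mem⟩
    | some (.add r a b) =>
        run P t ⟨c.pc + 1, Function.update c.reg r (c.reg a + c.reg b), c.mem⟩
    | some (.sub r a b) =>
        run P t ⟨c.pc + 1, Function.update c.reg r (c.reg a - c.reg b), c.mem⟩
    | some (.load r a) =>
        run P t ⟨c.pc + 1, Function.update c.reg r (c.mem (c.reg a)), c.mem⟩
    | some (.store a r) =>
        run P t ⟨c.pc + 1, c.reg, Function.update c.mem (c.reg a) (c.reg r)⟩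
    | some (.jumpZero r l) =>
        run P t ⟨if c.reg r = 0 then l else c.pc + 1, c.reg, c.mem⟩

/-- On input `x`, the program `P` answers the question `Q` correctly within time `T`. -/
def DecidesWithin (P : List Instr) (x : List ℕ) (Q : Prop) (T : ℝ) : Prop :=
  ∃ (t : ℕ) (b : Bool), (t : ℝ) ≤ T ∧ run P t (Config.initial x) = some b ∧ (b = true ↔ Q)

/-! ### Presentation of the input

Symbols and states are numbered, sets are written as lists of bits, the transitions of an
automaton are listed one after the other, in any order and without repetition. -/

open Classical in
/-- The truth value of a proposition as a bit. -/
noncomputable def bit (p : Prop) : ℕ := if p then 1 else 0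

/-- A subset of a numbered set, as a list of bits. -/
noncomputable def encodeSet {ι : Type*} {n : ℕ} (e : ι ≃ Fin n) (S : Set ι) : List ℕ :=
  List.ofFn fun i : Fin n => bit (e.symm i ∈ S)

/-- A layer, as a list of `|α| w² + 4 w + 2` bits. -/
noncomputable def encodeLayer {α : Type*} {w s : ℕ} (e : α ≃ Fin s) (L : Layer α w) : List ℕ :=
  [bit (L.initFlag = true), bit (L.finalFlag = true)] ++
    encodeSet (Equiv.refl _) (L.left : Set (Fin w)) ++
    encodeSet (Equiv.refl _) (L.right : Set (Fin w)) ++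
    encodeSet (Equiv.refl _) (L.init : Set (Fin w)) ++
    encodeSet (Equiv.refl _) (L.final : Set (Fin w)) ++
    (List.ofFn fun p : Fin w => (List.ofFn fun a : Fin s =>
      encodeSet (Equiv.refl _) {q : Fin w | (p, e.symm a, q) ∈ L.trans}).flatten).flatten

/-- An automaton with numbered states and listed transitions: number of states, initial states,
final states, number of transitions, and for each transition its source, its layer and its
target. -/
noncomputable def encodeNFA {α σ : Type*} {w s n : ℕ} (e : α ≃ Fin s) (f : σ ≃ Fin n)
    (M : NFA (Layer α w) σ) (l : List (σ × Layer α w × σ)) : List ℕ :=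
  [n] ++ encodeSet f M.start ++ encodeSet f M.accept ++ [l.length] ++
    (l.map fun t => [(f t.1 : ℕ)] ++ encodeLayer e t.2.1 ++ [(f t.2.2 : ℕ)]).flatten

/-- The list `x` presents the instance `(α, w, M₁, M₂)`. -/
def IsPresentation {α σ₁ σ₂ : Type*} {w : ℕ} (M₁ : NFA (Layer α w) σ₁)
    (M₂ : NFA (Layer α w) σ₂) (x : List ℕ) : Prop :=
  ∃ (s n₁ n₂ : ℕ) (e : α ≃ Fin s) (f₁ : σ₁ ≃ Fin n₁) (f₂ : σ₂ ≃ Fin n₂)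
    (l₁ : List (σ₁ × Layer α w × σ₁)) (l₂ : List (σ₂ × Layer α w × σ₂)),
    l₁.Nodup ∧ (∀ t, t ∈ l₁ ↔ t ∈ transitions M₁) ∧
    l₂.Nodup ∧ (∀ t, t ∈ l₂ ↔ t ∈ transitions M₂) ∧
    x = [s, w] ++ encodeNFA e f₁ M₁ l₁ ++ encodeNFA e f₂ M₂ l₂

end SecondOrder

set_option linter.constructorNameAsVariable false
set_option linter.unusedSimpArgs false
set_option linter.unusedVariables false

/-! The subset construction turns a decision diagram into a levelled deterministic automaton whose
states are sets of states, called macro states here. Two diagrams of equal length have the same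
language iff their initial macro states are equivalent. As in the algorithm of Hopcroft and Karp,
this is decided by merging: identify the two initial macro states and, from each level to the next,
identify the successors under every letter of whatever is already identified. The languages agree
iff behind the last layers no final macro state is identified with a non-final one. The merging runs
forward and remembers only the partition of the current level, so it can be carried along a search
in the product of the two automata. A node of the search consists of a state of each automaton and a
partition, stored as a map that sends every index to a label of its class. If N numbers serve for
the macro states of one side and M = 2N, there are at most n₁ n₂ M^M nodes.

Soundness is `updW_sound`: a word leads identified indices to identified indices, so a last
partition that respects finality forces equal languages. Completeness is `updW_complete`: merging
stays inside every equivalence that contains the merged pairs, in particular inside "no word of the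
remaining length tells the two apart". `check_iff` joins the two directions. Indices that stand for
no relevant macro state do no harm, because `delta` and `IsFin` are total and the completeness
argument covers all indices. `reach_iff` and `win_iff` pass from diagrams to automata.

The two claims differ only in the numbering of macro states. In general all subsets are numbered by
their binary digits and N = 2^w. If all layers are deterministic and complete, only one-element sets
occur (`goodRun_of_det`) and N = w. So M^M is 2^((w+1) 2^(w+1)) in the first case and (2w)^(2w) in
the second; `bound_subsets` and `bound_single` put this and the polynomial factors into the required
form.

For the running time, the product of the two out-degrees, summed over all nodes, is at most M^M T₁
T₂ for T₁ and T₂ transitions (`searchC_spec`). One pair of transitions costs a polynomial in M and w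
times the square of |Σ|. There are at least 2^|Σ| layers, so |Σ| is at most the logarithm in the
definition of the size, and n + T |Σ| is at most the size (`le_size`). Each automaton thus absorbs
one factor |Σ| (`total_le`).

The algorithm is written in a small language of bounded loops with arrays, in which both the effect
and the cost of a command are recursive functions. `Cmd.code_steps` shows that compiled code has
this effect within this cost, syntactic frames (`Cmd.reg_frame`, `Cmd.arr_frame`) settle what a
command leaves alone, and `Cmd.cost_le` reads a time bound off the nesting of loops. -/

namespace SecondOrder

/-! ### A structured language of bounded loops -/

/-- The scalar variables. -/
inductive Var
  | s | w | n1 | n2 | t1 | t2 | lam | ac1 | tp1 | st2 | ac2 | tp2 | len | N | M | bnd | cnt | ans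
  | i | q1 | q2 | d1 | d2 | j1 | j2 | p1 | p2 | a | x | y | r | u | v | z | cu | cv
  | m | L | off | mw | q | p | f | ad | t | k | j | key | acc | fx | ok | g1 | g2
  deriving DecidableEq

/-- The arrays. -/
inductive Arr
  | wt | memb | row | rowA | rowB | deg1 | deg2 | out1 | out2 | Q1 | Q2 | QC | vis | c | b | cn
  deriving DecidableEq

/-- Expressions; `inp` reads the input. -/
inductive Exp
  | lit (n : ℕ)
  | var (v : Var)
  | add (a b : Exp)
  | sub (a b : Exp)
  | rd (k : Arr) (e : Exp)
  | inp (e : Exp)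

instance : Add Exp := ⟨Exp.add⟩
instance : Sub Exp := ⟨Exp.sub⟩
instance (n : ℕ) : OfNat Exp n := ⟨Exp.lit n⟩

/-- Commands: `ifz e c₁ c₂` executes `c₁` if `e` is zero and `c₂` otherwise; `loop i n c` executes
`c` for `i = 0, …, n - 1`. -/
inductive Cmd
  | skip
  | assign (v : Var) (e : Exp)
  | write (k : Arr) (e₁ e₂ : Exp)
  | seq (c₁ c₂ : Cmd)
  | ifz (e : Exp) (c₁ c₂ : Cmd)
  | loop (i n : Var) (c : Cmd)

/-- States of the structured language. -/
structure St where
  reg : Var → ℕ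
  arr : Arr → ℕ → ℕ

/-- Assignment to a variable. -/
def St.set (s : St) (v : Var) (x : ℕ) : St := ⟨Function.update s.reg v x, s.arr⟩

/-- Assignment to an array entry. -/
def St.put (s : St) (k : Arr) (i x : ℕ) : St :=
  ⟨s.reg, Function.update s.arr k (Function.update (s.arr k) i x)⟩

@[simp] theorem St.set_reg (s : St) (v u : Var) (x : ℕ) :
    (s.set v x).reg u = if u = v then x else s.reg u := by
  simp [St.set, Function.update_apply]

@[simp] theorem St.set_arr (s : St) (v : Var) (x : ℕ) : (s.set v x).arr = s.arr := rfl

@[simp] theorem St.put_reg (s : St) (k : Arr) (i x : ℕ) : (s.put k i x).reg = s.reg := rfl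

@[simp] theorem St.put_arr (s : St) (k l : Arr) (i x : ℕ) :
    (s.put k i x).arr l = if l = k then Function.update (s.arr k) i x else s.arr l := by
  by_cases h : l = k
  · subst h; simp [St.put]
  · simp [St.put, h]

/-- The value of an expression. -/
def Exp.val (X : ℕ → ℕ) (s : St) : Exp → ℕ
  | lit n => n
  | var v => s.reg v
  | add a b => a.val X s + b.val X s
  | sub a b => a.val X s - b.val X s
  | rd k e => s.arr k (e.val X s)
  | inp e => X (e.val X s)

section val
variable (X : ℕ → ℕ) (s : St)
@[simp] theorem Exp.val_add (a b : Exp) : (a + b).val X s = a.val X s + b.val X s := rfl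
@[simp] theorem Exp.val_sub (a b : Exp) : (a - b).val X s = a.val X s - b.val X s := rfl
@[simp] theorem Exp.val_var (v : Var) : (Exp.var v).val X s = s.reg v := rfl
@[simp] theorem Exp.val_rd (k : Arr) (e : Exp) : (Exp.rd k e).val X s = s.arr k (e.val X s) := rfl
@[simp] theorem Exp.val_inp (e : Exp) : (Exp.inp e).val X s = X (e.val X s) := rfl
@[simp] theorem Exp.val_ofNat (n : ℕ) : (ofNat(n) : Exp).val X s = n := rfl
end val

/-- Iteration with a counter. -/
def iter {S : Type*} (f : ℕ → S → S) : ℕ → S → S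
  | 0, s => s
  | n + 1, s => f n (iter f n s)

/-- The state after the execution of a command. -/
def Cmd.eval (X : ℕ → ℕ) : Cmd → St → St
  | skip, s => s
  | assign v e, s => s.set v (e.val X s)
  | write k e₁ e₂, s => s.put k (e₁.val X s) (e₂.val X s)
  | seq c₁ c₂, s => c₂.eval X (c₁.eval X s)
  | ifz e c₁ c₂, s => if e.val X s = 0 then c₁.eval X s else c₂.eval X s
  | loop i n c, s => iter (fun j t => c.eval X (t.set i j)) (s.reg n) s

/-- A bound for the number of instructions that compute an expression. -/
def Exp.cost : Exp → ℕ
  | lit _ => 1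
  | var _ => 2
  | add a b => a.cost + b.cost + 1
  | sub a b => a.cost + b.cost + 1
  | rd _ e => e.cost + 9
  | inp e => e.cost + 3

/-- A bound for the number of instructions executed by a command. -/
def Cmd.cost (X : ℕ → ℕ) : Cmd → St → ℕ
  | skip, _ => 0
  | assign _ e, _ => e.cost + 2
  | write _ e₁ e₂, _ => e₁.cost + e₂.cost + 9
  | seq c₁ c₂, s => c₁.cost X s + c₂.cost X (c₁.eval X s)
  | ifz e c₁ c₂, s => e.cost + 3 + if e.val X s = 0 then c₁.cost X s else c₂.cost X s
  | loop i n c, s => 5 + ∑ j ∈ Finset.range (s.reg n),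
      (6 + c.cost X ((iter (fun j t => c.eval X (t.set i j)) j s).set i j))

/-! ### Compilation -/

/-- The register of a variable. -/
def rv (v : Var) : ℕ := 2 * v.ctorIdx + 2

/-- The `d`-th auxiliary register. -/
def tmp (d : ℕ) : ℕ := 2 * d + 1

theorem rv_inj {u v : Var} : rv u = rv v ↔ u = v := by
  refine ⟨fun h => ?_, fun h => h ▸ rfl⟩
  have h' : u.ctorIdx = v.ctorIdx := by unfold rv at h; omega
  rw [← Var.ofNat_ctorIdx u, h', Var.ofNat_ctorIdx]

/-- Variables occupy positive even registers and auxiliary values odd ones; register 0 is kept for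
the base address of the arrays. The three families therefore never collide. -/
theorem tmp_inj {d e : ℕ} : tmp d = tmp e ↔ d = e := by unfold tmp; omega
theorem rv_ne_tmp (v : Var) (d : ℕ) : rv v ≠ tmp d := by unfold rv tmp; omega
theorem tmp_ne_rv (v : Var) (d : ℕ) : tmp d ≠ rv v := (rv_ne_tmp v d).symm
theorem zero_ne_tmp (d : ℕ) : 0 ≠ tmp d := by unfold tmp; omega
theorem zero_ne_rv (v : Var) : 0 ≠ rv v := by unfold rv; omega

/-- The arrays are interleaved behind the input with stride 32. A power of two above the number of
arrays is chosen because five doublings then produce the address. -/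
theorem Arr.ctorIdx_lt (k : Arr) : k.ctorIdx < 32 := by cases k <;> decide

theorem Arr.ctorIdx_inj {k l : Arr} (h : k.ctorIdx = l.ctorIdx) : k = l := by
  rw [← Arr.ofNat_ctorIdx k, h, Arr.ofNat_ctorIdx]

/-- Turns an index in the `d`-th auxiliary register into the address of an array entry. -/
def addrCode (k : Arr) (d : ℕ) : List Instr :=
  [.add (tmp d) (tmp d) (tmp d), .add (tmp d) (tmp d) (tmp d), .add (tmp d) (tmp d) (tmp d),
    .add (tmp d) (tmp d) (tmp d), .add (tmp d) (tmp d) (tmp d), .add (tmp d) (tmp d) 0,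
    .const (tmp (d + 1)) (k.ctorIdx + 1), .add (tmp d) (tmp d) (tmp (d + 1))]

/-- The code of an expression: the value goes to the `d`-th auxiliary register. If `g` is set, then
register `0` holds the first address behind the input, and reading the input is guarded. -/
def Exp.code (g : Bool) : Exp → ℕ → List Instr
  | lit n, d => [.const (tmp d) n]
  | var v, d => [.const (tmp d) 0, .add (tmp d) (tmp d) (rv v)]
  | add a b, d => a.code g d ++ b.code g (d + 1) ++ [.add (tmp d) (tmp d) (tmp (d + 1))]
  | sub a b, d => a.code g d ++ b.code g (d + 1) ++ [.sub (tmp d) (tmp d) (tmp (d + 1))]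
  | rd k e, d => e.code g d ++ addrCode k d ++ [.load (tmp d) (tmp d)]
  -- The two subtractions compute a - (a - B) = min a B. Cell B lies behind the input and in front
  -- of all arrays, so it stays zero, and reading past the input never hits an array entry.
  | inp e, d => e.code g d ++
      (if g then [.sub (tmp (d + 1)) (tmp d) 0, .sub (tmp d) (tmp d) (tmp (d + 1))] else []) ++
      [.load (tmp d) (tmp d)]

/-- The code of a command, to be placed at address `o`. -/
def Cmd.code (g : Bool) : Cmd → ℕ → ℕ → List Instr
  | skip, _, _ => []
  | assign v e, _, d => e.code g d ++ [.const (tmp (d + 1)) 0, .add (rv v) (tmp d) (tmp (d + 1))]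
  | write k e₁ e₂, _, d =>
      e₁.code g d ++ addrCode k d ++ e₂.code g (d + 1) ++ [.store (tmp d) (tmp (d + 1))]
  | seq c₁ c₂, o, d => c₁.code g o d ++ c₂.code g (o + (c₁.code g o d).length) d
  | ifz e c₁ c₂, o, d =>
      let E := e.code g d
      let B := c₂.code g (o + E.length + 1) d
      let A := c₁.code g (o + E.length + 1 + B.length + 2) d
      E ++ ([.jumpZero (tmp d) (o + E.length + 1 + B.length + 2)] ++ (B ++
        ([.const (tmp d) 0, .jumpZero (tmp d) (o + E.length + 1 + B.length + 2 + A.length)] ++ A)))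
  -- The bound is copied to one auxiliary register and the number of remaining rounds is kept in the
  -- next; the index is their difference. The body works two levels deeper. The machine has no
  -- unconditional jump, so a register is set to zero and tested.
  | loop i n c, o, d =>
      let C := c.code g (o + 6) (d + 2)
      [.const (tmp d) 0, .add (tmp d) (tmp d) (rv n), .const (tmp (d + 1)) 0,
        .add (tmp (d + 1)) (tmp d) (tmp (d + 1))] ++
      ([.jumpZero (tmp (d + 1)) (o + 10 + C.length)] ++
      ([.sub (rv i) (tmp d) (tmp (d + 1))] ++
      (C ++
      ([.const (tmp (d + 2)) 1, .sub (tmp (d + 1)) (tmp (d + 1)) (tmp (d + 2)),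
        .const (tmp (d + 2)) 0] ++ [.jumpZero (tmp (d + 2)) (o + 4)]))))

/-- Whether an expression reads no array. -/
def Exp.noArr : Exp → Bool
  | lit _ => true
  | var _ => true
  | add a b => a.noArr && b.noArr
  | sub a b => a.noArr && b.noArr
  | rd _ _ => false
  | inp e => e.noArr

/-- Whether a command uses no array. -/
def Cmd.noArr : Cmd → Bool
  | skip => true
  | assign _ e => e.noArr
  | write _ _ _ => false
  | seq a b => a.noArr && b.noArr
  | ifz e a b => e.noArr && a.noArr && b.noArr
  | loop _ _ c => c.noArr

/-! ### Execution of machine code -/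

/-- Control gets from `c` to `c'` in `k` steps. -/
def Steps (P : List Instr) (k : ℕ) (c c' : Config) : Prop :=
  ∀ f, run P (k + f) c = run P f c'

theorem Steps.refl (P : List Instr) (c : Config) : Steps P 0 c c := fun f => by simp

theorem Steps.trans {P : List Instr} {k l : ℕ} {c c' c'' : Config} (h : Steps P k c c')
    (h' : Steps P l c' c'') : Steps P (k + l) c c'' := fun f => by
  rw [Nat.add_assoc, h, h']

/-- The effect of an instruction on registers and memory. -/
def Instr.exec : Instr → (ℕ → ℕ) × (ℕ → ℕ) → (ℕ → ℕ) × (ℕ → ℕ)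
  | .const r k, c => (Function.update c.1 r k, c.2)
  | .add r a b, c => (Function.update c.1 r (c.1 a + c.1 b), c.2)
  | .sub r a b, c => (Function.update c.1 r (c.1 a - c.1 b), c.2)
  | .load r a, c => (Function.update c.1 r (c.2 (c.1 a)), c.2)
  | .store a r, c => (c.1, Function.update c.2 (c.1 a) (c.1 r))
  | _, c => c

/-- Instructions that pass control to the next one. -/
def Instr.straight : Instr → Bool
  | .jumpZero _ _ => false
  | .accept => false
  | .reject => false
  | _ => true

/-- The effect of a list of instructions on registers and memory. -/
def execAll (l : List Instr) (c : (ℕ → ℕ) × (ℕ → ℕ)) : (ℕ → ℕ) × (ℕ → ℕ) :=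
  l.foldl (fun c i => i.exec c) c

theorem execAll_append (l l' : List Instr) (c : (ℕ → ℕ) × (ℕ → ℕ)) :
    execAll (l ++ l') c = execAll l' (execAll l c) := by simp [execAll]

/-- The code `l` stands at address `o` of `P`. -/
def Has (P : List Instr) (o : ℕ) (l : List Instr) : Prop :=
  ∃ pre post, P = pre ++ (l ++ post) ∧ pre.length = o

theorem Has.left {P : List Instr} {o : ℕ} {l l' : List Instr} (h : Has P o (l ++ l')) :
    Has P o l := by
  obtain ⟨pre, post, rfl, rfl⟩ := h
  exact ⟨pre, l' ++ post, by simp, rfl⟩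

theorem Has.right {P : List Instr} {o : ℕ} {l l' : List Instr} (h : Has P o (l ++ l')) :
    Has P (o + l.length) l' := by
  obtain ⟨pre, post, rfl, rfl⟩ := h
  exact ⟨pre ++ l, post, by simp, by simp⟩

theorem Has.head {P : List Instr} {o : ℕ} {i : Instr} {l : List Instr} (h : Has P o (i :: l)) :
    P[o]? = some i := by
  obtain ⟨pre, post, rfl, rfl⟩ := h
  simp

theorem steps_straight {P : List Instr} (l : List Instr) : ∀ {o : ℕ} (c : (ℕ → ℕ) × (ℕ → ℕ)),
    Has P o l → (l.all Instr.straight) = true →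
      Steps P l.length ⟨o, c.1, c.2⟩ ⟨o + l.length, (execAll l c).1, (execAll l c).2⟩ := by
  induction l with
  | nil => intro o c _ _; exact Steps.refl _ _
  | cons i l ih =>
    intro o c h hs
    simp only [List.all_cons, Bool.and_eq_true] at hs
    have h1 := h.head
    have h2 : Has P (o + 1) l := Has.right (l := [i]) h
    have h3 := ih (i.exec c) h2 hs.2
    have h4 : Steps P 1 ⟨o, c.1, c.2⟩ ⟨o + 1, (i.exec c).1, (i.exec c).2⟩ := by
      intro f
      rw [Nat.add_comm 1 f]
      cases i <;> simp_all [run, Instr.exec, Instr.straight]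
    have := h4.trans h3
    simp only [List.length_cons]
    rw [Nat.add_comm l.length 1, ← Nat.add_assoc]
    exact this

theorem steps_jump {P : List Instr} {o r l : ℕ} {L : List Instr} (R m : ℕ → ℕ)
    (h : Has P o (.jumpZero r l :: L)) :
    Steps P 1 ⟨o, R, m⟩ ⟨if R r = 0 then l else o + 1, R, m⟩ := by
  intro f
  rw [Nat.add_comm 1 f]
  simp [run, h.head]

/-! ### Correctness of compilation -/

/-- Registers `R` and memory `m` represent the state `s` for the input `X`. -/
structure Sim (g : Bool) (B : ℕ) (X : ℕ → ℕ) (s : St) (R m : ℕ → ℕ) : Prop where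
  var : ∀ v, R (rv v) = s.reg v
  base : g = true → R 0 = B
  input : ∀ a, (g = true → a ≤ B) → m a = X a
  zero : g = true → ∀ a, B ≤ a → X a = 0
  arr : g = true → ∀ k i, m (B + 1 + Arr.ctorIdx k + 32 * i) = s.arr k i

theorem Sim.congr {g : Bool} {B : ℕ} {X : ℕ → ℕ} {s : St} {R R' m : ℕ → ℕ} (h : Sim g B X s R m)
    (hR : ∀ r, (∀ d, r ≠ tmp d) → R' r = R r) : Sim g B X s R' m where
  var v := by rw [hR _ (rv_ne_tmp v), h.var]
  base hg := by rw [hR _ zero_ne_tmp, h.base hg]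
  input := h.input
  zero := h.zero
  arr := h.arr

/-- The last clause says that registers outside the auxiliary ones from level d on survive. This is
what makes nested evaluation possible. -/
theorem addrCode_exec (k : Arr) (d : ℕ) (c : (ℕ → ℕ) × (ℕ → ℕ)) :
    (execAll (addrCode k d) c).2 = c.2 ∧
    (execAll (addrCode k d) c).1 (tmp d) = c.1 0 + 1 + k.ctorIdx + 32 * c.1 (tmp d) ∧
    ∀ r, (∀ d', d ≤ d' → r ≠ tmp d') → (execAll (addrCode k d) c).1 r = c.1 r := by
  have h1 : tmp d ≠ tmp (d + 1) := by simp [tmp_inj]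
  have h3 : tmp (d + 1) ≠ tmp d := h1.symm
  refine ⟨by simp [addrCode, execAll, Instr.exec], ?_, ?_⟩
  · simp [addrCode, execAll, Instr.exec, Function.update_apply, zero_ne_tmp, h1]
    ring
  · intro r hr
    have h2 := hr d le_rfl
    have h4 := hr (d + 1) (by omega)
    simp [addrCode, execAll, Instr.exec, Function.update_apply, h2, h4]

theorem Exp.code_straight (g : Bool) (e : Exp) : ∀ d, ((e.code g d).all Instr.straight) = true := by
  induction e with
  | lit n => intro d; simp [code, Instr.straight]
  | var v => intro d; simp [code, Instr.straight]
  | add a b iha ihb => intro d; simp only [code, List.all_append, iha, ihb]; simp [Instr.straight]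
  | sub a b iha ihb => intro d; simp only [code, List.all_append, iha, ihb]; simp [Instr.straight]
  | rd k e ih =>
    intro d; simp only [code, List.all_append, ih]; simp [Instr.straight, addrCode]
  | inp e ih =>
    intro d; simp only [code, List.all_append, ih]; cases g <;> simp [Instr.straight]

theorem Exp.code_length (g : Bool) (e : Exp) : ∀ d, (e.code g d).length ≤ e.cost := by
  induction e with
  | lit n => intro d; simp [code, cost]
  | var v => intro d; simp [code, cost]
  | add a b iha ihb =>
    intro d; have := iha d; have := ihb (d + 1); simp [code, cost]; omega
  | sub a b iha ihb =>
    intro d; have := iha d; have := ihb (d + 1); simp [code, cost]; omega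
  | rd k e ih => intro d; have := ih d; simp [code, cost, addrCode]; omega
  | inp e ih => intro d; have := ih d; cases g <;> simp [code, cost] <;> omega

/-- Induction on the expression. The condition on `g` excludes array access in unguarded mode, where
no base address is available yet. -/
theorem Exp.code_exec {g : Bool} {B : ℕ} {X : ℕ → ℕ} {s : St} (e : Exp) :
    ∀ (d : ℕ) (c : (ℕ → ℕ) × (ℕ → ℕ)), Sim g B X s c.1 c.2 → (g = false → e.noArr = true) →
      (execAll (e.code g d) c).2 = c.2 ∧
      (execAll (e.code g d) c).1 (tmp d) = e.val X s ∧
      ∀ r, (∀ d', d ≤ d' → r ≠ tmp d') → (execAll (e.code g d) c).1 r = c.1 r := by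
  -- Both binary operations follow one pattern: the left value waits at level d while the right
  -- operand is evaluated from level d + 1 on.
  have key : ∀ (a b : Exp) (I : Instr) (d : ℕ) (c : (ℕ → ℕ) × (ℕ → ℕ)) (F : ℕ → ℕ → ℕ),
      (∀ c, I.exec c = (Function.update c.1 (tmp d) (F (c.1 (tmp d)) (c.1 (tmp (d + 1)))), c.2)) →
      Sim g B X s c.1 c.2 →
      (∀ (d : ℕ) (c : (ℕ → ℕ) × (ℕ → ℕ)), Sim g B X s c.1 c.2 →
        (execAll (a.code g d) c).2 = c.2 ∧ (execAll (a.code g d) c).1 (tmp d) = a.val X s ∧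
        ∀ r, (∀ d', d ≤ d' → r ≠ tmp d') → (execAll (a.code g d) c).1 r = c.1 r) →
      (∀ (d : ℕ) (c : (ℕ → ℕ) × (ℕ → ℕ)), Sim g B X s c.1 c.2 →
        (execAll (b.code g d) c).2 = c.2 ∧ (execAll (b.code g d) c).1 (tmp d) = b.val X s ∧
        ∀ r, (∀ d', d ≤ d' → r ≠ tmp d') → (execAll (b.code g d) c).1 r = c.1 r) →
      (execAll (a.code g d ++ b.code g (d + 1) ++ [I]) c).2 = c.2 ∧
      (execAll (a.code g d ++ b.code g (d + 1) ++ [I]) c).1 (tmp d) = F (a.val X s) (b.val X s) ∧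
      ∀ r, (∀ d', d ≤ d' → r ≠ tmp d') →
        (execAll (a.code g d ++ b.code g (d + 1) ++ [I]) c).1 r = c.1 r := by
    intro a b I d c F hI hc ha hb
    obtain ⟨a1, a2, a3⟩ := ha d c hc
    have hc' : Sim g B X s (execAll (a.code g d) c).1 (execAll (a.code g d) c).2 := by
      rw [a1]; exact hc.congr fun r hr => a3 r fun d' _ => hr d'
    obtain ⟨b1, b2, b3⟩ := hb (d + 1) _ hc'
    have hI' : ∀ c, execAll [I] c = I.exec c := fun c => rfl
    rw [execAll_append, execAll_append, hI', hI]
    refine ⟨by rw [b1, a1], ?_, ?_⟩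
    · simp only [Function.update_self]
      rw [b2, b3 _ fun d' hd' => by simp [tmp_inj]; omega, a2]
    · intro r hr
      simp only
      rw [Function.update_of_ne (hr d le_rfl), b3 r fun d' hd' => hr d' (by omega), a3 r hr]
  induction e with
  | lit n =>
    intro d c _ _
    refine ⟨rfl, by simp [code, execAll, Instr.exec, val], fun r hr => ?_⟩
    simp [code, execAll, Instr.exec, Function.update_of_ne (hr d le_rfl)]
  | var v =>
    intro d c hc _
    refine ⟨rfl, ?_, fun r hr => ?_⟩
    · simp [code, execAll, Instr.exec, val, Function.update_of_ne (rv_ne_tmp v d), hc.var]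
    · simp [code, execAll, Instr.exec, Function.update_of_ne (hr d le_rfl)]
  | add a b iha ihb =>
    intro d c hc hg
    simp only [noArr, Bool.and_eq_true] at hg
    exact key a b _ d c (· + ·) (fun c => rfl) hc (fun d c h => iha d c h fun h => (hg h).1)
      (fun d c h => ihb d c h fun h => (hg h).2)
  | sub a b iha ihb =>
    intro d c hc hg
    simp only [noArr, Bool.and_eq_true] at hg
    exact key a b _ d c (· - ·) (fun c => rfl) hc (fun d c h => iha d c h fun h => (hg h).1)
      (fun d c h => ihb d c h fun h => (hg h).2)
  | rd k e ih =>
    intro d c hc hg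
    have hg' : g = true := by
      cases g with
      | true => rfl
      | false => simp [noArr] at hg
    obtain ⟨a1, a2, a3⟩ := ih d c hc (by simp [hg'])
    obtain ⟨b1, b2, b3⟩ := addrCode_exec k d (execAll (e.code g d) c)
    have hI : ∀ c, execAll [Instr.load (tmp d) (tmp d)] c
      = (Function.update c.1 (tmp d) (c.2 (c.1 (tmp d))), c.2) := fun c => rfl
    simp only [code]
    rw [execAll_append, execAll_append, hI]
    refine ⟨by rw [b1, a1], ?_, fun r hr => ?_⟩
    · simp only [Function.update_self]
      rw [b1, b2, a1, a2, a3 0 fun d' _ => zero_ne_tmp d', hc.base hg', hc.arr hg', val_rd]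
    · simp only
      rw [Function.update_of_ne (hr d le_rfl), b3 r hr, a3 r hr]
  | inp e ih =>
    intro d c hc hg
    obtain ⟨a1, a2, a3⟩ := ih d c hc hg
    have hI : ∀ c, execAll [Instr.load (tmp d) (tmp d)] c
      = (Function.update c.1 (tmp d) (c.2 (c.1 (tmp d))), c.2) := fun c => rfl
    simp only [code]
    rw [execAll_append, execAll_append, hI]
    cases g with
    | false =>
      simp only [Bool.false_eq_true, if_false]
      refine ⟨a1, ?_, fun r hr => ?_⟩
      · have : ∀ c, execAll [] c = c := fun c => rfl
        simp only [Function.update_self, this]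
        rw [a1, a2, hc.input _ (by simp), val_inp]
      · have : ∀ c, execAll [] c = c := fun c => rfl
        simp only [this]
        rw [Function.update_of_ne (hr d le_rfl), a3 r hr]
    | true =>
      have h1 : tmp d ≠ tmp (d + 1) := by simp [tmp_inj]
      have h0 : (execAll (code true e d) c).1 0 = B := by
        rw [a3 0 fun d' _ => zero_ne_tmp d', hc.base rfl]
      simp only [if_true]
      refine ⟨by simp [execAll, Instr.exec]; exact a1, ?_, fun r hr => ?_⟩
      · set c' := execAll (code true e d) c with hc'
        simp only [execAll, Instr.exec, List.foldl_cons, List.foldl_nil, Function.update_self,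
          Function.update_of_ne h1, h0, a1, a2, val_inp]
        rcases le_total (e.val X s) B with h | h
        · rw [Nat.sub_eq_zero_of_le h, Nat.sub_zero, hc.input _ fun _ => h]
        · rw [Nat.sub_sub_self h, hc.input _ fun _ => le_rfl, hc.zero rfl _ le_rfl,
            hc.zero rfl _ h]
      · have h2 := hr d le_rfl
        have h4 := hr (d + 1) (by omega)
        simp [execAll, Instr.exec, Function.update_of_ne h2, Function.update_of_ne h4]
        exact a3 r hr

theorem Exp.code_steps {g : Bool} {B : ℕ} {X : ℕ → ℕ} {s : St} (e : Exp) {P : List Instr}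
    {o d : ℕ} {R m : ℕ → ℕ} (hP : Has P o (e.code g d)) (h : Sim g B X s R m)
    (hg : g = false → e.noArr = true) :
    ∃ R', Steps P (e.code g d).length ⟨o, R, m⟩ ⟨o + (e.code g d).length, R', m⟩ ∧
      Sim g B X s R' m ∧ R' (tmp d) = e.val X s ∧
      ∀ r, (∀ d', d ≤ d' → r ≠ tmp d') → R' r = R r := by
  obtain ⟨a1, a2, a3⟩ := e.code_exec d (R, m) h hg
  refine ⟨_, ?_, h.congr fun r hr => a3 r fun d' _ => hr d', a2, a3⟩
  have := steps_straight (e.code g d) (R, m) hP (e.code_straight g d)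
  rw [a1] at this
  exact this

theorem Sim.set {g : Bool} {B : ℕ} {X : ℕ → ℕ} {s : St} {R m : ℕ → ℕ} (h : Sim g B X s R m)
    (v : Var) (x : ℕ) {R' : ℕ → ℕ} (hx : R' (rv v) = x)
    (hR : ∀ r, r ≠ rv v → (∀ d, r ≠ tmp d) → R' r = R r) : Sim g B X (s.set v x) R' m where
  var u := by
    by_cases huv : u = v
    · subst huv; simp [hx]
    · rw [hR _ (by simpa [rv_inj] using huv) (rv_ne_tmp u), h.var]; simp [huv]
  base hg := by rw [hR _ (zero_ne_rv v) zero_ne_tmp, h.base hg]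
  input := h.input
  zero := h.zero
  arr := h.arr

/-- The address written is above B, so the input is intact; different arrays have different residues
modulo 32, so only the intended entry changes. -/
theorem Sim.put {B : ℕ} {X : ℕ → ℕ} {s : St} {R m : ℕ → ℕ} (h : Sim true B X s R m)
    (k : Arr) (i x : ℕ) :
    Sim true B X (s.put k i x) R (Function.update m (B + 1 + k.ctorIdx + 32 * i) x) where
  var := h.var
  base := h.base
  input a ha := by
    rw [Function.update_of_ne (by have := ha rfl; omega), h.input a ha]
  zero := h.zero
  arr hg l j := by
    have hk := k.ctorIdx_lt
    have hl := l.ctorIdx_lt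
    by_cases hlk : l = k
    · subst hlk
      by_cases hji : j = i
      · subst hji; simp
      · rw [Function.update_of_ne (by omega), h.arr hg]; simp [hji]
    · have : l.ctorIdx ≠ k.ctorIdx := fun h => hlk (Arr.ctorIdx_inj h)
      rw [Function.update_of_ne (by omega), h.arr hg]; simp [hlk]

/-- Induction on the command. Preservation of the auxiliary registers below d has to be part of the
induction: it carries the counters of the enclosing loops through their bodies. -/
theorem Cmd.code_steps {g : Bool} {B : ℕ} {X : ℕ → ℕ} {P : List Instr} (c : Cmd) :
    ∀ {s : St} {o d : ℕ} {R m : ℕ → ℕ}, Has P o (c.code g o d) → Sim g B X s R m →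
      (g = false → c.noArr = true) →
      ∃ k R' m', k ≤ c.cost X s ∧
        Steps P k ⟨o, R, m⟩ ⟨o + (c.code g o d).length, R', m'⟩ ∧
        Sim g B X (c.eval X s) R' m' ∧ ∀ d' < d, R' (tmp d') = R (tmp d') := by
  induction c with
  | skip =>
    intro s o d R m _ h _
    exact ⟨0, R, m, le_rfl, Steps.refl _ _, h, fun _ _ => rfl⟩
  | assign v e =>
    intro s o d R m hP h hg
    simp only [code] at hP
    obtain ⟨R1, h1, h2, h3, h4⟩ := e.code_steps hP.left h hg
    have h5 := steps_straight _ (R1, m) hP.right (by simp [Instr.straight])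
    have h6 := h1.trans h5
    have hl : o + (e.code g d).length + [Instr.const (tmp (d + 1)) 0,
        .add (rv v) (tmp d) (tmp (d + 1))].length = o + (code g (assign v e) o d).length := by
      simp [code, Nat.add_assoc]
    rw [hl] at h6
    refine ⟨_, _, _, ?_, h6, ?_, ?_⟩
    rotate_left
    · simp only [execAll, Instr.exec, List.foldl_cons, List.foldl_nil, eval]
      refine h2.set v _ ?_ ?_
      · simp [Function.update_apply, tmp_inj, h3]
      · intro r hr hr'
        simp [Function.update_apply, hr, hr']
    · intro d' hd'
      simp only [execAll, Instr.exec, List.foldl_cons, List.foldl_nil]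
      rw [Function.update_of_ne (tmp_ne_rv v d'),
        Function.update_of_ne (by simp [tmp_inj]; omega), h4 _ fun d'' hd'' => by
          simp [tmp_inj]; omega]
    · have := e.code_length g d
      simp [cost]; omega
  | write k e₁ e₂ =>
    intro s o d R m hP h hg
    have hg' : g = true := by
      cases g with
      | true => rfl
      | false => simp [noArr] at hg
    subst hg'
    simp only [code] at hP
    obtain ⟨R1, h1, h2, h3, h4⟩ := e₁.code_steps hP.left.left.left h (by simp)
    have hA := steps_straight _ (R1, m) hP.left.left.right (by simp [addrCode, Instr.straight])
    obtain ⟨b1, b2, b3⟩ := addrCode_exec k d (R1, m)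
    simp only at b1 b2 b3 hA
    rw [b1] at hA
    set R2 := (execAll (addrCode k d) (R1, m)).1 with hR2
    have h2' : Sim true B X s R2 m := h2.congr fun r hr => b3 r fun d' _ => hr d'
    have hE := hP.left.right
    rw [List.length_append, ← Nat.add_assoc] at hE
    obtain ⟨R3, h5, h6, h7, h8⟩ := e₂.code_steps hE h2' (by simp)
    have hS := hP.right
    rw [List.length_append, List.length_append, ← Nat.add_assoc, ← Nat.add_assoc] at hS
    have h9 := steps_straight _ (R3, m) hS (by simp [Instr.straight])
    have h10 := ((h1.trans hA).trans h5).trans h9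
    have hl : o + (e₁.code true d).length + (addrCode k d).length + (e₂.code true (d + 1)).length +
        [Instr.store (tmp d) (tmp (d + 1))].length = o + (code true (write k e₁ e₂) o d).length := by
      simp [code, Nat.add_assoc]
    rw [hl] at h10
    refine ⟨_, _, _, ?_, h10, ?_, ?_⟩
    rotate_left
    · simp only [execAll, Instr.exec, List.foldl_cons, List.foldl_nil, eval]
      rw [h7, h8 _ fun d' hd' => by simp [tmp_inj]; omega, b2, h3, h2.base rfl]
      exact h6.put k _ _
    · intro d' hd'
      simp only [execAll, Instr.exec, List.foldl_cons, List.foldl_nil]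
      rw [h8 _ fun d'' hd'' => by simp [tmp_inj]; omega,
        b3 _ fun d'' hd'' => by simp [tmp_inj]; omega,
        h4 _ fun d'' hd'' => by simp [tmp_inj]; omega]
    · have := e₁.code_length true d
      have := e₂.code_length true (d + 1)
      simp [cost, addrCode]; omega
  | seq c₁ c₂ ih₁ ih₂ =>
    intro s o d R m hP h hg
    simp only [noArr, Bool.and_eq_true] at hg
    simp only [code] at hP
    obtain ⟨k1, R1, m1, h1, h2, h3, h4⟩ := ih₁ hP.left h fun h => (hg h).1
    obtain ⟨k2, R2, m2, h5, h6, h7, h8⟩ := ih₂ hP.right h3 fun h => (hg h).2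
    refine ⟨k1 + k2, R2, m2, ?_, h2.trans ?_, h7, fun d' hd' => by rw [h8 _ hd', h4 _ hd']⟩
    · simp only [cost]; omega
    · simp only [code, List.length_append]
      rw [← Nat.add_assoc]; exact h6
  | ifz e c₁ c₂ ih₁ ih₂ =>
    intro s o d R m hP h hg
    simp only [noArr, Bool.and_eq_true] at hg
    simp only [code] at hP
    obtain ⟨R1, h1, h2, h3, h4⟩ := e.code_steps hP.left h fun h => (hg h).1.1
    have hJ := steps_jump R1 m hP.right.left
    have hB := hP.right.right.left
    have hX := hP.right.right.right.left
    have hA := hP.right.right.right.right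
    have hlen := e.code_length g d
    have hl : (code g (ifz e c₁ c₂) o d).length = (e.code g d).length + 1 +
        (c₂.code g (o + (e.code g d).length + 1) d).length + 2 + (c₁.code g (o +
        (e.code g d).length + 1 + (c₂.code g (o + (e.code g d).length + 1) d).length + 2)
        d).length := by
      simp only [code, List.length_append, List.length_cons, List.length_nil]
      omega
    by_cases hz : e.val X s = 0
    · rw [h3, if_pos hz] at hJ
      simp only [List.length_cons, List.length_nil, Nat.zero_add, Nat.reduceAdd] at hA
      obtain ⟨k1, R2, m2, h5, h6, h7, h8⟩ := ih₁ hA h2 fun h => (hg h).1.2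
      have h10 := (h1.trans hJ).trans h6
      rw [show o + (e.code g d).length + 1 + (c₂.code g (o + (e.code g d).length + 1) d).length + 2 +
        (c₁.code g (o + (e.code g d).length + 1 +
        (c₂.code g (o + (e.code g d).length + 1) d).length + 2) d).length
        = o + (code g (ifz e c₁ c₂) o d).length by rw [hl]; omega] at h10
      refine ⟨_, R2, m2, ?_, h10, ?_, ?_⟩
      rotate_left
      · simp only [eval, if_pos hz]; exact h7
      · intro d' hd'
        rw [h8 _ hd', h4 _ fun d'' hd'' => by simp [tmp_inj]; omega]
      · simp only [cost, if_pos hz]; omega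
    · rw [h3, if_neg hz] at hJ
      obtain ⟨k1, R2, m2, h5, h6, h7, h8⟩ := ih₂ hB h2 fun h => (hg h).2
      -- Behind the second branch, a zero is loaded and tested in order to skip the code of the
      -- first branch.
      have hS := steps_straight [Instr.const (tmp d) 0] (R2, m2) (Has.left (l' := [_]) hX)
        (by simp [Instr.straight])
      have hJ' := steps_jump (execAll [Instr.const (tmp d) 0] (R2, m2)).1
        (execAll [Instr.const (tmp d) 0] (R2, m2)).2 (Has.right (l := [_]) hX)
      rw [if_pos (by simp [execAll, Instr.exec])] at hJ'
      have h10 := (((h1.trans hJ).trans h6).trans hS).trans hJ'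
      rw [show o + (e.code g d).length + 1 + (c₂.code g (o + (e.code g d).length + 1) d).length + 2 +
        (c₁.code g (o + (e.code g d).length + 1 +
        (c₂.code g (o + (e.code g d).length + 1) d).length + 2) d).length
        = o + (code g (ifz e c₁ c₂) o d).length by rw [hl]; omega] at h10
      refine ⟨_, _, _, ?_, h10, ?_, ?_⟩
      rotate_left
      · simp only [eval, if_neg hz]
        refine h7.congr fun r hr => ?_
        simp [execAll, Instr.exec, Function.update_of_ne (hr d)]
      · intro d' hd'
        have : tmp d' ≠ tmp d := by simp [tmp_inj]; omega
        simp only [execAll, Instr.exec, List.foldl_cons, List.foldl_nil]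
        rw [Function.update_of_ne this, h8 _ hd', h4 _ fun d'' hd'' => by simp [tmp_inj]; omega]
      · simp only [cost, if_neg hz, List.length_cons, List.length_nil]; omega
  | loop i n c ih =>
    intro s o d R m hP h hg
    simp only [code] at hP
    set C := c.code g (o + 6) (d + 2) with hC
    have e1 : tmp d ≠ tmp (d + 1) := by simp [tmp_inj]
    have e2 : tmp (d + 1) ≠ tmp (d + 2) := by simp [tmp_inj]
    have e3 : tmp d ≠ tmp (d + 2) := by simp [tmp_inj]
    have hI := hP.left
    have hJ := hP.right.left
    have hS := hP.right.right.left
    have hB := hP.right.right.right.left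
    have hT := hP.right.right.right.right.left
    have hK := hP.right.right.right.right.right
    simp only [List.length_cons, List.length_nil, Nat.zero_add, Nat.add_assoc, Nat.reduceAdd] at *
    have k1 := steps_straight _ (R, m) hI (by simp [Instr.straight])
    set R1 := (execAll [Instr.const (tmp d) 0, .add (tmp d) (tmp d) (rv n), .const (tmp (d + 1)) 0,
        .add (tmp (d + 1)) (tmp d) (tmp (d + 1))] (R, m)).1 with hR1
    have r1 : R1 (tmp d) = s.reg n := by
      simp [hR1, execAll, Instr.exec, Function.update_apply, e1, rv_ne_tmp, h.var]
    have r2 : R1 (tmp (d + 1)) = s.reg n := by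
      simp [hR1, execAll, Instr.exec, Function.update_apply, e1, rv_ne_tmp, h.var]
    have r3 : ∀ r, r ≠ tmp d → r ≠ tmp (d + 1) → R1 r = R r := by
      intro r h h'
      simp [hR1, execAll, Instr.exec, Function.update_apply, h, h']
    have hm1 : (execAll [Instr.const (tmp d) 0, .add (tmp d) (tmp d) (rv n), .const (tmp (d + 1)) 0,
        .add (tmp (d + 1)) (tmp d) (tmp (d + 1))] (R, m)).2 = m := rfl
    rw [hm1] at k1
    simp only [List.length_cons, List.length_nil, Nat.zero_add, Nat.reduceAdd] at k1
    set f : ℕ → St → St := fun j t => c.eval X (t.set i j) with hf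
    -- Loop invariant at the test instruction, which stands at o + 4: after j rounds the bound is
    -- still stored and n - j rounds remain. The 4 steps of set-up and the final jump add up to the
    -- 5 in the cost; each round pays 6 for its administration.
    have main : ∀ j ≤ s.reg n, ∃ k R' m',
        k ≤ 4 + ∑ j ∈ Finset.range j, (6 + c.cost X ((iter f j s).set i j)) ∧
        Steps P k ⟨o, R, m⟩ ⟨o + 4, R', m'⟩ ∧ Sim g B X (iter f j s) R' m' ∧
        R' (tmp d) = s.reg n ∧ R' (tmp (d + 1)) = s.reg n - j ∧
        ∀ d' < d, R' (tmp d') = R (tmp d') := by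
      intro j
      induction j with
      | zero =>
        intro _
        refine ⟨4, R1, m, by simp, k1, h.congr fun r hr => r3 r (hr d) (hr (d + 1)), r1, r2, ?_⟩
        intro d' hd'
        exact r3 _ (by simp [tmp_inj]; omega) (by simp [tmp_inj]; omega)
      | succ j ihj =>
        intro hj
        obtain ⟨k, R2, m2, a1, a2, a3, a4, a5, a6⟩ := ihj (by omega)
        have b1 := steps_jump R2 m2 hJ
        rw [if_neg (by omega)] at b1
        have b2 := steps_straight _ (R2, m2) hS (by simp [Instr.straight])
        simp only [execAll, Instr.exec, List.foldl_cons, List.foldl_nil, a4, a5,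
          Nat.sub_sub_self (show j ≤ s.reg n by omega), List.length_cons, List.length_nil,
          Nat.zero_add, Nat.add_assoc, Nat.reduceAdd] at b1 b2
        have b3 : Sim g B X ((iter f j s).set i j) (Function.update R2 (rv i) j) m2 :=
          a3.set i j (by simp) fun r hr _ => by simp [hr]
        obtain ⟨k', R3, m3, c1, c2, c3, c4⟩ := ih hB b3 hg
        have d1 := steps_straight _ (R3, m3) hT (by simp [Instr.straight])
        set R4 := (execAll [Instr.const (tmp (d + 2)) 1,
          .sub (tmp (d + 1)) (tmp (d + 1)) (tmp (d + 2)), .const (tmp (d + 2)) 0] (R3, m3)).1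
          with hR4
        have hm4 : (execAll [Instr.const (tmp (d + 2)) 1,
          .sub (tmp (d + 1)) (tmp (d + 1)) (tmp (d + 2)), .const (tmp (d + 2)) 0] (R3, m3)).2 = m3 :=
          rfl
        rw [hm4] at d1
        have x1 : R4 (tmp (d + 2)) = 0 := by simp [hR4, execAll, Instr.exec]
        have x2 : R4 (tmp (d + 1)) = R3 (tmp (d + 1)) - 1 := by
          simp [hR4, execAll, Instr.exec, Function.update_apply, e2]
        have x3 : ∀ r, r ≠ tmp (d + 1) → r ≠ tmp (d + 2) → R4 r = R3 r := by
          intro r h h'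
          simp [hR4, execAll, Instr.exec, Function.update_apply, h, h']
        have d2 := steps_jump R4 m3 hK
        rw [if_pos x1] at d2
        simp only [List.length_cons, List.length_nil, Nat.zero_add, Nat.add_assoc, Nat.reduceAdd]
          at d1 d2
        have c2' : Steps P k' ⟨o + 6, Function.update R2 (rv i) j, m2⟩
            ⟨o + (6 + C.length), R3, m3⟩ := by
          rw [← Nat.add_assoc]; exact c2
        refine ⟨k + 1 + 1 + k' + 3 + 1, R4, m3, ?_,
          ((((a2.trans b1).trans b2).trans c2').trans d1).trans d2, ?_, ?_, ?_, ?_⟩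
        · rw [Finset.sum_range_succ]; omega
        · exact c3.congr fun r hr => x3 r (hr _) (hr _)
        · rw [x3 _ e1 e3, c4 d (by omega), Function.update_of_ne (tmp_ne_rv i d), a4]
        · rw [x2, c4 (d + 1) (by omega), Function.update_of_ne (tmp_ne_rv i _), a5]; omega
        · intro d' hd'
          rw [x3 _ (by simp [tmp_inj]; omega) (by simp [tmp_inj]; omega), c4 d' (by omega),
            Function.update_of_ne (tmp_ne_rv i _), a6 d' hd']
    obtain ⟨k, R2, m2, a1, a2, a3, a4, a5, a6⟩ := main _ le_rfl
    have b1 := steps_jump R2 m2 hJ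
    rw [if_pos (by omega)] at b1
    refine ⟨k + 1, R2, m2, ?_, a2.trans ?_, a3, a6⟩
    · simp only [cost, ← hf]
      omega
    · have : (code g (loop i n c) o d).length = 10 + C.length := by
        simp only [code, List.length_append, List.length_cons, List.length_nil, ← hC]
        omega
      rw [this]
      exact b1

end SecondOrder

namespace SecondOrder

/-! ### Whole programs -/

/-- The program that executes `pre` without arrays, moves the value of `len` to register `0`,
executes `main` with arrays, and answers yes if `ans` is not zero. -/
def program (pre main : Cmd) : List Instr :=
  let A := pre.code false 0 0
  let B := main.code true (A.length + 2) 0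
  A ++ ([.const (tmp 0) 0, .add 0 (rv .len) (tmp 0)] ++ (B ++
    ([.jumpZero (rv .ans) (A.length + 2 + B.length + 2)] ++ [.accept, .reject])))

theorem run_mono {P : List Instr} {k l : ℕ} {c c' : Config} {b : Bool} (h : Steps P k c c')
    (h' : run P l c' = some b) : run P (k + l) c = some b := by rw [h, h']

/-- The state in which all variables and array entries are zero. -/
def St.zero : St := ⟨fun _ => 0, fun _ _ => 0⟩

theorem Cmd.eval_arr_of_noArr (X : ℕ → ℕ) (c : Cmd) : ∀ (s : St), c.noArr = true →
    (c.eval X s).arr = s.arr := by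
  induction c with
  | skip => intro s _; rfl
  | assign v e => intro s _; rfl
  | write k e₁ e₂ => intro s h; simp [noArr] at h
  | seq a b iha ihb =>
    intro s h
    simp only [noArr, Bool.and_eq_true] at h
    simp only [eval]
    rw [ihb _ h.2, iha _ h.1]
  | ifz e a b iha ihb =>
    intro s h
    simp only [noArr, Bool.and_eq_true] at h
    simp only [eval]
    split
    · exact iha _ h.1.2
    · exact ihb _ h.2
  | loop i n c ih =>
    intro s h
    simp only [eval]
    generalize s.reg n = N
    induction N with
    | zero => rfl
    | succ N ihN => simp only [iter]; rw [ih _ h]; exact ihN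

/-- The first stage determines where the input ends and must do so without arrays. Its result `len`
becomes the base address for the second stage; an upper bound for the length of the input is good
enough. -/
theorem run_program (pre main : Cmd) (x : List ℕ) (hpre : pre.noArr = true)
    (hlen : x.length ≤ (pre.eval (fun i => x.getD i 0) St.zero).reg .len) :
    ∃ t ≤ pre.cost (fun i => x.getD i 0) St.zero +
        main.cost (fun i => x.getD i 0) (pre.eval (fun i => x.getD i 0) St.zero) + 4,
      run (program pre main) t (Config.initial x) = some (decide ((main.eval (fun i => x.getD i 0)
        (pre.eval (fun i => x.getD i 0) St.zero)).reg .ans ≠ 0)) := by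
  set X : ℕ → ℕ := fun i => x.getD i 0 with hX
  set P := program pre main with hP
  have h0 : Has P 0 P := ⟨[], [], by simp, rfl⟩
  nth_rw 2 [hP] at h0
  simp only [program] at h0
  set A := pre.code false 0 0 with hA
  set B := main.code true (A.length + 2) 0 with hB
  have s0 : Sim false 0 X St.zero (Config.initial x).reg (Config.initial x).mem :=
    ⟨fun v => rfl, by simp, fun a _ => rfl, by simp, by simp⟩
  obtain ⟨k1, R1, m1, a1, a2, a3, a4⟩ := pre.code_steps h0.left s0 fun _ => hpre
  set s1 := pre.eval X St.zero with hs1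
  have b1 := steps_straight _ (R1, m1) h0.right.left (by simp [Instr.straight])
  simp only [execAll, Instr.exec, List.foldl_cons, List.foldl_nil, List.length_cons,
    List.length_nil, Nat.zero_add, Nat.reduceAdd] at b1
  have e1 : rv .len ≠ tmp 0 := rv_ne_tmp _ _
  simp only [Function.update_of_ne e1, Function.update_self, Nat.add_zero] at b1
  have hz : s1.arr = St.zero.arr := pre.eval_arr_of_noArr X _ hpre
  -- All memory behind the input is still zero, so the arrays start out as zero without any
  -- initialisation. For the table of visited nodes this saves time as well as code.
  have c0 : Sim true (s1.reg .len) X s1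
      (Function.update (Function.update R1 (tmp 0) 0) 0 (R1 (rv .len))) m1 := by
    refine ⟨fun v => ?_, fun _ => ?_, fun a _ => a3.input a (by simp), fun _ a ha => ?_,
      fun _ k i => ?_⟩
    · rw [Function.update_of_ne (zero_ne_rv v).symm, Function.update_of_ne (rv_ne_tmp v 0), a3.var]
    · simp [a3.var]
    · simp only [hX]
      rw [List.getD_eq_default]; omega
    · rw [hz, a3.input _ (by simp)]
      simp only [hX, St.zero]
      rw [List.getD_eq_default]; omega
  have hBP := h0.right.right.left
  simp only [List.length_cons, List.length_nil, Nat.zero_add, Nat.reduceAdd] at hBP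
  obtain ⟨k2, R2, m2, c1, c2, c3, c4⟩ := main.code_steps hBP c0 (by simp)
  set s2 := main.eval X s1 with hs2
  have hJ := h0.right.right.right.left
  have hE := h0.right.right.right.right
  have hE' := Has.right (l := [Instr.accept]) hE
  have hh := hE.head
  have hh' := hE'.head
  simp only [List.length_cons, List.length_nil, Nat.zero_add, Nat.reduceAdd] at hJ hh hh'
  have d1 := steps_jump R2 m2 hJ
  rw [c3.var] at d1
  simp only [Nat.zero_add] at a2
  have key := ((a2.trans b1).trans c2).trans d1
  refine ⟨k1 + 2 + k2 + 1 + 1, by omega, run_mono key ?_⟩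
  by_cases hans : s2.reg .ans = 0
  · simp [hans, run, hh']
  · simp [hans, run, hh]

/-! ### Frames -/

/-- Whether a command may change a variable. -/
def Cmd.wr : Cmd → Var → Bool
  | skip, _ => false
  | assign v _, u => u == v
  | write _ _ _, _ => false
  | seq a b, u => a.wr u || b.wr u
  | ifz _ a b, u => a.wr u || b.wr u
  | loop i _ c, u => u == i || c.wr u

/-- Whether a command may change an array. -/
def Cmd.wa : Cmd → Arr → Bool
  | skip, _ => false
  | assign _ _, _ => false
  | write k _ _, l => l == k
  | seq a b, u => a.wa u || b.wa u
  | ifz _ a b, u => a.wa u || b.wa u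
  | loop _ _ c, u => c.wa u

theorem Cmd.eval_seq (X : ℕ → ℕ) (a b : Cmd) (s : St) :
    (seq a b).eval X s = b.eval X (a.eval X s) := rfl

theorem Cmd.eval_ifz_pos {X : ℕ → ℕ} {e : Exp} {s : St} (h : e.val X s = 0) (a b : Cmd) :
    (ifz e a b).eval X s = a.eval X s := if_pos h

theorem Cmd.eval_ifz_neg {X : ℕ → ℕ} {e : Exp} {s : St} (h : e.val X s ≠ 0) (a b : Cmd) :
    (ifz e a b).eval X s = b.eval X s := if_neg h

theorem iter_ind {S : Type*} (f : ℕ → S → S) (I : ℕ → S → Prop) {s : S} (n : ℕ) (h0 : I 0 s)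
    (hs : ∀ i < n, ∀ t, I i t → I (i + 1) (f i t)) : I n (iter f n s) := by
  induction n with
  | zero => exact h0
  | succ n ih => exact hs n (by omega) _ (ih fun i hi => hs i (by omega))

/-- Whether a command can change a variable is decided by computation on its syntax. Most framing
obligations below therefore close by `rfl`. -/
theorem Cmd.reg_frame (X : ℕ → ℕ) (c : Cmd) : ∀ (s : St) {u : Var}, c.wr u = false →
    (c.eval X s).reg u = s.reg u := by
  induction c with
  | skip => intro s u _; rfl
  | assign v e => intro s u h; simp [wr] at h; simp [eval, h]
  | write k e₁ e₂ => intro s u h; rfl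
  | seq a b iha ihb =>
    intro s u h
    simp only [wr, Bool.or_eq_false_iff] at h
    simp only [eval]
    rw [ihb _ h.2, iha _ h.1]
  | ifz e a b iha ihb =>
    intro s u h
    simp only [wr, Bool.or_eq_false_iff] at h
    simp only [eval]
    split
    · exact iha _ h.1
    · exact ihb _ h.2
  | loop i n c ih =>
    intro s u h
    simp only [wr, Bool.or_eq_false_iff, beq_eq_false_iff_ne] at h
    refine iter_ind _ (fun _ (t : St) => t.reg u = s.reg u) _ rfl fun j _ t ht => ?_
    rw [ih _ h.2, St.set_reg, if_neg h.1, ht]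

theorem Cmd.arr_frame (X : ℕ → ℕ) (c : Cmd) : ∀ (s : St) {u : Arr}, c.wa u = false →
    (c.eval X s).arr u = s.arr u := by
  induction c with
  | skip => intro s u _; rfl
  | assign v e => intro s u h; rfl
  | write k e₁ e₂ => intro s u h; simp [wa] at h; simp [eval, h]
  | seq a b iha ihb =>
    intro s u h
    simp only [wa, Bool.or_eq_false_iff] at h
    simp only [eval]
    rw [ihb _ h.2, iha _ h.1]
  | ifz e a b iha ihb =>
    intro s u h
    simp only [wa, Bool.or_eq_false_iff] at h
    simp only [eval]
    split
    · exact iha _ h.1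
    · exact ihb _ h.2
  | loop i n c ih =>
    intro s u h
    refine iter_ind _ (fun _ (t : St) => t.arr u = s.arr u) _ rfl fun j _ t ht => ?_
    rw [ih _ h, St.set_arr, ht]

/-- `t` agrees with `s` outside of what `c` may change, apart from the variable `i`. -/
structure Frame (c : Cmd) (i : Var) (s t : St) : Prop where
  reg : ∀ u, c.wr u = false → u ≠ i → t.reg u = s.reg u
  arr : ∀ k, c.wa k = false → t.arr k = s.arr k

theorem Frame.refl (c : Cmd) (i : Var) (s : St) : Frame c i s s := ⟨fun _ _ _ => rfl, fun _ _ => rfl⟩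

theorem Frame.step {c : Cmd} {i : Var} {s t : St} (X : ℕ → ℕ) (j : ℕ) (h : Frame c i s t) :
    Frame c i s (c.eval X (t.set i j)) where
  reg u hu hi := by rw [c.reg_frame X _ hu, St.set_reg, if_neg hi, h.reg u hu hi]
  arr k hk := by rw [c.arr_frame X _ hk, St.set_arr, h.arr k hk]

/-- The bound of a loop is read once, on entry. The invariant may use that everything the body
cannot write still has its value from before the loop. -/
theorem eval_loop_ind {X : ℕ → ℕ} {i n : Var} {c : Cmd} {s : St} (I : ℕ → St → Prop) (h0 : I 0 s)
    (hs : ∀ j < s.reg n, ∀ t, Frame c i s t → I j t → I (j + 1) (c.eval X (t.set i j))) :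
    I (s.reg n) ((Cmd.loop i n c).eval X s) := by
  refine (iter_ind _ (fun j t => Frame c i s t ∧ I j t) _ ⟨Frame.refl c i s, h0⟩ ?_).2
  rintro j hj t ⟨h1, h2⟩
  exact ⟨h1.step X j, hs j hj t h1 h2⟩

/-- Relates a loop to a fold over `Fin N`, the form in which `upd` and `Node.key` are defined. -/
theorem eval_loop_foldl {X : ℕ → ℕ} {i n : Var} {c : Cmd} {s : St} {β : Type*} {N : ℕ}
    (hN : s.reg n = N) (R : St → β → Prop) (f : β → Fin N → β) {b : β} (h0 : R s b)
    (hs : ∀ (j : Fin N) t b, Frame c i s t → R t b → R (c.eval X (t.set i j)) (f b j)) :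
    R ((Cmd.loop i n c).eval X s) ((List.finRange N).foldl f b) := by
  have := eval_loop_ind (X := X) (i := i) (n := n) (c := c) (s := s)
    (fun j t => R t (((List.finRange N).take j).foldl f b)) (by simpa using h0) ?_
  · rw [hN, List.take_of_length_le (by simp)] at this
    exact this
  · intro j hj t hF ht
    rw [hN] at hj
    rw [List.take_add_one, List.foldl_append]
    have : (List.finRange N)[j]?.toList = [⟨j, hj⟩] := by simp [hj]
    rw [this]
    exact hs ⟨j, hj⟩ t _ hF ht

/-! ### Static bounds for the running time -/

/-- The constant factor in the running time. -/
def Cmd.K : Cmd → ℕ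
  | skip => 0
  | assign _ e => e.cost + 2
  | write _ e₁ e₂ => e₁.cost + e₂.cost + 9
  | seq a b => a.K + b.K
  | ifz e a b => e.cost + 3 + (a.K + b.K)
  | loop _ _ c => 11 + c.K

/-- The number of nested loops with bound `v`. -/
def Cmd.deg : Cmd → Var → ℕ
  | seq a b, v => max (a.deg v) (b.deg v)
  | ifz _ a b, v => max (a.deg v) (b.deg v)
  | loop _ n c, v => c.deg v + if v = n then 1 else 0
  | _, _ => 0

/-- All loop bounds are in `F` and not changed. -/
def Cmd.static (F : Finset Var) : Cmd → Bool
  | skip => true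
  | assign v _ => decide (v ∉ F)
  | write _ _ _ => true
  | seq a b => a.static F && b.static F
  | ifz _ a b => a.static F && b.static F
  | loop i n c => decide (i ∉ F) && decide (n ∈ F) && c.static F

theorem Cmd.wr_of_static {F : Finset Var} (c : Cmd) (h : c.static F = true) {v : Var}
    (hv : v ∈ F) : c.wr v = false := by
  induction c with
  | skip => rfl
  | assign u e =>
    simp only [static, decide_eq_true_eq] at h
    simp only [wr, beq_eq_false_iff_ne]
    rintro rfl; exact h hv
  | write k e₁ e₂ => rfl
  | seq a b iha ihb =>
    simp only [static, Bool.and_eq_true] at h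
    simp [wr, iha h.1, ihb h.2]
  | ifz e a b iha ihb =>
    simp only [static, Bool.and_eq_true] at h
    simp [wr, iha h.1, ihb h.2]
  | loop i n c ih =>
    simp only [static, Bool.and_eq_true, decide_eq_true_eq] at h
    simp only [wr, ih h.2, Bool.or_false, beq_eq_false_iff_ne]
    rintro rfl; exact h.1.1 hv

/-- Every loop bound is a variable that the command never changes, so a loop contributes a factor `ρ
n`, and sequential parts are bounded by the larger exponents. No analysis of values is needed. -/
theorem Cmd.cost_le (X : ℕ → ℕ) {F : Finset Var} {ρ : Var → ℕ} (h1 : ∀ v ∈ F, 1 ≤ ρ v) (c : Cmd) :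
    ∀ s : St, c.static F = true → (∀ v ∈ F, s.reg v ≤ ρ v) →
      c.cost X s ≤ c.K * ∏ v ∈ F, ρ v ^ c.deg v := by
  have pos : ∀ e : Var → ℕ, 1 ≤ ∏ v ∈ F, ρ v ^ e v := fun e =>
    Finset.one_le_prod' fun v hv => Nat.one_le_pow _ _ (h1 v hv)
  have mono : ∀ e e' : Var → ℕ, (∀ v, e v ≤ e' v) → ∏ v ∈ F, ρ v ^ e v ≤ ∏ v ∈ F, ρ v ^ e' v :=
    fun e e' h => Finset.prod_le_prod' fun v hv => Nat.pow_le_pow_right (h1 v hv) (h v)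
  induction c with
  | skip => intro s _ _; simp [cost]
  | assign v e =>
    intro s _ _
    simp only [cost, K]
    exact Nat.le_mul_of_pos_right _ (pos _)
  | write k e₁ e₂ =>
    intro s _ _
    simp only [cost, K]
    exact Nat.le_mul_of_pos_right _ (pos _)
  | seq a b iha ihb =>
    intro s h hs
    simp only [static, Bool.and_eq_true] at h
    have ha := iha s h.1 hs
    have hb := ihb (a.eval X s) h.2 fun v hv => by
      rw [a.reg_frame X _ (a.wr_of_static h.1 hv)]; exact hs v hv
    have ma := mono a.deg (seq a b).deg fun v => by simp [deg]
    have mb := mono b.deg (seq a b).deg fun v => by simp [deg]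
    simp only [cost, K, add_mul]
    exact add_le_add (ha.trans (Nat.mul_le_mul_left _ ma)) (hb.trans (Nat.mul_le_mul_left _ mb))
  | ifz e a b iha ihb =>
    intro s h hs
    simp only [static, Bool.and_eq_true] at h
    have ha := iha s h.1 hs
    have hb := ihb s h.2 hs
    have ma := mono a.deg (ifz e a b).deg fun v => by simp [deg]
    have mb := mono b.deg (ifz e a b).deg fun v => by simp [deg]
    have ha' := ha.trans (Nat.mul_le_mul_left _ ma)
    have hb' := hb.trans (Nat.mul_le_mul_left _ mb)
    simp only [cost, K]
    rw [add_mul (e.cost + 3), add_mul a.K]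
    refine add_le_add (Nat.le_mul_of_pos_right _ (pos _)) ?_
    split
    · omega
    · omega
  | loop i n c ih =>
    intro s h hs
    simp only [static, Bool.and_eq_true, decide_eq_true_eq] at h
    obtain ⟨⟨hi, hn⟩, hc⟩ := h
    have hprod : ∏ v ∈ F, ρ v ^ (loop i n c).deg v = (∏ v ∈ F, ρ v ^ c.deg v) * ρ n := by
      simp only [deg, pow_add, Finset.prod_mul_distrib]
      congr 1
      rw [Finset.prod_eq_single n]
      · simp
      · intro v _ hv; simp [hv]
      · intro h; exact absurd hn h
    have hframe : ∀ j, ∀ v ∈ F, ((iter (fun j t => c.eval X (t.set i j)) j s).set i j).reg v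
        ≤ ρ v := by
      intro j v hv
      rw [St.set_reg, if_neg (by rintro rfl; exact hi hv)]
      refine le_trans (le_of_eq ?_) (hs v hv)
      refine iter_ind _ (fun _ (t : St) => t.reg v = s.reg v) j rfl fun j _ t ht => ?_
      rw [c.reg_frame X _ (c.wr_of_static hc hv), St.set_reg,
        if_neg (by rintro rfl; exact hi hv), ht]
    have hsum : ∑ j ∈ Finset.range (s.reg n),
        (6 + c.cost X ((iter (fun j t => c.eval X (t.set i j)) j s).set i j)) ≤
        s.reg n * (6 + c.K * ∏ v ∈ F, ρ v ^ c.deg v) := by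
      refine (Finset.sum_le_card_nsmul _ _ _ fun j _ => Nat.add_le_add_left
        (ih _ hc (hframe j)) 6).trans ?_
      simp
    simp only [cost, K]
    rw [hprod]
    have hp := pos c.deg
    set Q := ∏ v ∈ F, ρ v ^ c.deg v
    have hn1 := h1 n hn
    have hns := hs n hn
    -- The overhead 5 + 6 n is charged to the product of all bounds, which is at least 1; this is
    -- where the 11 in `Cmd.K` comes from.
    calc _ ≤ 5 + s.reg n * (6 + c.K * Q) := by omega
      _ ≤ 5 * (Q * ρ n) + ρ n * (6 * Q + c.K * Q) := by
          gcongr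
          · exact Nat.le_mul_of_pos_right _ (Nat.mul_pos hp hn1)
          · exact Nat.le_mul_of_pos_right _ hp
      _ = (11 + c.K) * (Q * ρ n) := by ring

end SecondOrder

namespace SecondOrder

/-! ### Processing a pair of transitions -/

infixr:60 "⨾" => Cmd.seq
infix:62 "≔" => Cmd.assign
prefix:max "♯" => Exp.var

section code
open Var Arr Cmd Exp

/-- `v := a * n`. -/
def mulC (v a n : Var) : Cmd := v ≔ 0 ⨾ loop k n (v ≔ ♯v + ♯a)

/-- Splits the index `y` into a side and a macro state. -/
def decC : Cmd :=
  ifz (♯y + 1 - ♯N) (m ≔ ♯y ⨾ L ≔ ♯p1 ⨾ off ≔ 0) (m ≔ ♯y - ♯N ⨾ L ≔ ♯p2 ⨾ off ≔ ♯N) ⨾ mulC mw m w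

/-- The weight of the set of successors of a macro state. -/
def stepC : Cmd :=
  r ≔ 0 ⨾ loop q w (
    (f ≔ 0 ⨾ loop p w (
      ifz (rd memb (♯mw + ♯p)) skip (
        mulC t p s ⨾ t ≔ ♯t + ♯a ⨾ mulC ad t w ⨾
        ifz (inp (♯L + 3 + ♯w + ♯w + ♯w + ♯w + ♯ad + ♯q)) skip (f ≔ 1)))) ⨾
    ifz ♯f skip (r ≔ ♯r + rd wt ♯q))

/-- Replaces numbers that are not macro states by `0`. -/
def clampC : Cmd := ifz (♯r + 1 - ♯N) skip (r ≔ 0)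

/-- The successor `r` of the index `y` under the symbol `a`. -/
def deltaC : Cmd := decC ⨾ stepC ⨾ clampC ⨾ r ≔ ♯r + ♯off

/-- Whether the index `y` stands for a set that contains a final state. -/
def finC : Cmd :=
  decC ⨾ f ≔ 0 ⨾ loop p w (ifz (rd memb (♯mw + ♯p)) skip (
    ifz (inp (♯L + 3 + ♯w + ♯w + ♯w + ♯p)) skip (f ≔ 1)))

/-- The weight of the set whose bits are at address `ad`. -/
def weightC : Cmd := r ≔ 0 ⨾ loop q w (ifz (inp (♯ad + ♯q)) skip (r ≔ ♯r + rd wt ♯q))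

/-- The number `r` of the set whose bits are at address `ad`. -/
def encC : Cmd := weightC ⨾ clampC

/-- The partition before the transition. -/
def baseC : Cmd :=
  ifz (inp (♯p1 + 1)) (loop x M (write b ♯x (rd c ♯x)))
    (loop x M (write b ♯x ♯x) ⨾ ad ≔ ♯p1 + 3 + ♯w + ♯w ⨾ encC ⨾ u ≔ ♯r ⨾
      ad ≔ ♯p2 + 3 + ♯w + ♯w ⨾ encC ⨾ write b ♯u (♯r + ♯N))

/-- Joins the classes of `u` and `v`. -/
def unionC : Cmd :=
  cu ≔ rd cn ♯u ⨾ cv ≔ rd cn ♯v ⨾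
  loop z M (ifz ((rd cn ♯z - ♯cu) + (♯cu - rd cn ♯z)) (write cn ♯z ♯cv) skip)

/-- The partition after the transition. -/
def updC : Cmd :=
  loop x M (write cn ♯x ♯x) ⨾
  loop a s (loop x M (
    (y ≔ ♯x ⨾ deltaC ⨾ u ≔ ♯r) ⨾ (y ≔ rd b ♯x ⨾ deltaC ⨾ v ≔ ♯r) ⨾ unionC))

/-- Whether the pair of transitions witnesses a common language. -/
def checkC : Cmd :=
  (ok ≔ 0 ⨾ ifz (inp (♯ac1 + ♯g1)) skip (ifz (inp (♯ac2 + ♯g2)) skip (ok ≔ 1))) ⨾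
  loop x M ((y ≔ ♯x ⨾ finC ⨾ fx ≔ ♯f) ⨾ (y ≔ rd cn ♯x ⨾ finC) ⨾
    ifz ((♯f - ♯fx) + (♯fx - ♯f)) skip (ok ≔ 0)) ⨾
  ifz ♯ok skip (ans ≔ 1)

end code

variable {α : Type*} {w S : ℕ}

open Classical in
/-- The successors of a set of states. -/
noncomputable def stepS (B : Layer α w) (a : α) (A : Finset (Fin w)) : Finset (Fin w) :=
  Finset.univ.filter fun q => ∃ p ∈ A, (p, a, q) ∈ B.trans

/-- The macro state `m` as a set, for the table `MB` of members. -/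
def decS (w : ℕ) (MB : ℕ → ℕ) (m : ℕ) : Finset (Fin w) :=
  Finset.univ.filter fun p => MB (m * w + p) ≠ 0

/-- A set as a macro state, for the weights `WT`. -/
def encS (N : ℕ) (WT : ℕ → ℕ) (A : Finset (Fin w)) : ℕ :=
  if ∑ q ∈ A, WT q < N then ∑ q ∈ A, WT q else 0

theorem encS_lt {N : ℕ} [NeZero N] (WT : ℕ → ℕ) (A : Finset (Fin w)) : encS N WT A < N := by
  unfold encS; split
  · assumption
  · exact Nat.pos_of_ne_zero (NeZero.ne N)

/-- The layer of a transition that is listed at address `p`. -/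
structure IsLayerAt (X : ℕ → ℕ) (e : α ≃ Fin S) (p : ℕ) (B : Layer α w) : Prop where
  initFlag : X (p + 1) = bit (B.initFlag = true)
  init : ∀ q : Fin w, X (p + 3 + w + w + q) = bit (q ∈ B.init)
  final : ∀ q : Fin w, X (p + 3 + w + w + w + q) = bit (q ∈ B.final)
  trans : ∀ (p' : Fin w) (a : α) (q : Fin w),
    X (p + 3 + w + w + w + w + (p' * S + e a) * w + q) = bit ((p', a, q) ∈ B.trans)

theorem bit_ne_zero {P : Prop} : bit P ≠ 0 ↔ P := by unfold bit; split <;> simp_all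
theorem bit_eq_zero {P : Prop} : bit P = 0 ↔ ¬ P := by unfold bit; split <;> simp_all
theorem bit_congr {P Q : Prop} (h : P ↔ Q) : bit P = bit Q := by rw [propext h]
theorem bit_true {P : Prop} (h : P) : bit P = 1 := by unfold bit; rw [if_pos h]
theorem bit_false {P : Prop} (h : ¬ P) : bit P = 0 := by unfold bit; rw [if_neg h]

variable {X : ℕ → ℕ}

/-- Multiplication is repeated addition. The inequalities of variables keep the operands and the
result from being overwritten by the loop. -/
theorem mulC_reg {v a n : Var} (h1 : a ≠ v) (h2 : n ≠ v) (h3 : a ≠ .k) (h4 : v ≠ .k) (t : St) :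
    ((mulC v a n).eval X t).reg v = t.reg a * t.reg n := by
  unfold mulC
  simp only [Cmd.eval_seq]
  have := eval_loop_ind (X := X) (i := .k) (n := n) (c := v ≔ ♯v + ♯a)
    (s := (v ≔ 0).eval X t) (fun j u => u.reg v = t.reg a * j ∧ u.reg a = t.reg a)
    (by simp [Cmd.eval, h1]) ?_
  · rw [this.1]; simp [Cmd.eval, h2]
  · rintro j _ u _ ⟨h, h'⟩
    simp [Cmd.eval, h1, h3, h4, h, h']; ring

/-- With truncated subtraction, `y + 1 - N` vanishes exactly if y < N. This is the test for the
first side. -/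
theorem decC_left (t : St) (h : t.reg .y < t.reg .N) :
    (decC.eval X t).reg .mw = t.reg .y * t.reg .w ∧ (decC.eval X t).reg .L = t.reg .p1 ∧
      (decC.eval X t).reg .off = 0 := by
  have h0 : t.reg .y + 1 - t.reg .N = 0 := by omega
  unfold decC
  rw [Cmd.eval_seq]
  refine ⟨?_, ?_, ?_⟩
  · rw [mulC_reg (by decide) (by decide) (by decide) (by decide)]
    simp [Cmd.eval, h0]
  · rw [Cmd.reg_frame _ _ _ rfl]; simp [Cmd.eval, h0]
  · rw [Cmd.reg_frame _ _ _ rfl]; simp [Cmd.eval, h0]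

theorem decC_right (t : St) (h : ¬ t.reg .y < t.reg .N) :
    (decC.eval X t).reg .mw = (t.reg .y - t.reg .N) * t.reg .w ∧
      (decC.eval X t).reg .L = t.reg .p2 ∧ (decC.eval X t).reg .off = t.reg .N := by
  have h0 : ¬ t.reg .y + 1 - t.reg .N = 0 := by omega
  unfold decC
  rw [Cmd.eval_seq]
  refine ⟨?_, ?_, ?_⟩
  · rw [mulC_reg (by decide) (by decide) (by decide) (by decide)]
    simp [Cmd.eval, h0]
  · rw [Cmd.reg_frame _ _ _ rfl]; simp [Cmd.eval, h0]
  · rw [Cmd.reg_frame _ _ _ rfl]; simp [Cmd.eval, h0]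

/-- The tables and constants needed to process a pair of transitions. -/
structure Env (w S N : ℕ) (WT MB : ℕ → ℕ) (t : St) : Prop where
  eqS : t.reg .s = S
  eqw : t.reg .w = w
  eqN : t.reg .N = N
  eqM : t.reg .M = N + N
  eqwt : t.arr .wt = WT
  eqmb : t.arr .memb = MB

/-- A command does not change the tables and constants. -/
def Cmd.keeps (c : Cmd) : Bool :=
  !c.wr .s && !c.wr .w && !c.wr .N && !c.wr .M && !c.wa .wt && !c.wa .memb

variable {N : ℕ} {WT MB : ℕ → ℕ}

theorem Env.frame {t u : St} {i : Var} {c : Cmd} (h : Env w S N WT MB t) (hF : Frame c i t u)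
    (hc : c.keeps = true) (hi : (Cmd.assign i 0).keeps = true) : Env w S N WT MB u := by
  simp only [Cmd.keeps, Bool.and_eq_true, Bool.not_eq_true'] at hc
  simp only [Cmd.keeps, Cmd.wr, Bool.and_eq_true, Bool.not_eq_true', beq_eq_false_iff_ne,
    Cmd.wa] at hi
  obtain ⟨⟨⟨⟨⟨a1, a2⟩, a3⟩, a4⟩, a5⟩, a6⟩ := hc
  obtain ⟨⟨⟨⟨⟨b1, b2⟩, b3⟩, b4⟩, -⟩, -⟩ := hi
  exact ⟨by rw [hF.reg _ a1 b1, h.eqS], by rw [hF.reg _ a2 b2, h.eqw], by rw [hF.reg _ a3 b3, h.eqN],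
    by rw [hF.reg _ a4 b4, h.eqM], by rw [hF.arr _ a5, h.eqwt], by rw [hF.arr _ a6, h.eqmb]⟩

theorem Env.eval {t : St} (h : Env w S N WT MB t) (c : Cmd) (hc : c.keeps = true) :
    Env w S N WT MB (c.eval X t) :=
  h.frame (i := .k) ⟨fun u hu _ => c.reg_frame X t hu, fun k hk => c.arr_frame X t hk⟩ hc rfl

theorem Env.set {t : St} (h : Env w S N WT MB t) (v : Var) (x : ℕ)
    (hv : (Cmd.assign v 0).keeps = true) : Env w S N WT MB (t.set v x) := by
  simp only [Cmd.keeps, Cmd.wr, Bool.and_eq_true, Bool.not_eq_true', beq_eq_false_iff_ne,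
    Cmd.wa] at hv
  obtain ⟨⟨⟨⟨⟨b1, b2⟩, b3⟩, b4⟩, -⟩, -⟩ := hv
  exact ⟨by simp [b1, h.eqS], by simp [b2, h.eqw], by simp [b3, h.eqN], by simp [b4, h.eqM], h.eqwt, h.eqmb⟩

/-- One round of a loop that adds up the weights of the members of a set in increasing order. -/
theorem sum_fin_range {w j : ℕ} (A : Finset (Fin w)) (g : ℕ → ℕ) (hj : j < w) :
    (∑ q ∈ A.filter (fun q : Fin w => (q : ℕ) < j + 1), g q) =
      (∑ q ∈ A.filter (fun q : Fin w => (q : ℕ) < j), g q) + if (⟨j, hj⟩ : Fin w) ∈ A then g j else 0 := by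
  have h1 : A.filter (fun q : Fin w => (q : ℕ) < j + 1) =
      A.filter (fun q : Fin w => (q : ℕ) < j) ∪ A.filter (fun q : Fin w => q = ⟨j, hj⟩) := by
    ext q
    simp only [Finset.mem_filter, Finset.mem_union, Fin.ext_iff]
    constructor
    · rintro ⟨h, h'⟩
      by_cases hq : (q : ℕ) = j
      · exact Or.inr ⟨h, hq⟩
      · exact Or.inl ⟨h, by omega⟩
    · rintro (⟨h, h'⟩ | ⟨h, h'⟩) <;> exact ⟨h, by omega⟩
  rw [h1, Finset.sum_union]
  · congr 1
    rw [Finset.filter_eq']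
    split <;> simp
  · rw [Finset.disjoint_left]
    intro q hq hq'
    simp only [Finset.mem_filter, Fin.ext_iff] at hq hq'
    omega

theorem sum_filter_lt_self {w : ℕ} (A : Finset (Fin w)) (g : ℕ → ℕ) :
    (∑ q ∈ A.filter (fun q : Fin w => (q : ℕ) < w), g q) = ∑ q ∈ A, g q := by
  rw [Finset.filter_true_of_mem fun q _ => q.2]

theorem clampC_reg (t : St) :
    (clampC.eval X t).reg .r = if t.reg .r < t.reg .N then t.reg .r else 0 := by
  unfold clampC
  by_cases h : t.reg .r < t.reg .N
  · have h0 : t.reg .r + 1 - t.reg .N = 0 := by omega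
    rw [if_pos h, Cmd.eval_ifz_pos (by simpa using h0)]; rfl
  · have h0 : t.reg .r + 1 - t.reg .N ≠ 0 := by omega
    rw [if_neg h, Cmd.eval_ifz_neg (by simpa using h0)]; simp [Cmd.eval]

theorem weightC_reg {t : St} (h : Env w S N WT MB t) (A : Finset (Fin w))
    (hA : ∀ q : Fin w, X (t.reg .ad + q) = bit (q ∈ A)) :
    (weightC.eval X t).reg .r = ∑ q ∈ A, WT q := by
  unfold weightC
  rw [Cmd.eval_seq]
  have := eval_loop_ind (X := X) (i := .q) (n := .w)
    (c := .ifz (.inp (♯.ad + ♯.q)) .skip (.r ≔ ♯.r + .rd .wt ♯.q))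
    (s := (Var.r ≔ 0).eval X t)
    (fun j u => u.reg .r = ∑ q ∈ A.filter (fun q : Fin w => (q : ℕ) < j), WT q)
    (by simp [Cmd.eval]) ?_
  · rw [this, Cmd.reg_frame _ _ _ rfl, h.eqw, sum_filter_lt_self]
  · intro j hj u hF hu
    have hj' : j < w := by
      rw [Cmd.reg_frame _ _ _ rfl, h.eqw] at hj; exact hj
    have had : u.reg .ad = t.reg .ad := by
      rw [hF.reg _ rfl (by decide), Cmd.reg_frame _ _ _ rfl]
    have hwt : u.arr .wt = WT := by
      rw [hF.arr _ rfl, Cmd.arr_frame _ _ _ rfl, h.eqwt]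
    rw [sum_fin_range A WT hj', ← hu]
    have hX := hA ⟨j, hj'⟩
    simp only at hX
    by_cases hq : (⟨j, hj'⟩ : Fin w) ∈ A
    · rw [bit_true hq] at hX
      simp [Cmd.eval, had, hwt, hX, hq]
    · rw [bit_false hq] at hX
      simp [Cmd.eval, had, hwt, hX, hq]

theorem encC_reg {t : St} (h : Env w S N WT MB t) (A : Finset (Fin w))
    (hA : ∀ q : Fin w, X (t.reg .ad + q) = bit (q ∈ A)) :
    (encC.eval X t).reg .r = encS N WT A := by
  unfold encC
  rw [Cmd.eval_seq, clampC_reg, weightC_reg h A hA, (h.eval weightC rfl).eqN]; rfl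

theorem mem_decS {m : ℕ} {p : Fin w} : p ∈ decS w MB m ↔ MB (m * w + p) ≠ 0 := by simp [decS]

theorem mem_stepS {B : Layer α w} {a : α} {A : Finset (Fin w)} {q : Fin w} :
    q ∈ stepS B a A ↔ ∃ p ∈ A, (p, a, q) ∈ B.trans := by simp [stepS]

theorem exists_fin_lt_succ {w j : ℕ} (hj : j < w) (P : Fin w → Prop) :
    (∃ p : Fin w, (p : ℕ) < j + 1 ∧ P p) ↔ (∃ p : Fin w, (p : ℕ) < j ∧ P p) ∨ P ⟨j, hj⟩ := by
  constructor
  · rintro ⟨p, hp, h⟩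
    by_cases hpj : (p : ℕ) = j
    · right; convert h; exact hpj.symm
    · exact Or.inl ⟨p, by omega, h⟩
  · rintro (⟨p, hp, h⟩ | h)
    · exact ⟨p, by omega, h⟩
    · exact ⟨⟨j, hj⟩, by simp, h⟩

/-- The outer loop adds the weight of every state q that the inner loop finds to be a successor of a
member of the macro state. The sum depends only on the successor set, so that each q is counted once
however many predecessors it has. -/
theorem stepC_reg {t : St} (h : Env w S N WT MB t) (e : α ≃ Fin S) (B : Layer α w)
    (hB : IsLayerAt X e (t.reg .L) B) {m : ℕ} (hm : t.reg .mw = m * w) {a : α}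
    (ha : t.reg .a = e a) :
    (stepC.eval X t).reg .r = ∑ q ∈ stepS B a (decS w MB m), WT q := by
  set A := stepS B a (decS w MB m) with hA
  unfold stepC
  rw [Cmd.eval_seq]
  have := eval_loop_ind (X := X) (i := .q) (n := .w)
    (c := (.f ≔ 0 ⨾ .loop .p .w (
      .ifz (.rd .memb (♯.mw + ♯.p)) .skip (
        mulC .t .p .s ⨾ .t ≔ ♯.t + ♯.a ⨾ mulC .ad .t .w ⨾
        .ifz (.inp (♯.L + 3 + ♯.w + ♯.w + ♯.w + ♯.w + ♯.ad + ♯.q)) .skip (.f ≔ 1)))) ⨾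
      .ifz ♯.f .skip (.r ≔ ♯.r + .rd .wt ♯.q))
    (s := (Var.r ≔ 0).eval X t)
    (fun j u => u.reg .r = ∑ q ∈ A.filter (fun q : Fin w => (q : ℕ) < j), WT q)
    (by simp [Cmd.eval]) ?_
  · rw [this, Cmd.reg_frame _ _ _ rfl, h.eqw, sum_filter_lt_self]
  · intro j hj u hF hu
    have hj' : j < w := by
      rw [Cmd.reg_frame _ _ _ rfl, h.eqw] at hj; exact hj
    have hE : Env w S N WT MB u := (h.eval (X := X) (.r ≔ 0) rfl).frame hF rfl rfl
    have hmw : u.reg .mw = m * w := by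
      rw [hF.reg _ rfl (by decide), Cmd.reg_frame _ _ _ rfl, hm]
    have hL : u.reg .L = t.reg .L := by
      rw [hF.reg _ rfl (by decide), Cmd.reg_frame _ _ _ rfl]
    have hua : u.reg .a = e a := by
      rw [hF.reg _ rfl (by decide), Cmd.reg_frame _ _ _ rfl, ha]
    have key := eval_loop_ind (X := X) (i := .p) (n := .w)
      (c := .ifz (.rd .memb (♯.mw + ♯.p)) .skip (
        mulC .t .p .s ⨾ .t ≔ ♯.t + ♯.a ⨾ mulC .ad .t .w ⨾
        .ifz (.inp (♯.L + 3 + ♯.w + ♯.w + ♯.w + ♯.w + ♯.ad + ♯.q)) .skip (.f ≔ 1)))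
      (s := (Var.f ≔ 0).eval X (u.set .q j))
      (fun i u => u.reg .f = bit (∃ p : Fin w, (p : ℕ) < i ∧ p ∈ decS w MB m ∧
        (p, a, (⟨j, hj'⟩ : Fin w)) ∈ B.trans))
      (by simp [Cmd.eval, bit]) ?_
    · rw [sum_fin_range A WT hj', ← hu, Cmd.eval_seq, Cmd.eval_seq]
      have hw : ((Var.f ≔ 0).eval X (u.set .q j)).reg .w = w := by
        rw [Cmd.reg_frame _ _ _ rfl]; simp [hE.eqw]
      rw [hw] at key
      generalize hv : Cmd.eval X (Cmd.loop _ _ _) _ = v at key ⊢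
      have hr : v.reg .r = u.reg .r := by
        rw [← hv, Cmd.reg_frame _ _ _ rfl, Cmd.reg_frame _ _ _ rfl]; simp
      have hq : v.reg .q = j := by
        rw [← hv, Cmd.reg_frame _ _ _ rfl, Cmd.reg_frame _ _ _ rfl]; simp
      have hwt : v.arr .wt = WT := by
        rw [← hv, Cmd.arr_frame _ _ _ rfl, Cmd.arr_frame _ _ _ rfl]; simp [hE.eqwt]
      by_cases hqA : (⟨j, hj'⟩ : Fin w) ∈ A
      · rw [bit_true] at key
        · simp [Cmd.eval, key, hr, hq, hwt, hqA]
        · obtain ⟨p, hp, hp'⟩ := mem_stepS.1 hqA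
          exact ⟨p, p.2, hp, hp'⟩
      · rw [bit_false] at key
        · simp [Cmd.eval, key, hr, hqA]
        · rintro ⟨p, -, hp, hp'⟩
          exact hqA (mem_stepS.2 ⟨p, hp, hp'⟩)
    · intro i hi v hG hv
      have hE' : Env w S N WT MB v :=
        ((hE.set .q j rfl).eval (X := X) (.f ≔ 0) rfl).frame hG rfl rfl
      have hi' : i < w := by
        rw [Cmd.reg_frame _ _ _ rfl] at hi; simpa [hE.eqw] using hi
      have hvmw : v.reg .mw = m * w := by
        rw [hG.reg _ rfl (by decide), Cmd.reg_frame _ _ _ rfl]; simp [hmw]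
      have hvL : v.reg .L = t.reg .L := by
        rw [hG.reg _ rfl (by decide), Cmd.reg_frame _ _ _ rfl]; simp [hL]
      have hva : v.reg .a = e a := by
        rw [hG.reg _ rfl (by decide), Cmd.reg_frame _ _ _ rfl]; simp [hua]
      have hvq : v.reg .q = j := by
        rw [hG.reg _ rfl (by decide), Cmd.reg_frame _ _ _ rfl]; simp
      rw [bit_congr (exists_fin_lt_succ hi' _)]
      by_cases hmem : (⟨i, hi'⟩ : Fin w) ∈ decS w MB m
      · have hmem' := mem_decS.1 hmem
        have hne : ¬ Exp.val X (v.set .p i) (.rd .memb (♯.mw + ♯.p)) = 0 := by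
          simpa [hvmw, hE'.eqmb] using hmem'
        rw [Cmd.eval_ifz_neg hne, Cmd.eval_seq, Cmd.eval_seq, Cmd.eval_seq]
        set v1 := (mulC .t .p .s).eval X (v.set .p i) with hv1
        have x1 : v1.reg .t = i * S := by
          rw [hv1, mulC_reg (by decide) (by decide) (by decide) (by decide)]; simp [hE'.eqS]
        set v2 := (Var.t ≔ ♯.t + ♯.a).eval X v1 with hv2
        have x2 : v2.reg .t = i * S + e a := by
          have : v1.reg .a = e a := by rw [hv1, Cmd.reg_frame _ _ _ rfl]; simp [hva]
          simp [hv2, Cmd.eval, x1, this]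
        have x3 : v2.reg .w = w := by
          rw [hv2, Cmd.reg_frame _ _ _ rfl, hv1, Cmd.reg_frame _ _ _ rfl]; simp [hE'.eqw]
        set v3 := (mulC .ad .t .w).eval X v2 with hv3
        have x4 : v3.reg .ad = (i * S + e a) * w := by
          rw [hv3, mulC_reg (by decide) (by decide) (by decide) (by decide), x2, x3]
        have fr : ∀ u, (mulC .ad .t .w).wr u = false → (Var.t ≔ ♯.t + ♯.a).wr u = false →
            (mulC .t .p .s).wr u = false → u ≠ .p → v3.reg u = v.reg u := by
          intro u h1 h2 h3 h4
          rw [hv3, Cmd.reg_frame _ _ _ h1, hv2, Cmd.reg_frame _ _ _ h2, hv1,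
            Cmd.reg_frame _ _ _ h3]; simp [h4]
        have y1 := fr .L rfl rfl rfl (by decide)
        have y2 := fr .w rfl rfl rfl (by decide)
        have y3 := fr .q rfl rfl rfl (by decide)
        have y4 := fr .f rfl rfl rfl (by decide)
        have hX := hB.trans ⟨i, hi'⟩ a ⟨j, hj'⟩
        simp only at hX
        -- Behind the two flags and the four sets, the transition bits are ordered by source, symbol
        -- and target; hence the offset (i S + a) w + j.
        have hval : Exp.val X v3 (.inp (♯.L + 3 + ♯.w + ♯.w + ♯.w + ♯.w + ♯.ad + ♯.q)) =
            bit ((⟨i, hi'⟩, a, ⟨j, hj'⟩) ∈ B.trans) := by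
          rw [← hX]
          simp [y1, y2, y3, x4, hvL, hE'.eqw, hvq]
        by_cases htr : ((⟨i, hi'⟩ : Fin w), a, (⟨j, hj'⟩ : Fin w)) ∈ B.trans
        · rw [Cmd.eval_ifz_neg (by rw [hval]; exact bit_ne_zero.2 htr), bit_true (Or.inr ⟨hmem, htr⟩)]
          simp [Cmd.eval]
        · rw [Cmd.eval_ifz_pos (by rw [hval]; exact bit_eq_zero.2 htr)]
          simp only [Cmd.eval]
          rw [y4, hv]
          exact bit_congr (by simp [htr])
      · have hmem' := hmem
        rw [mem_decS, not_not] at hmem'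
        have hz : Exp.val X (v.set .p i) (.rd .memb (♯.mw + ♯.p)) = 0 := by
          simpa [hvmw, hE'.eqmb] using hmem'
        rw [Cmd.eval_ifz_pos hz]
        simp only [Cmd.eval, St.set_reg]
        rw [if_neg (by decide), hv]
        exact bit_congr (by simp [hmem])

end SecondOrder

namespace SecondOrder

variable {α : Type*} {w S : ℕ} {X : ℕ → ℕ}

/-! ### The transformation of partitions -/

section maps
variable (N : ℕ) [NeZero N] (WT MB : ℕ → ℕ) (B₁ B₂ : Layer α w)

/-- The index of a set of states of the first side. -/
def left (A : Finset (Fin w)) : Fin (N + N) :=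
  ⟨encS N WT A, (encS_lt WT A).trans_le (Nat.le_add_right N N)⟩

/-- The index of a set of states of the second side. -/
def right (A : Finset (Fin w)) : Fin (N + N) :=
  ⟨encS N WT A + N, Nat.add_lt_add_right (encS_lt WT A) N⟩

/-- The successor of an index. -/
noncomputable def delta (a : α) (y : Fin (N + N)) : Fin (N + N) :=
  if (y : ℕ) < N then left N WT (stepS B₁ a (decS w MB y))
  else right N WT (stepS B₂ a (decS w MB (y - N)))

/-- The index stands for a set that contains a final state. -/
def IsFin (y : Fin (N + N)) : Prop :=
  if (y : ℕ) < N then ∃ p ∈ decS w MB y, p ∈ B₁.final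
  else ∃ p ∈ decS w MB (y - N), p ∈ B₂.final

/-- Join the classes of `u` and `v`. -/
def join {M : ℕ} (u v : Fin M) (c : Fin M → Fin M) : Fin M → Fin M :=
  fun z => if c z = c u then c v else c z

/-- The partition in front of a pair of layers. -/
def base (c : Fin (N + N) → Fin (N + N)) : Fin (N + N) → Fin (N + N) :=
  if B₁.initFlag = true then
    fun z => if z = left N WT B₁.init then right N WT B₂.init else z
  else c

/-- The partition behind a pair of layers. -/
noncomputable def upd (e : α ≃ Fin S) (b : Fin (N + N) → Fin (N + N)) :
    Fin (N + N) → Fin (N + N) :=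
  (List.finRange S).foldl (fun c a => (List.finRange (N + N)).foldl (fun c x =>
    join (delta N WT MB B₁ B₂ (e.symm a) x) (delta N WT MB B₁ B₂ (e.symm a) (b x)) c) c) id

end maps

/-- An array represents a map. -/
def Rep {M : ℕ} (A : ℕ → ℕ) (c : Fin M → Fin M) : Prop := ∀ x : Fin M, A x = c x

variable {N : ℕ} {WT MB : ℕ → ℕ}

/-- The situation in which a pair of transitions is processed. -/
structure Edge (X : ℕ → ℕ) (N : ℕ) (WT MB : ℕ → ℕ) (e : α ≃ Fin S) (B₁ B₂ : Layer α w) (t : St) :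
    Prop extends Env w S N WT MB t where
  ptr1 : IsLayerAt X e (t.reg .p1) B₁
  ptr2 : IsLayerAt X e (t.reg .p2) B₂

/-- A command does not change the tables, the constants and the pair of transitions. -/
def Cmd.keeps₂ (c : Cmd) : Bool := c.keeps && (!c.wr .p1 && !c.wr .p2)

variable {e : α ≃ Fin S} {B₁ B₂ : Layer α w}

theorem Edge.frame {t u : St} {i : Var} {c : Cmd} (h : Edge X N WT MB e B₁ B₂ t)
    (hF : Frame c i t u) (hc : c.keeps₂ = true) (hi : (Cmd.assign i 0).keeps₂ = true) :
    Edge X N WT MB e B₁ B₂ u := by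
  simp only [Cmd.keeps₂, Bool.and_eq_true, Bool.not_eq_true'] at hc
  simp only [Cmd.keeps₂, Bool.and_eq_true, Bool.not_eq_true', Cmd.wr, beq_eq_false_iff_ne] at hi
  refine ⟨h.toEnv.frame hF hc.1 hi.1, ?_, ?_⟩
  · rw [hF.reg _ hc.2.1 hi.2.1]; exact h.ptr1
  · rw [hF.reg _ hc.2.2 hi.2.2]; exact h.ptr2

theorem Edge.eval {t : St} (h : Edge X N WT MB e B₁ B₂ t) (c : Cmd) (hc : c.keeps₂ = true) :
    Edge X N WT MB e B₁ B₂ (c.eval X t) :=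
  h.frame (i := .k) ⟨fun u hu _ => c.reg_frame X t hu, fun k hk => c.arr_frame X t hk⟩ hc rfl

theorem Edge.set {t : St} (h : Edge X N WT MB e B₁ B₂ t) (v : Var) (x : ℕ)
    (hv : (Cmd.assign v 0).keeps₂ = true) : Edge X N WT MB e B₁ B₂ (t.set v x) := by
  simp only [Cmd.keeps₂, Bool.and_eq_true, Bool.not_eq_true', Cmd.wr, beq_eq_false_iff_ne] at hv
  refine ⟨h.toEnv.set v x hv.1, ?_, ?_⟩
  · rw [St.set_reg, if_neg hv.2.1]; exact h.ptr1
  · rw [St.set_reg, if_neg hv.2.2]; exact h.ptr2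

variable [NeZero N]

theorem deltaC_reg {t : St} (h : Edge X N WT MB e B₁ B₂ t) {y : Fin (N + N)} (hy : t.reg .y = y)
    {a : α} (ha : t.reg .a = e a) :
    (deltaC.eval X t).reg .r = delta N WT MB B₁ B₂ a y := by
  have hE := h.eval decC rfl
  have ha' : (decC.eval X t).reg .a = e a := by rw [Cmd.reg_frame _ _ _ rfl, ha]
  unfold deltaC
  rw [Cmd.eval_seq, Cmd.eval_seq, Cmd.eval_seq]
  have hoff : (clampC.eval X (stepC.eval X (decC.eval X t))).reg .off = (decC.eval X t).reg .off := by
    rw [Cmd.reg_frame _ _ _ rfl, Cmd.reg_frame _ _ _ rfl]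
  simp only [Cmd.eval, St.set_reg, if_true, Exp.val_add, Exp.val_var]
  rw [hoff, clampC_reg, (hE.eval stepC rfl).eqN]
  unfold delta
  by_cases hyN : (y : ℕ) < N
  · obtain ⟨d1, d2, d3⟩ := decC_left (X := X) t (by rw [hy, h.eqN]; exact hyN)
    rw [if_pos hyN, d3, stepC_reg hE.toEnv e B₁ (by rw [d2]; exact h.ptr1) (m := y)
      (by rw [d1, hy, h.eqw]) ha']
    rfl
  · obtain ⟨d1, d2, d3⟩ := decC_right (X := X) t (by rw [hy, h.eqN]; exact hyN)
    rw [if_neg hyN, d3, stepC_reg hE.toEnv e B₂ (by rw [d2]; exact h.ptr2) (m := y - N)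
      (by rw [d1, hy, h.eqw, h.eqN]) ha', h.eqN]
    rfl

theorem finC_reg {t : St} (h : Edge X N WT MB e B₁ B₂ t) {y : Fin (N + N)} (hy : t.reg .y = y) :
    (finC.eval X t).reg .f = bit (IsFin N MB B₁ B₂ y) := by
  have hE := h.eval decC rfl
  have key : ∀ (B : Layer α w) (m : ℕ), (decC.eval X t).reg .mw = m * w →
      IsLayerAt X e ((decC.eval X t).reg .L) B →
      (finC.eval X t).reg .f = bit (∃ p ∈ decS w MB m, p ∈ B.final) := by
    intro B m hm hB
    unfold finC
    rw [Cmd.eval_seq, Cmd.eval_seq]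
    have := eval_loop_ind (X := X) (i := .p) (n := .w)
      (c := .ifz (.rd .memb (♯.mw + ♯.p)) .skip (
        .ifz (.inp (♯.L + 3 + ♯.w + ♯.w + ♯.w + ♯.p)) .skip (.f ≔ 1)))
      (s := (Var.f ≔ 0).eval X (decC.eval X t))
      (fun j u => u.reg .f = bit (∃ p : Fin w, (p : ℕ) < j ∧ p ∈ decS w MB m ∧ p ∈ B.final))
      (by simp [Cmd.eval, bit]) ?_
    · rw [this, (hE.eval (.f ≔ 0) rfl).eqw]
      refine bit_congr ⟨?_, ?_⟩
      · rintro ⟨p, -, h, h'⟩; exact ⟨p, h, h'⟩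
      · rintro ⟨p, h, h'⟩; exact ⟨p, p.2, h, h'⟩
    · intro j hj u hF hu
      rw [(hE.eval (.f ≔ 0) rfl).eqw] at hj
      have hE' := (hE.eval (.f ≔ 0) rfl).frame hF rfl rfl
      have h1 : u.reg .mw = m * w := by
        rw [hF.reg _ rfl (by decide), Cmd.reg_frame _ _ _ rfl, hm]
      have h2 : u.reg .L = (decC.eval X t).reg .L := by
        rw [hF.reg _ rfl (by decide), Cmd.reg_frame _ _ _ rfl]
      rw [bit_congr (exists_fin_lt_succ hj _)]
      have hX := hB.final ⟨j, hj⟩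
      simp only at hX
      by_cases hmem : (⟨j, hj⟩ : Fin w) ∈ decS w MB m
      · have hmem' := mem_decS.1 hmem
        rw [Cmd.eval_ifz_neg (by simpa [h1, hE'.eqmb] using hmem')]
        have hval : Exp.val X (u.set .p j) (.inp (♯.L + 3 + ♯.w + ♯.w + ♯.w + ♯.p)) =
            bit ((⟨j, hj⟩ : Fin w) ∈ B.final) := by
          rw [← hX]; simp [h2, hE'.eqw]
        by_cases hf : (⟨j, hj⟩ : Fin w) ∈ B.final
        · rw [Cmd.eval_ifz_neg (by rw [hval]; exact bit_ne_zero.2 hf), bit_true (Or.inr ⟨hmem, hf⟩)]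
          simp [Cmd.eval]
        · rw [Cmd.eval_ifz_pos (by rw [hval]; exact bit_eq_zero.2 hf)]
          simp only [Cmd.eval, St.set_reg]
          rw [if_neg (by decide), hu]
          exact bit_congr (by simp [hf])
      · have hmem' := hmem
        rw [mem_decS, not_not] at hmem'
        rw [Cmd.eval_ifz_pos (by simpa [h1, hE'.eqmb] using hmem')]
        simp only [Cmd.eval, St.set_reg]
        rw [if_neg (by decide), hu]
        exact bit_congr (by simp [hmem])
  unfold IsFin
  by_cases hyN : (y : ℕ) < N
  · obtain ⟨d1, d2, d3⟩ := decC_left (X := X) t (by rw [hy, h.eqN]; exact hyN)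
    simp only [if_pos hyN]
    exact key B₁ _ (by rw [d1, hy, h.eqw]) (by rw [d2]; exact h.ptr1)
  · obtain ⟨d1, d2, d3⟩ := decC_right (X := X) t (by rw [hy, h.eqN]; exact hyN)
    simp only [if_neg hyN]
    exact key B₂ _ (by rw [d1, hy, h.eqw, h.eqN]) (by rw [d2]; exact h.ptr2)

/-- A loop that fills an array. -/
theorem eval_fill {X : ℕ → ℕ} {i n : Var} {k : Arr} {ex : Exp} {s : St} {g : ℕ → ℕ}
    (hg : ∀ j < s.reg n, ∀ t : St, Frame (.write k ♯i ex) i s t →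
      ex.val X (t.set i j) = g j) :
    ∀ j < s.reg n, ((Cmd.loop i n (.write k ♯i ex)).eval X s).arr k j = g j := by
  refine eval_loop_ind (I := fun j t => ∀ i < j, t.arr k i = g i) (by simp) ?_
  intro j hj t hF ht i' hi'
  simp only [Cmd.eval, St.put_arr, if_true, Exp.val_var, St.set_reg, St.set_arr, hg j hj t hF,
    Function.update_apply]
  split
  · next h => rw [h]
  · exact ht i' (by omega)

/-- Only the flag of the first layer is tested. This suffices because the search advances both sides
together, so both diagrams are at their first layer at the same time. -/
theorem baseC_arr {t : St} (h : Edge X N WT MB e B₁ B₂ t) {c : Fin (N + N) → Fin (N + N)}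
    (hc : Rep (t.arr .c) c) : Rep ((baseC.eval X t).arr .b) (base N WT B₁ B₂ c) := by
  intro z
  unfold baseC base
  have hflag := h.ptr1.initFlag
  by_cases hi : B₁.initFlag = true
  · rw [bit_true hi] at hflag
    rw [Cmd.eval_ifz_neg (by simp [hflag]), if_pos hi]
    simp only [Cmd.eval_seq]
    set t1 := (Cmd.loop .x .M (.write .b ♯.x ♯.x)).eval X t with ht1
    have h1 : Edge X N WT MB e B₁ B₂ t1 := h.eval _ rfl
    have hb1 : ∀ j < t.reg .M, t1.arr .b j = j := eval_fill (g := id) (by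
      intro j hj u hF; simp)
    set t2 := (Var.ad ≔ ♯.p1 + 3 + ♯.w + ♯.w).eval X t1 with ht2
    have h2 : Edge X N WT MB e B₁ B₂ t2 := h1.eval _ rfl
    have had2 : t2.reg .ad = t2.reg .p1 + 3 + w + w := by
      simp [ht2, Cmd.eval, h1.eqw]
    have r2 := encC_reg h2.toEnv B₁.init (X := X) (by rw [had2]; exact h2.ptr1.init)
    set t3 := (Var.u ≔ ♯.r).eval X (encC.eval X t2) with ht3
    have h3 : Edge X N WT MB e B₁ B₂ t3 := (h2.eval _ rfl).eval _ rfl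
    have hu3 : t3.reg .u = encS N WT B₁.init := by simp [ht3, Cmd.eval, r2]
    set t4 := (Var.ad ≔ ♯.p2 + 3 + ♯.w + ♯.w).eval X t3 with ht4
    have h4 : Edge X N WT MB e B₁ B₂ t4 := h3.eval _ rfl
    have had4 : t4.reg .ad = t4.reg .p2 + 3 + w + w := by
      simp [ht4, Cmd.eval, h3.eqw]
    have r4 := encC_reg h4.toEnv B₂.init (X := X) (by rw [had4]; exact h4.ptr2.init)
    have h5 : Edge X N WT MB e B₁ B₂ (encC.eval X t4) := h4.eval _ rfl
    have hu5 : (encC.eval X t4).reg .u = encS N WT B₁.init := by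
      rw [Cmd.reg_frame _ _ _ rfl, ht4, Cmd.reg_frame _ _ _ rfl, hu3]
    have hb5 : (encC.eval X t4).arr .b = t1.arr .b := by
      rw [Cmd.arr_frame _ _ _ rfl, ht4, Cmd.arr_frame _ _ _ rfl, ht3, Cmd.arr_frame _ _ _ rfl,
        Cmd.arr_frame _ _ _ rfl, ht2, Cmd.arr_frame _ _ _ rfl]
    simp only [Cmd.eval, St.put_arr, if_true, Exp.val_add, Exp.val_var, r4, hu5, h5.eqN, hb5,
      Function.update_apply]
    by_cases hz : z = left N WT B₁.init
    · rw [if_pos hz, if_pos (by rw [hz]; rfl)]; rfl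
    · rw [if_neg hz, if_neg (show ¬ (z : ℕ) = encS N WT B₁.init from fun h => hz (Fin.ext h)), hb1 z (by rw [h.eqM]; exact z.2)]
  · rw [bit_false hi] at hflag
    rw [Cmd.eval_ifz_pos (by simp [hflag]), if_neg hi]
    rw [eval_fill (g := t.arr .c) ?_ z (by rw [h.eqM]; exact z.2), hc z]
    intro j hj u hF
    simp [hF.arr _ (show (Cmd.write .b ♯.x (.rd .c ♯.x)).wa .c = false from rfl)]

/-- Both labels are read before the relabelling begins, as the loop may overwrite the entries of `u`
and `v`. The invariant says that the entries below j are relabelled and the others are still the old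
ones. -/
theorem unionC_arr {t : St} (h : Edge X N WT MB e B₁ B₂ t) {c : Fin (N + N) → Fin (N + N)}
    (hc : Rep (t.arr .cn) c) {u v : Fin (N + N)} (hu : t.reg .u = u) (hv : t.reg .v = v) :
    Rep ((unionC.eval X t).arr .cn) (join u v c) := by
  unfold unionC
  simp only [Cmd.eval_seq]
  set t1 := (Var.cv ≔ .rd .cn ♯.v).eval X ((Var.cu ≔ .rd .cn ♯.u).eval X t) with ht1
  have h1 : Edge X N WT MB e B₁ B₂ t1 := (h.eval _ rfl).eval _ rfl
  have hcu : t1.reg .cu = c u := by simp [ht1, Cmd.eval, hu, hc u]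
  have hcv : t1.reg .cv = c v := by simp [ht1, Cmd.eval, hv, hc v]
  have hcn : Rep (t1.arr .cn) c := by
    rw [ht1, Cmd.arr_frame _ _ _ rfl, Cmd.arr_frame _ _ _ rfl]; exact hc
  have := eval_loop_ind (X := X) (i := .z) (n := .M)
    (c := .ifz ((.rd .cn ♯.z - ♯.cu) + (♯.cu - .rd .cn ♯.z)) (.write .cn ♯.z ♯.cv) .skip)
    (s := t1) (fun j t => ∀ z : Fin (N + N), t.arr .cn z = if (z : ℕ) < j then join u v c z else c z)
    (by intro z; simpa using hcn z) ?_
  · intro z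
    rw [this z, if_pos (by rw [h1.eqM]; exact z.2)]
  · intro j hj t hF ht z
    rw [h1.eqM] at hj
    have e1 : t.reg .cu = c u := by rw [hF.reg _ rfl (by decide), hcu]
    have e2 : t.reg .cv = c v := by rw [hF.reg _ rfl (by decide), hcv]
    have e3 : t.arr .cn j = c ⟨j, hj⟩ := by simpa using ht ⟨j, hj⟩
    have hz := ht z
    by_cases hcz : c ⟨j, hj⟩ = c u
    · rw [Cmd.eval_ifz_pos (by simp [e1, e3, hcz])]
      simp only [Cmd.eval, St.put_arr, if_true, Exp.val_var, St.set_reg, St.set_arr, e2,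
        Function.update_apply]
      by_cases hzj : (z : ℕ) = j
      · have hz' : z = ⟨j, hj⟩ := Fin.ext hzj
        have hjoin : join u v c z = c v := by simp [join, hz', hcz]
        rw [if_pos hzj, if_pos (show (z : ℕ) < j + 1 by omega), hjoin, if_neg (by decide)]
      · rw [if_neg hzj, hz]
        by_cases hlt : (z : ℕ) < j
        · rw [if_pos hlt, if_pos (by omega)]
        · rw [if_neg hlt, if_neg (by omega)]
    · have hcz' : (c ⟨j, hj⟩ : ℕ) ≠ c u := fun h => hcz (Fin.ext h)
      rw [Cmd.eval_ifz_neg (by simp [e1, e3]; omega)]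
      simp only [Cmd.eval, St.set_arr]
      rw [hz]
      by_cases hzj : (z : ℕ) = j
      · have hz' : z = ⟨j, hj⟩ := Fin.ext hzj
        rw [if_neg (by omega), if_pos (by omega), hz']
        simp [join, hcz]
      · by_cases hlt : (z : ℕ) < j
        · rw [if_pos hlt, if_pos (by omega)]
        · rw [if_neg hlt, if_neg (by omega)]

/-- The two nested loops match the two nested folds of `upd`; the new partition starts from the
identity and the old one is only read. -/
theorem updC_arr {t : St} (h : Edge X N WT MB e B₁ B₂ t) {b : Fin (N + N) → Fin (N + N)}
    (hb : Rep (t.arr .b) b) : Rep ((updC.eval X t).arr .cn) (upd N WT MB B₁ B₂ e b) := by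
  unfold updC upd
  rw [Cmd.eval_seq]
  set t1 := (Cmd.loop .x .M (.write .cn ♯.x ♯.x)).eval X t with ht1
  have h1 : Edge X N WT MB e B₁ B₂ t1 := h.eval _ rfl
  have hcn1 : Rep (M := N + N) (t1.arr .cn) id := by
    intro z
    exact eval_fill (X := X) (g := id) (by intro j hj u hF; simp) z (by rw [h.eqM]; exact z.2)
  have hb1 : Rep (t1.arr .b) b := by rw [ht1, Cmd.arr_frame _ _ _ rfl]; exact hb
  refine eval_loop_foldl h1.eqS (fun t c => Rep (t.arr .cn) c) _ hcn1 ?_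
  intro a t2 c2 hF2 hc2
  have h2 : Edge X N WT MB e B₁ B₂ (t2.set .a a) := (h1.frame hF2 rfl rfl).set _ _ rfl
  refine eval_loop_foldl h2.eqM (fun t c => Rep (t.arr .cn) c) _ hc2 ?_
  intro x t3 c3 hF3 hc3
  have h3 : Edge X N WT MB e B₁ B₂ (t3.set .x x) := (h2.frame hF3 rfl rfl).set _ _ rfl
  have ha3 : (t3.set .x x).reg .a = e (e.symm a) := by
    simp [hF3.reg .a rfl (by decide)]
  have hb3 : Rep ((t3.set .x x).arr .b) b := by
    rw [St.set_arr, hF3.arr _ rfl, St.set_arr, hF2.arr _ rfl]; exact hb1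
  simp only [Cmd.eval_seq]
  set t4 := (Var.y ≔ ♯.x).eval X (t3.set .x x) with ht4
  have h4 : Edge X N WT MB e B₁ B₂ t4 := h3.eval _ rfl
  have r4 := deltaC_reg h4 (y := x) (by simp [ht4, Cmd.eval])
    (a := e.symm a) (by rw [ht4, Cmd.reg_frame _ _ _ rfl, ha3])
  set t5 := (Var.u ≔ ♯.r).eval X (deltaC.eval X t4) with ht5
  have h5 : Edge X N WT MB e B₁ B₂ t5 := (h4.eval _ rfl).eval _ rfl
  have hu5 : t5.reg .u = delta N WT MB B₁ B₂ (e.symm a) x := by simp [ht5, Cmd.eval, r4]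
  have fr5 : ∀ u, deltaC.wr u = false → u ≠ .u → u ≠ .y → t5.reg u = (t3.set .x x).reg u := by
    intro u hu hu' hu''
    rw [ht5, Cmd.reg_frame _ _ _ (by simpa [Cmd.wr] using hu'), Cmd.reg_frame _ _ _ hu, ht4,
      Cmd.reg_frame _ _ _ (by simpa [Cmd.wr] using hu'')]
  have ar5 : t5.arr = (t3.set .x x).arr := by
    funext k
    rw [ht5, Cmd.arr_frame _ _ _ rfl, Cmd.arr_frame _ _ _ (by cases k <;> rfl), ht4,
      Cmd.arr_frame _ _ _ rfl]
  set t6 := (Var.y ≔ .rd .b ♯.x).eval X t5 with ht6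
  have h6 : Edge X N WT MB e B₁ B₂ t6 := h5.eval _ rfl
  have r6 := deltaC_reg h6 (y := b x)
    (by
      rw [← hb3 x, ← ar5]
      simp [ht6, Cmd.eval, fr5 .x rfl (by decide) (by decide)])
    (a := e.symm a)
    (by rw [ht6, Cmd.reg_frame _ _ _ rfl, fr5 .a rfl (by decide) (by decide), ha3])
  set t7 := (Var.v ≔ ♯.r).eval X (deltaC.eval X t6) with ht7
  have h7 : Edge X N WT MB e B₁ B₂ t7 := (h6.eval _ rfl).eval _ rfl
  refine unionC_arr h7 ?_ ?_ (by simp [ht7, Cmd.eval, r6])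
  · rw [ht7, Cmd.arr_frame _ _ _ rfl, Cmd.arr_frame _ _ _ rfl, ht6, Cmd.arr_frame _ _ _ rfl, ar5]
    exact hc3
  · rw [ht7, Cmd.reg_frame _ _ _ rfl, Cmd.reg_frame _ _ _ rfl, ht6, Cmd.reg_frame _ _ _ rfl, hu5]

/-- The answer is only ever raised, so earlier successes persist. A partition passes if every index
agrees in finality with its label, which makes finality constant on classes. -/
theorem checkC_reg {t : St} (h : Edge X N WT MB e B₁ B₂ t) {c : Fin (N + N) → Fin (N + N)}
    (hc : Rep (t.arr .cn) c) :
    (checkC.eval X t).reg .ans ≠ 0 ↔ t.reg .ans ≠ 0 ∨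
      (X (t.reg .ac1 + t.reg .g1) ≠ 0 ∧ X (t.reg .ac2 + t.reg .g2) ≠ 0 ∧
        ∀ x, IsFin N MB B₁ B₂ x ↔ IsFin N MB B₁ B₂ (c x)) := by
  set A : Prop := X (t.reg .ac1 + t.reg .g1) ≠ 0 ∧ X (t.reg .ac2 + t.reg .g2) ≠ 0 with hA
  unfold checkC
  rw [Cmd.eval_seq, Cmd.eval_seq]
  set t1 := Cmd.eval X (.ok ≔ 0⨾Cmd.ifz (Exp.inp (♯.ac1 + ♯.g1)) Cmd.skip
    (.ifz (Exp.inp (♯.ac2 + ♯.g2)) Cmd.skip (.ok ≔ 1))) t with ht1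
  have h1 : Edge X N WT MB e B₁ B₂ t1 := h.eval _ rfl
  have hok1 : t1.reg .ok = bit A := by
    rw [ht1, Cmd.eval_seq]
    by_cases a1 : X (t.reg .ac1 + t.reg .g1) = 0
    · rw [Cmd.eval_ifz_pos (by simpa [Cmd.eval] using a1), bit_false (by tauto)]
      simp [Cmd.eval]
    · rw [Cmd.eval_ifz_neg (by simpa [Cmd.eval] using a1)]
      by_cases a2 : X (t.reg .ac2 + t.reg .g2) = 0
      · rw [Cmd.eval_ifz_pos (by simpa [Cmd.eval] using a2), bit_false (by tauto)]
        simp [Cmd.eval]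
      · rw [Cmd.eval_ifz_neg (by simpa [Cmd.eval] using a2), bit_true (by tauto)]
        simp [Cmd.eval]
  have hans1 : t1.reg .ans = t.reg .ans := by rw [ht1, Cmd.reg_frame _ _ _ rfl]
  have hcn1 : Rep (t1.arr .cn) c := by rw [ht1, Cmd.arr_frame _ _ _ rfl]; exact hc
  have := eval_loop_ind (X := X) (i := .x) (n := .M)
    (c := (.y ≔ ♯.x⨾finC⨾.fx ≔ ♯.f)⨾(.y ≔ .rd .cn ♯.x⨾finC)⨾
      .ifz ((♯.f - ♯.fx) + (♯.fx - ♯.f)) .skip (.ok ≔ 0))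
    (s := t1) (fun j t => t.reg .ok = bit (A ∧ ∀ x : Fin (N + N), (x : ℕ) < j →
      (IsFin N MB B₁ B₂ x ↔ IsFin N MB B₁ B₂ (c x))))
    (by rw [hok1]; exact bit_congr (by simp)) ?_
  · set t2 := Cmd.eval X (Cmd.loop _ _ _) t1 with ht2
    have hans2 : t2.reg .ans = t.reg .ans := by rw [ht2, Cmd.reg_frame _ _ _ rfl, hans1]
    rw [h1.eqM, bit_congr (Q := A ∧ ∀ x, (IsFin N MB B₁ B₂ x ↔ IsFin N MB B₁ B₂ (c x))) (by simp)]
      at this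
    by_cases hQ : A ∧ ∀ x, (IsFin N MB B₁ B₂ x ↔ IsFin N MB B₁ B₂ (c x))
    · rw [bit_true hQ] at this
      rw [Cmd.eval_ifz_neg (by simp [this])]
      simp only [Cmd.eval, St.set_reg, if_true, Exp.val_ofNat]
      exact ⟨fun _ => Or.inr ⟨hQ.1.1, hQ.1.2, hQ.2⟩, fun _ => by decide⟩
    · rw [bit_false hQ] at this
      rw [Cmd.eval_ifz_pos (by simp [this])]
      simp only [Cmd.eval, hans2]
      constructor
      · exact Or.inl
      · rintro (h | ⟨x, y, z⟩)
        · exact h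
        · exact absurd ⟨⟨x, y⟩, z⟩ hQ
  · intro j hj t2 hF ht2
    rw [h1.eqM] at hj
    have h2 : Edge X N WT MB e B₁ B₂ (t2.set .x j) := (h1.frame hF rfl rfl).set _ _ rfl
    have hcn2 : Rep (t2.arr .cn) c := by rw [hF.arr _ rfl]; exact hcn1
    simp only [Cmd.eval_seq]
    set t4 := (Var.y ≔ ♯.x).eval X (t2.set .x j) with ht4
    have h4 : Edge X N WT MB e B₁ B₂ t4 := h2.eval _ rfl
    have r4 := finC_reg h4 (y := ⟨j, hj⟩) (by simp [ht4, Cmd.eval])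
    set t5 := (Var.fx ≔ ♯.f).eval X (finC.eval X t4) with ht5
    have h5 : Edge X N WT MB e B₁ B₂ t5 := (h4.eval _ rfl).eval _ rfl
    have hfx5 : t5.reg .fx = bit (IsFin N MB B₁ B₂ ⟨j, hj⟩) := by simp [ht5, Cmd.eval, r4]
    have hx5 : t5.reg .x = j := by
      rw [ht5, Cmd.reg_frame _ _ _ rfl, Cmd.reg_frame _ _ _ rfl, ht4, Cmd.reg_frame _ _ _ rfl]; simp
    have hok5 : t5.reg .ok = t2.reg .ok := by
      rw [ht5, Cmd.reg_frame _ _ _ rfl, Cmd.reg_frame _ _ _ rfl, ht4, Cmd.reg_frame _ _ _ rfl]; simp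
    have hcn5 : t5.arr .cn = t2.arr .cn := by
      rw [ht5, Cmd.arr_frame _ _ _ rfl, Cmd.arr_frame _ _ _ rfl, ht4, Cmd.arr_frame _ _ _ rfl]; simp
    set t6 := (Var.y ≔ .rd .cn ♯.x).eval X t5 with ht6
    have h6 : Edge X N WT MB e B₁ B₂ t6 := h5.eval _ rfl
    have r6 := finC_reg h6 (y := c ⟨j, hj⟩) (by
      rw [← hcn2 ⟨j, hj⟩, ← hcn5]; simp [ht6, Cmd.eval, hx5])
    have hfx7 : (finC.eval X t6).reg .fx = bit (IsFin N MB B₁ B₂ ⟨j, hj⟩) := by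
      rw [Cmd.reg_frame _ _ _ rfl, ht6, Cmd.reg_frame _ _ _ rfl, hfx5]
    have hok7 : (finC.eval X t6).reg .ok = t2.reg .ok := by
      rw [Cmd.reg_frame _ _ _ rfl, ht6, Cmd.reg_frame _ _ _ rfl, hok5]
    set t7 := finC.eval X t6 with ht7
    -- Splits off the index treated in round j, so that the flag `ok` records agreement for all
    -- indices up to j.
    have hstep : (A ∧ ∀ x : Fin (N + N), (x : ℕ) < j + 1 →
        (IsFin N MB B₁ B₂ x ↔ IsFin N MB B₁ B₂ (c x))) ↔ ((A ∧ ∀ x : Fin (N + N), (x : ℕ) < j →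
        (IsFin N MB B₁ B₂ x ↔ IsFin N MB B₁ B₂ (c x))) ∧
        (IsFin N MB B₁ B₂ ⟨j, hj⟩ ↔ IsFin N MB B₁ B₂ (c ⟨j, hj⟩))) := by
      constructor
      · rintro ⟨h, h'⟩
        exact ⟨⟨h, fun x hx => h' x (by omega)⟩, h' ⟨j, hj⟩ (by simp)⟩
      · rintro ⟨⟨h, h'⟩, h''⟩
        refine ⟨h, fun x hx => ?_⟩
        by_cases hxj : (x : ℕ) = j
        · rw [show x = ⟨j, hj⟩ from Fin.ext hxj]; exact h''
        · exact h' x (by omega)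
    rw [bit_congr hstep]
    by_cases hx : IsFin N MB B₁ B₂ ⟨j, hj⟩ ↔ IsFin N MB B₁ B₂ (c ⟨j, hj⟩)
    · rw [Cmd.eval_ifz_pos (by simp [r6, hfx7, bit_congr hx])]
      simp only [Cmd.eval]
      rw [hok7, ht2]
      exact bit_congr (by simp [hx])
    · have hne : bit (IsFin N MB B₁ B₂ ⟨j, hj⟩) ≠ bit (IsFin N MB B₁ B₂ (c ⟨j, hj⟩)) := by
        intro hb
        apply hx
        rw [← bit_ne_zero (P := IsFin N MB B₁ B₂ ⟨j, hj⟩),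
          ← bit_ne_zero (P := IsFin N MB B₁ B₂ (c ⟨j, hj⟩)), hb]
      rw [Cmd.eval_ifz_neg (by simp [r6, hfx7]; omega), bit_false fun h => hx h.2]
      simp [Cmd.eval]

end SecondOrder

namespace SecondOrder

variable {α : Type*} {w S : ℕ}

/-! ### Languages of decision diagrams by sets of states -/

/-- The states reached from a set of states. -/
noncomputable def runS : List (Layer α w) → List α → Finset (Fin w) → Finset (Fin w)
  | B :: D, a :: u, A => runS D u (stepS B a A)
  | _, _, A => A

/-- The subset construction: membership in the set reached amounts to a path, built or cut at its
first transition. -/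
theorem mem_runS (D : List (Layer α w)) : ∀ (s : Fin D.length → α) (A : Finset (Fin w)) (q : Fin w),
    q ∈ runS D (List.ofFn s) A ↔ ∃ p : Fin (D.length + 1) → Fin w, p 0 ∈ A ∧
      p (Fin.last D.length) = q ∧
      ∀ i : Fin D.length, (p i.castSucc, s i, p i.succ) ∈ (D.get i).trans := by
  induction D with
  | nil =>
    intro s A q
    simp only [List.length_nil, List.ofFn_zero, runS]
    constructor
    · intro h; exact ⟨fun _ => q, h, rfl, fun i => i.elim0⟩
    · rintro ⟨p, h, rfl, -⟩; exact h
  | cons B D ih =>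
    intro s A q
    have hs : List.ofFn s = s 0 :: List.ofFn (fun i : Fin D.length => s i.succ) := List.ofFn_succ
    rw [hs, runS, ih]
    constructor
    · rintro ⟨p, h0, hq, hp⟩
      obtain ⟨p0, hp0, htr⟩ := mem_stepS.1 h0
      refine ⟨Fin.cons p0 p, hp0, ?_, ?_⟩
      · rw [← hq]; rfl
      · intro i
        refine Fin.cases ?_ (fun i => ?_) i
        · exact htr
        · exact hp i
    · rintro ⟨p, h0, hq, hp⟩
      refine ⟨fun i => p i.succ, ?_, ?_, ?_⟩
      · exact mem_stepS.2 ⟨p 0, h0, hp 0⟩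
      · rw [← hq]; rfl
      · intro i; exact hp i.succ

/-- The diagram `D` accepts the string `u`. -/
def AcceptsList (D : List (Layer α w)) (u : List α) : Prop :=
  ∃ B ∈ D.head?, ∃ B' ∈ D.getLast?, ∃ q ∈ runS D u B.init, q ∈ B'.final

theorem accepts_iff {D : List (Layer α w)} (hD : D ≠ []) (s : Fin D.length → α) :
    Accepts D s ↔ AcceptsList D (List.ofFn s) := by
  unfold Accepts AcceptsList
  have h1 : D.head? = some (D.head hD) := List.head?_eq_some_head hD
  have h2 : D.getLast? = some (D.getLast hD) := List.getLast?_eq_some_getLast hD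
  simp only [h1, h2, Option.mem_def, Option.some.injEq, exists_eq_left', forall_eq', mem_runS]
  constructor
  · rintro ⟨p, h0, hl, hp⟩; exact ⟨_, ⟨p, h0, rfl, hp⟩, hl⟩
  · rintro ⟨q, ⟨p, h0, rfl, hp⟩, hl⟩; exact ⟨p, h0, hl, hp⟩

/-- Expressing the sets by predicates on lists removes the dependence on the length and with it the
heterogeneous equality. -/
theorem sigma_set_eq_iff {k l : ℕ} {P Q : List α → Prop} :
    ((⟨k, {s | P (List.ofFn s)}⟩ : Σ k : ℕ, Set (Fin k → α)) = ⟨l, {s | Q (List.ofFn s)}⟩) ↔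
      k = l ∧ ∀ u : List α, u.length = k → (P u ↔ Q u) := by
  constructor
  · intro h
    have hk : k = l := congrArg Sigma.fst h
    subst hk
    refine ⟨rfl, fun u hu => ?_⟩
    have h' := eq_of_heq (Sigma.mk.inj h).2
    subst hu
    have := Set.ext_iff.1 h' u.get
    simpa using this
  · rintro ⟨rfl, h⟩
    congr 1
    ext s
    exact h _ (by simp)

theorem oddLanguage_eq_iff {D D' : List (Layer α w)} (hD : D ≠ []) (hD' : D' ≠ []) :
    oddLanguage D = oddLanguage D' ↔ D.length = D'.length ∧
      ∀ u : List α, u.length = D.length → (AcceptsList D u ↔ AcceptsList D' u) := by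
  have h : ∀ {D : List (Layer α w)}, D ≠ [] → oddLanguage D =
      ⟨D.length, {s | AcceptsList D (List.ofFn s)}⟩ := by
    intro D hD
    unfold oddLanguage
    congr 1
    ext s
    exact accepts_iff hD s
  rw [h hD, h hD', sigma_set_eq_iff]

/-! ### Partitions along pairs of diagrams -/

section join
variable {M : ℕ}

/-- Merging has three properties, on which everything about partitions rests: it identifies the two
given elements, it keeps earlier identifications, and it creates none outside an equivalence that
contains the pair. -/
theorem join_eq (u v : Fin M) (c : Fin M → Fin M) : join u v c u = join u v c v := by
  simp [join]

theorem join_pres (u v : Fin M) {c : Fin M → Fin M} {x y : Fin M} (h : c x = c y) :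
    join u v c x = join u v c y := by simp [join, h]

/-- Since labels are themselves indices, it is enough to record that every index is related to its
label. A relabelled z is linked to the new label through z, c u, u, v, c v. -/
theorem join_rel {R : Fin M → Fin M → Prop} (hR : Equivalence R) {u v : Fin M} (huv : R u v)
    {c : Fin M → Fin M} (hc : ∀ z, R z (c z)) (z : Fin M) : R z (join u v c z) := by
  unfold join
  split
  · next h => exact hR.trans (hc z) (h ▸ hR.trans (hR.symm (hc u)) (hR.trans huv (hc v)))
  · exact hc z

theorem foldl_pres {β ι : Type*} {f : β → ι → β} {P : β → Prop} (hf : ∀ b i, P b → P (f b i))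
    (l : List ι) : ∀ b, P b → P (l.foldl f b) := by
  induction l with
  | nil => intro b h; exact h
  | cons i l ih => intro b h; exact ih _ (hf b i h)

/-- What one step establishes and all steps preserve holds at the end, whatever happened before that
step. -/
theorem foldl_est {β ι : Type*} {f : β → ι → β} {P : β → Prop} (hf : ∀ b i, P b → P (f b i))
    {l : List ι} {i : ι} (hi : i ∈ l) (h : ∀ b, P (f b i)) (b : β) : P (l.foldl f b) := by
  obtain ⟨l₁, l₂, rfl⟩ := List.append_of_mem hi
  rw [List.foldl_append, List.foldl_cons]
  exact foldl_pres hf _ _ (h _)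

end join

variable {N : ℕ} [NeZero N] {WT MB : ℕ → ℕ} {e : α ≃ Fin S}

/-- The round of the nested fold for a and x merges exactly these two successors, and later rounds
never separate them. -/
theorem upd_sound (B₁ B₂ : Layer α w) (b : Fin (N + N) → Fin (N + N)) (a : α) (x : Fin (N + N)) :
    upd N WT MB B₁ B₂ e b (delta N WT MB B₁ B₂ a x) =
      upd N WT MB B₁ B₂ e b (delta N WT MB B₁ B₂ a (b x)) := by
  unfold upd
  refine foldl_est (P := fun c : Fin (N + N) → Fin (N + N) =>
    c (delta N WT MB B₁ B₂ a x) = c (delta N WT MB B₁ B₂ a (b x))) ?_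
    (List.mem_finRange (e a)) ?_ _
  · intro c a' hc
    exact foldl_pres (P := fun c : Fin (N + N) → Fin (N + N) =>
      c (delta N WT MB B₁ B₂ a x) = c (delta N WT MB B₁ B₂ a (b x)))
      (fun c i h => join_pres _ _ h) _ _ hc
  · intro c
    refine foldl_est (P := fun c : Fin (N + N) → Fin (N + N) =>
      c (delta N WT MB B₁ B₂ a x) = c (delta N WT MB B₁ B₂ a (b x)))
      (fun c i h => join_pres _ _ h) (List.mem_finRange x) ?_ _
    intro c
    rw [Equiv.symm_apply_apply]
    exact join_eq _ _ _

/-- The fold starts from the identity and performs only merges that R allows. -/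
theorem upd_complete {B₁ B₂ : Layer α w} {b : Fin (N + N) → Fin (N + N)}
    {R : Fin (N + N) → Fin (N + N) → Prop} (hR : Equivalence R)
    (h : ∀ a x, R (delta N WT MB B₁ B₂ a x) (delta N WT MB B₁ B₂ a (b x))) :
    ∀ z, R z (upd N WT MB B₁ B₂ e b z) := by
  unfold upd
  refine foldl_pres (P := fun c : Fin (N + N) → Fin (N + N) => ∀ z, R z (c z)) ?_ _ _
    fun z => hR.refl z
  intro c a hc
  exact foldl_pres (P := fun c : Fin (N + N) → Fin (N + N) => ∀ z, R z (c z))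
    (fun c x hc => join_rel hR (h _ _) hc) _ _ hc

variable (N WT MB e)

/-- The index reached by reading a string. -/
noncomputable def deltaW : List (Layer α w × Layer α w) → List α → Fin (N + N) → Fin (N + N)
  | B :: E, a :: v, y => deltaW E v (delta N WT MB B.1 B.2 a y)
  | _, _, y => y

/-- The partition reached by a sequence of pairs of layers that are not initial. -/
noncomputable def updW (E : List (Layer α w × Layer α w)) (c : Fin (N + N) → Fin (N + N)) :
    Fin (N + N) → Fin (N + N) :=
  E.foldl (fun c B => upd N WT MB B.1 B.2 e c) c

/-- The partition reached by a pair of layers. -/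
noncomputable def stepP (B₁ B₂ : Layer α w) (c : Fin (N + N) → Fin (N + N)) :
    Fin (N + N) → Fin (N + N) :=
  upd N WT MB B₁ B₂ e (base N WT B₁ B₂ c)

/-- The partition reached by a sequence of pairs of layers. -/
noncomputable def partition (E : List (Layer α w × Layer α w)) : Fin (N + N) → Fin (N + N) :=
  E.foldl (fun c B => stepP N WT MB e B.1 B.2 c) id

variable {N WT MB e}

/-- Identified indices stay identified while both read the same word. This is the forward half of
the argument of Hopcroft and Karp. -/
theorem updW_sound (E : List (Layer α w × Layer α w)) : ∀ (v : List α)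
    (c : Fin (N + N) → Fin (N + N)) (x y : Fin (N + N)), v.length = E.length → c x = c y →
      updW N WT MB e E c (deltaW N WT MB E v x) = updW N WT MB e E c (deltaW N WT MB E v y) := by
  induction E with
  | nil => intro v c x y _ h; exact h
  | cons B E ih =>
    intro v c x y hv h
    cases v with
    | nil => simp at hv
    | cons a v =>
      simp only [deltaW, updW, List.foldl_cons]
      refine ih v _ _ _ (by simpa using hv) ?_
      -- Both successors are merged with the successor of the common label of x and y.
      rw [upd_sound, h, ← upd_sound]

/-- The relation to which `upd_complete` is applied is indistinguishability by words whose length is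
the number of remaining layers. A letter merged now becomes the first letter of a word one longer,
which the hypothesis covers. -/
theorem updW_complete {φ : Fin (N + N) → Prop} (E : List (Layer α w × Layer α w)) :
    ∀ (c : Fin (N + N) → Fin (N + N)),
      (∀ x, ∀ v : List α, v.length = E.length →
        (φ (deltaW N WT MB E v x) ↔ φ (deltaW N WT MB E v (c x)))) →
      ∀ x, φ x ↔ φ (updW N WT MB e E c x) := by
  induction E with
  | nil => intro c h x; exact h x [] rfl
  | cons B E ih =>
    intro c h x
    refine ih (upd N WT MB B.1 B.2 e c) (fun x => ?_) x
    refine upd_complete (e := e) (R := fun x y => ∀ v : List α, v.length = E.length →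
      (φ (deltaW N WT MB E v x) ↔ φ (deltaW N WT MB E v y))) ?_ ?_ x
    · exact ⟨fun _ _ _ => Iff.rfl, fun h v hv => (h v hv).symm,
        fun h h' v hv => (h v hv).trans (h' v hv)⟩
    · intro a x v hv
      exact h x (a :: v) (by simpa using hv)

/-- All sets of states that occur in runs of a diagram are in `G`. -/
def GoodRun (G : Set (Finset (Fin w))) : List (Layer α w) → Finset (Fin w) → Prop
  | [], A => A ∈ G
  | B :: D, A => A ∈ G ∧ ∀ a, GoodRun G D (stepS B a A)

theorem GoodRun.run {G : Set (Finset (Fin w))} : ∀ {D : List (Layer α w)} {A : Finset (Fin w)}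
    (v : List α), v.length = D.length → GoodRun G D A → runS D v A ∈ G := by
  intro D
  induction D with
  | nil => intro A v _ h; exact h
  | cons B D ih =>
    intro A v hv h
    cases v with
    | nil => simp at hv
    | cons a v => exact ih v (by simpa using hv) (h.2 a)

/-! ### Faithfulness of the numbering on the macro states that occur in runs. -/

section good
variable {G : Set (Finset (Fin w))} (hG : ∀ A ∈ G, decS w MB (encS N WT A) = A)
include hG

/-- A macro state in `G` is recovered from its number. Its successor need not be in `G` here; it is
numbered in any case and decoded only at the next step. -/
theorem delta_left {B₁ B₂ : Layer α w} {A : Finset (Fin w)} (hA : A ∈ G) (a : α) :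
    delta N WT MB B₁ B₂ a (left N WT A) = left N WT (stepS B₁ a A) := by
  have h : ((left N WT A : Fin (N + N)) : ℕ) < N := encS_lt WT A
  unfold delta
  rw [if_pos h]
  congr 2
  exact hG A hA

theorem delta_right {B₁ B₂ : Layer α w} {A : Finset (Fin w)} (hA : A ∈ G) (a : α) :
    delta N WT MB B₁ B₂ a (right N WT A) = right N WT (stepS B₂ a A) := by
  have h : ¬ ((right N WT A : Fin (N + N)) : ℕ) < N := by simp [right]
  unfold delta
  rw [if_neg h]
  congr 2
  simp only [right, Nat.add_sub_cancel]
  exact hG A hA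

theorem isFin_left {B₁ B₂ : Layer α w} {A : Finset (Fin w)} (hA : A ∈ G) :
    IsFin N MB B₁ B₂ (left N WT A) ↔ ∃ q ∈ A, q ∈ B₁.final := by
  have h : ((left N WT A : Fin (N + N)) : ℕ) < N := encS_lt WT A
  unfold IsFin
  rw [if_pos h]
  simp only [left, hG A hA]

theorem isFin_right {B₁ B₂ : Layer α w} {A : Finset (Fin w)} (hA : A ∈ G) :
    IsFin N MB B₁ B₂ (right N WT A) ↔ ∃ q ∈ A, q ∈ B₂.final := by
  have h : ¬ ((right N WT A : Fin (N + N)) : ℕ) < N := by simp [right]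
  unfold IsFin
  rw [if_neg h]
  simp only [right, Nat.add_sub_cancel, hG A hA]

/-- Along a run all of whose sets lie in `G`, indices follow the subset construction of the first
diagram; the second diagram only has to have the same length. -/
theorem deltaW_left : ∀ {D D' : List (Layer α w)} {A : Finset (Fin w)} (v : List α),
    D.length = D'.length → v.length = D.length → GoodRun G D A →
      deltaW N WT MB (D.zip D') v (left N WT A) = left N WT (runS D v A) := by
  intro D
  induction D with
  | nil => intro D' A v _ _ h; simp [deltaW, runS]
  | cons B D ih =>
    intro D' A v hD hv h
    cases v with
    | nil => simp at hv
    | cons a v =>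
      cases D' with
      | nil => simp at hD
      | cons B' D' =>
        simp only [List.zip_cons_cons, deltaW, runS]
        rw [delta_left hG h.1]
        exact ih v (by simpa using hD) (by simpa using hv) (h.2 a)

theorem deltaW_right : ∀ {D D' : List (Layer α w)} {A : Finset (Fin w)} (v : List α),
    D.length = D'.length → v.length = D.length → GoodRun G D' A →
      deltaW N WT MB (D.zip D') v (right N WT A) = right N WT (runS D' v A) := by
  intro D
  induction D with
  | nil =>
    intro D' A v hD _ h
    have : D' = [] := List.length_eq_zero_iff.1 (by simpa using hD.symm)
    subst this
    simp [deltaW, runS]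
  | cons B D ih =>
    intro D' A v hD hv h
    cases v with
    | nil => simp at hv
    | cons a v =>
      cases D' with
      | nil => simp at hD
      | cons B' D' =>
        simp only [List.zip_cons_cons, deltaW, runS]
        rw [delta_right hG h.1]
        exact ih v (by simpa using hD) (by simpa using hv) (h.2 a)

end good

/-- The initial flag is set in the first layer only, so the merging of the initial macro states
happens once. At that layer `base` ignores its argument, so the partition with which the search
starts is immaterial. -/
theorem partition_eq {B B' : Layer α w} {D D' : List (Layer α w)} (hD : IsODD (B :: D)) :
    partition N WT MB e ((B :: D).zip (B' :: D')) =
      updW N WT MB e ((B :: D).zip (B' :: D')) (base N WT B B' id) := by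
  have hflag : ∀ B ∈ D, B.initFlag = false := by
    intro C hC
    obtain ⟨i, hi, rfl⟩ := List.getElem_of_mem hC
    have := hD.2.2.1 (i + 1) (by simpa using hi)
    simp only [List.getElem_cons_succ] at this
    simpa using this
  have key : ∀ (E E' : List (Layer α w)) (c : Fin (N + N) → Fin (N + N)),
      (∀ B ∈ E, B.initFlag = false) →
      (E.zip E').foldl (fun c B => stepP N WT MB e B.1 B.2 c) c = updW N WT MB e (E.zip E') c := by
    intro E
    induction E with
    | nil => intro E' c _; rfl
    | cons C E ih =>
      intro E' c h
      cases E' with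
      | nil => rfl
      | cons C' E' =>
        simp only [List.zip_cons_cons, updW, List.foldl_cons]
        rw [ih _ _ fun B hB => h B (List.mem_cons_of_mem _ hB)]
        have : stepP N WT MB e C C' c = upd N WT MB C C' e c := by
          unfold stepP base
          rw [if_neg (by rw [h C (List.mem_cons_self ..)]; decide)]
        rw [this]; rfl
  unfold partition
  simp only [List.zip_cons_cons, List.foldl_cons]
  rw [key _ _ _ hflag]
  rfl

/-- All final indices are separated from the other ones by the partition `c`. -/
theorem check_iff {G : Set (Finset (Fin w))} (hG : ∀ A ∈ G, decS w MB (encS N WT A) = A)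
    {D D' : List (Layer α w)} (hD : IsODD D) (hD' : IsODD D') (hlen : D.length = D'.length)
    (hg : ∀ B ∈ D.head?, GoodRun G D B.init) (hg' : ∀ B ∈ D'.head?, GoodRun G D' B.init)
    {C C' : Layer α w} (hC : C ∈ D.getLast?) (hC' : C' ∈ D'.getLast?) :
    (∀ x, IsFin N MB C C' x ↔ IsFin N MB C C' (partition N WT MB e (D.zip D') x)) ↔
      oddLanguage D = oddLanguage D' := by
  rw [oddLanguage_eq_iff hD.1 hD'.1]
  simp only [hlen, true_and]
  cases D with
  | nil => exact absurd rfl hD.1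
  | cons B D =>
  cases D' with
  | nil => exact absurd rfl hD'.1
  | cons B' D' =>
  have hgB := hg B rfl
  have hgB' := hg' B' rfl
  -- Acceptance becomes finality of the index reached from the initial index, on either side.
  have hacc : ∀ u : List α, u.length = (B :: D).length → (AcceptsList (B :: D) u ↔
      IsFin N MB C C' (deltaW N WT MB ((B :: D).zip (B' :: D')) u (left N WT B.init))) := by
    intro u hu
    rw [deltaW_left hG u hlen hu hgB, isFin_left hG (GoodRun.run u hu hgB)]
    unfold AcceptsList
    rw [Option.mem_def] at hC
    simp [hC]
  have hacc' : ∀ u : List α, u.length = (B :: D).length → (AcceptsList (B' :: D') u ↔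
      IsFin N MB C C' (deltaW N WT MB ((B :: D).zip (B' :: D')) u (right N WT B'.init))) := by
    intro u hu
    rw [deltaW_right hG u hlen hu hgB', isFin_right hG (GoodRun.run u (hu.trans hlen) hgB')]
    unfold AcceptsList
    rw [Option.mem_def] at hC'
    simp [hC']
  have hiff : (∀ u : List α, u.length = (B' :: D').length →
      (AcceptsList (B :: D) u ↔ AcceptsList (B' :: D') u)) ↔
      ∀ u : List α, u.length = (B :: D).length →
      (IsFin N MB C C' (deltaW N WT MB ((B :: D).zip (B' :: D')) u (left N WT B.init)) ↔
      IsFin N MB C C' (deltaW N WT MB ((B :: D).zip (B' :: D')) u (right N WT B'.init))) := by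
    rw [← hlen]
    exact forall_congr' fun u => forall_congr' fun hu => by rw [hacc u hu, hacc' u hu]
  rw [hiff, partition_eq hD]
  have hflag : B.initFlag = true := (hD.2.2.1 0 (by simp)).2 rfl
  have hzl : ((B :: D).zip (B' :: D')).length = (B :: D).length := by
    rw [List.length_zip, ← hlen, min_self]
  set E := (B :: D).zip (B' :: D') with hE
  set b : Fin (N + N) → Fin (N + N) := base N WT B B' id with hb
  have hbv : ∀ z, b z = if z = left N WT B.init then right N WT B'.init else z := by
    intro z; rw [hb]; unfold base; rw [if_pos hflag]
  constructor
  -- The initial indices are identified, so after u the two indices reached have the same label, and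
  -- each agrees in finality with that label.
  · intro h u hu
    rw [h, h (deltaW N WT MB E u (right N WT B'.init)),
      updW_sound E u b (left N WT B.init) (right N WT B'.init) (by rw [hzl, hu])]
    rw [hbv, hbv, if_pos rfl]
    split <;> rfl
  -- The first partition moves only the initial index of the first side, to that of the second, and
  -- no word tells these two apart when the languages agree.
  · intro h
    refine updW_complete E b fun x v hv => ?_
    rw [hbv]
    split
    · next hx => rw [hx]; exact h v (by rw [hv, hzl])
    · exact Iff.rfl

end SecondOrder

namespace SecondOrder

/-! ### Breadth-first search -/

section code
open Var Arr Cmd Exp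

/-- The number of the node given by `g1`, `g2` and `cn`. -/
def keyC : Cmd :=
  key ≔ rd row ♯g1 + ♯g2 ⨾ loop j M (mulC acc key M ⨾ key ≔ ♯acc + rd cn ♯j)

/-- Appends the node given by `g1`, `g2` and `cn` to the queue. -/
def insertC : Cmd :=
  (write vis ♯key 1 ⨾ write Q1 ♯cnt ♯g1 ⨾ write Q2 ♯cnt ♯g2) ⨾ mulC ad cnt M ⨾
    loop j M (write QC (♯ad + ♯j) (rd cn ♯j)) ⨾ cnt ≔ ♯cnt + 1

/-- Appends the node given by `g1`, `g2` and `cn` to the queue if it is new. -/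
def pushC : Cmd := keyC ⨾ ifz (rd vis ♯key) insertC skip

/-- Processes a pair of transitions. -/
def edgeC : Cmd :=
  baseC ⨾ updC ⨾ (g1 ≔ inp (♯p1 + ♯lam - 1) ⨾ g2 ≔ inp (♯p2 + ♯lam - 1)) ⨾ checkC ⨾ pushC

/-- Loads the `i`-th node. -/
def loadC : Cmd :=
  (q1 ≔ rd Q1 ♯i ⨾ q2 ≔ rd Q2 ♯i ⨾ d1 ≔ rd deg1 ♯q1 ⨾ d2 ≔ rd deg2 ♯q2) ⨾
    mulC ad i M ⨾ loop j M (write c ♯j (rd QC (♯ad + ♯j)))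

/-- Processes the transitions from the second state. -/
def innerC : Cmd := loop j2 d2 (p2 ≔ rd out2 (rd rowB ♯q2 + ♯j2) ⨾ edgeC)

/-- Processes the transitions from the first state. -/
def outerC : Cmd := loop j1 d1 (p1 ≔ rd out1 (rd rowA ♯q1 + ♯j1) ⨾ innerC)

/-- The search. -/
def searchC : Cmd := loop i bnd (ifz (♯cnt - ♯i) skip (loadC ⨾ outerC))

end code

/-- The nodes of the search: a pair of states and a partition. -/
abbrev Node (n₁ n₂ M : ℕ) : Type := Fin n₁ × Fin n₂ × (Fin M → Fin M)

/-- The number of a node. -/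
def Node.key {n₁ n₂ M : ℕ} (ν : Node n₁ n₂ M) : ℕ :=
  (List.finRange M).foldl (fun acc j => acc * M + ν.2.2 j) (ν.1 * n₂ + ν.2.1)

theorem mul_add_inj {M a b x y : ℕ} (hx : x < M) (hy : y < M) (h : a * M + x = b * M + y) :
    a = b ∧ x = y := by
  have h1 := congrArg (· % M) h
  simp only [Nat.mul_add_mod_self_right, Nat.mod_eq_of_lt hx, Nat.mod_eq_of_lt hy] at h1
  subst h1
  exact ⟨Nat.eq_of_mul_eq_mul_right (by omega) (Nat.add_right_cancel h), rfl⟩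

/-- The key is a numeral in mixed radix: the two states, then M digits in base M. Its digits can be
recovered from the last one on. -/
theorem Node.key_injective {n₁ n₂ M : ℕ} : Function.Injective (Node.key (n₁ := n₁) (n₂ := n₂)
    (M := M)) := by
  have key : ∀ (c c' : Fin M → Fin M) (l : List (Fin M)) (a a' : ℕ),
      l.foldl (fun acc j => acc * M + (c j : ℕ)) a = l.foldl (fun acc j => acc * M + (c' j : ℕ)) a' →
      a = a' ∧ ∀ j ∈ l, c j = c' j := by
    intro c c' l
    induction l with
    | nil => intro a a' h; exact ⟨h, by simp⟩
    | cons j l ih =>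
      intro a a' h
      obtain ⟨h1, h2⟩ := ih _ _ h
      obtain ⟨h3, h4⟩ := mul_add_inj (c j).2 (c' j).2 h1
      refine ⟨h3, fun i hi => ?_⟩
      rcases List.mem_cons.1 hi with rfl | hi
      · exact Fin.ext h4
      · exact h2 i hi
  rintro ⟨q1, q2, c⟩ ⟨q1', q2', c'⟩ h
  obtain ⟨h1, h2⟩ := key c c' _ _ _ h
  obtain ⟨h3, h4⟩ := mul_add_inj q2.2 q2'.2 h1
  have e1 : q1 = q1' := Fin.ext h3
  have e2 : q2 = q2' := Fin.ext h4
  have e3 : c = c' := funext fun j => h2 j (List.mem_finRange j)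
  rw [e1, e2, e3]

/-- The state `t` represents the queue `l`. -/
structure Queue {n₁ n₂ M : ℕ} (l : List (Node n₁ n₂ M)) (t : St) : Prop where
  cnt : t.reg .cnt = l.length
  q1 : ∀ (i : ℕ) (h : i < l.length), t.arr .Q1 i = l[i].1
  q2 : ∀ (i : ℕ) (h : i < l.length), t.arr .Q2 i = l[i].2.1
  qc : ∀ (i : ℕ) (h : i < l.length) (x : Fin M), t.arr .QC (i * M + x) = l[i].2.2 x
  vis : ∀ ν : Node n₁ n₂ M, t.arr .vis ν.key ≠ 0 ↔ ν ∈ l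
  nodup : l.Nodup

theorem Queue.congr {n₁ n₂ M : ℕ} {l : List (Node n₁ n₂ M)} {t u : St} (h : Queue l t)
    (h1 : u.reg .cnt = t.reg .cnt) (h2 : u.arr .Q1 = t.arr .Q1) (h3 : u.arr .Q2 = t.arr .Q2)
    (h4 : u.arr .QC = t.arr .QC) (h5 : u.arr .vis = t.arr .vis) : Queue l u :=
  ⟨by rw [h1, h.cnt], by rw [h2]; exact h.q1, by rw [h3]; exact h.q2, by rw [h4]; exact h.qc,
    by rw [h5]; exact h.vis, h.nodup⟩

open Classical in
/-- Append a node unless it is in the list. -/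
noncomputable def pushNode {n₁ n₂ M : ℕ} (l : List (Node n₁ n₂ M)) (ν : Node n₁ n₂ M) :
    List (Node n₁ n₂ M) := if ν ∈ l then l else l ++ [ν]

variable {α : Type*} {w S : ℕ} {X : ℕ → ℕ} {n₁ n₂ M : ℕ}

theorem mem_pushNode {l : List (Node n₁ n₂ M)} {ν ν' : Node n₁ n₂ M} :
    ν' ∈ pushNode l ν ↔ ν' ∈ l ∨ ν' = ν := by
  unfold pushNode
  split
  · constructor
    · exact Or.inl
    · rintro (h | rfl) <;> assumption
  · simp

/-- The product of the first state with n₂ comes from a table. Repeated addition would cost a factor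
n₂ for every pair of transitions and spoil the time bound. -/
theorem keyC_reg {t : St} {ν : Node n₁ n₂ M} (hM : t.reg .M = M)
    (hrow : t.arr .row ν.1 = ν.1 * n₂) (h1 : t.reg .g1 = ν.1) (h2 : t.reg .g2 = ν.2.1)
    (hc : Rep (t.arr .cn) ν.2.2) : (keyC.eval X t).reg .key = ν.key := by
  unfold keyC Node.key
  rw [Cmd.eval_seq]
  refine eval_loop_foldl (by rw [Cmd.reg_frame _ _ _ rfl, hM])
    (fun t acc => t.reg .key = acc) _ (by simp [Cmd.eval, h1, h2, hrow]) ?_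
  intro j u acc hF hu
  rw [Cmd.eval_seq]
  have h3 : u.arr .cn j = ν.2.2 j := by rw [hF.arr _ rfl, Cmd.arr_frame _ _ _ rfl, hc]
  have h4 : u.reg .M = M := by rw [hF.reg _ rfl (by decide), Cmd.reg_frame _ _ _ rfl, hM]
  set u' := (mulC .acc .key .M).eval X (u.set .j j) with hu'
  have h5 : u'.reg .acc = acc * M := by
    rw [hu', mulC_reg (by decide) (by decide) (by decide) (by decide)]; simp [hu, h4]
  have h6 : u'.reg .j = j := by rw [hu', Cmd.reg_frame _ _ _ rfl]; simp
  have h7 : u'.arr .cn = u.arr .cn := by rw [hu', Cmd.arr_frame _ _ _ rfl]; rfl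
  simp [Cmd.eval, h5, h6, h7, h3]

/-- The partition of the i-th node fills the M cells from i M on, so the new block does not touch
earlier ones. Injectivity of the key ensures that marking the new node marks no other. -/
theorem insertC_queue {t : St} {l : List (Node n₁ n₂ M)} (h : Queue l t) {ν : Node n₁ n₂ M}
    (hν : ν ∉ l) (hM : t.reg .M = M) (h1 : t.reg .g1 = ν.1) (h2 : t.reg .g2 = ν.2.1)
    (hc : Rep (t.arr .cn) ν.2.2) (hkey : t.reg .key = ν.key) :
    Queue (l ++ [ν]) (insertC.eval X t) := by
  unfold insertC
  simp only [Cmd.eval_seq]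
  set t1 := (Cmd.write .Q2 ♯.cnt ♯.g2).eval X ((Cmd.write .Q1 ♯.cnt ♯.g1).eval X
    ((Cmd.write .vis ♯.key 1).eval X t)) with ht1
  set t2 := (mulC .ad .cnt .M).eval X t1 with ht2
  have had : t2.reg .ad = l.length * M := by
    rw [ht2, mulC_reg (by decide) (by decide) (by decide) (by decide)]
    simp [ht1, Cmd.eval, h.cnt, hM]
  have hM2 : t2.reg .M = M := by
    rw [ht2, Cmd.reg_frame _ _ _ rfl, ht1, Cmd.reg_frame _ _ _ rfl, Cmd.reg_frame _ _ _ rfl,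
      Cmd.reg_frame _ _ _ rfl, hM]
  have hcn2 : t2.arr .cn = t.arr .cn := by
    rw [ht2, Cmd.arr_frame _ _ _ rfl, ht1, Cmd.arr_frame _ _ _ rfl, Cmd.arr_frame _ _ _ rfl,
      Cmd.arr_frame _ _ _ rfl]
  have hqc2 : t2.arr .QC = t.arr .QC := by
    rw [ht2, Cmd.arr_frame _ _ _ rfl, ht1, Cmd.arr_frame _ _ _ rfl, Cmd.arr_frame _ _ _ rfl,
      Cmd.arr_frame _ _ _ rfl]
  set t3 := (Cmd.loop .j .M (.write .QC (♯.ad + ♯.j) (.rd .cn ♯.j))).eval X t2 with ht3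
  have hqc3 : ∀ y, t3.arr .QC y = if l.length * M ≤ y ∧ y < l.length * M + M then
      t.arr .cn (y - l.length * M) else t.arr .QC y := by
    have := eval_loop_ind (X := X) (i := .j) (n := .M)
      (c := .write .QC (♯.ad + ♯.j) (.rd .cn ♯.j)) (s := t2)
      (fun j u => ∀ y, u.arr .QC y = if l.length * M ≤ y ∧ y < l.length * M + j then
        t.arr .cn (y - l.length * M) else t.arr .QC y)
      (by intro y; rw [if_neg (by omega), hqc2]) ?_
    · rw [hM2] at this; exact this
    · intro j hj u hF hu y
      have a1 : u.reg .ad = l.length * M := by rw [hF.reg _ rfl (by decide), had]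
      have a2 : u.arr .cn = t.arr .cn := by rw [hF.arr _ rfl, hcn2]
      have hy := hu y
      simp only [Cmd.eval, St.put_arr, if_true, Exp.val_add, Exp.val_var, Exp.val_rd, St.set_reg,
        St.set_arr, Function.update_apply, a2]
      have a1' : (if Var.ad = Var.j then j else u.reg .ad) = l.length * M := by
        rw [if_neg (by decide), a1]
      rw [a1']
      by_cases hyj : y = l.length * M + j
      · rw [if_pos hyj, if_pos (by omega), hyj, Nat.add_sub_cancel_left]
      · rw [if_neg hyj, hy]
        by_cases h' : l.length * M ≤ y ∧ y < l.length * M + j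
        · rw [if_pos h', if_pos (by omega)]
        · rw [if_neg h', if_neg (by omega)]
  have fr : ∀ k, k ≠ .QC → ((Var.cnt ≔ ♯.cnt + 1).eval X t3).arr k = t1.arr k := by
    intro k hk
    rw [Cmd.arr_frame _ _ _ rfl, ht3, Cmd.arr_frame _ _ _ (by simpa [Cmd.wa] using hk), ht2,
      Cmd.arr_frame _ _ _ (by cases k <;> rfl)]
  have hfin : ((Var.cnt ≔ ♯.cnt + 1).eval X t3).arr .QC = t3.arr .QC := Cmd.arr_frame _ _ _ rfl
  have hcnt3 : t3.reg .cnt = l.length := by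
    rw [ht3, Cmd.reg_frame _ _ _ rfl, ht2, Cmd.reg_frame _ _ _ rfl, ht1, Cmd.reg_frame _ _ _ rfl,
      Cmd.reg_frame _ _ _ rfl, Cmd.reg_frame _ _ _ rfl, h.cnt]
  refine ⟨by simp [Cmd.eval, hcnt3], ?_, ?_, ?_, ?_, ?_⟩
  · intro i hi
    rw [fr _ (by decide)]
    by_cases hil : i < l.length
    · have : i ≠ l.length := by omega
      simp [ht1, Cmd.eval, h.cnt, Function.update_apply, this, List.getElem_append_left hil,
        h.q1 i hil]
    · have : i = l.length := by simp at hi; omega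
      subst this
      simp [ht1, Cmd.eval, h.cnt, h1]
  · intro i hi
    rw [fr _ (by decide)]
    by_cases hil : i < l.length
    · have : i ≠ l.length := by omega
      simp [ht1, Cmd.eval, h.cnt, Function.update_apply, this, List.getElem_append_left hil,
        h.q2 i hil]
    · have : i = l.length := by simp at hi; omega
      subst this
      simp [ht1, Cmd.eval, h.cnt, h2]
  · intro i hi x
    rw [hfin, hqc3]
    have hx := x.2
    by_cases hil : i < l.length
    · have : i * M + x < l.length * M := by
        calc i * M + x < i * M + M := by omega
          _ = (i + 1) * M := by ring
          _ ≤ l.length * M := Nat.mul_le_mul_right _ hil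
      rw [if_neg (by omega), h.qc i hil]
      simp [List.getElem_append_left hil]
    · have : i = l.length := by simp at hi; omega
      subst this
      rw [if_pos (by omega), Nat.add_sub_cancel_left, hc]
      simp
  · intro ν'
    rw [fr _ (by decide)]
    simp only [ht1, Cmd.eval, St.put_arr, Exp.val_var, hkey, Function.update_apply]
    by_cases hνν : ν' = ν
    · subst hνν; simp
    · have : ν'.key ≠ ν.key := fun h => hνν (Node.key_injective h)
      simp [this, hνν]
      exact h.vis ν'
  · rw [List.nodup_append]
    refine ⟨h.nodup, by simp, ?_⟩
    rintro a ha b hb rfl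
    simp at hb
    subst hb
    exact hν ha

theorem pushC_queue {t : St} {l : List (Node n₁ n₂ M)} (h : Queue l t) {ν : Node n₁ n₂ M}
    (hM : t.reg .M = M) (hrow : t.arr .row ν.1 = ν.1 * n₂) (h1 : t.reg .g1 = ν.1)
    (h2 : t.reg .g2 = ν.2.1) (hc : Rep (t.arr .cn) ν.2.2) :
    Queue (pushNode l ν) (pushC.eval X t) := by
  unfold pushC
  rw [Cmd.eval_seq]
  have hk := keyC_reg (X := X) hM hrow h1 h2 hc
  set u := keyC.eval X t with hu
  have hQ : Queue l u := h.congr (Cmd.reg_frame _ _ _ rfl) (Cmd.arr_frame _ _ _ rfl)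
    (Cmd.arr_frame _ _ _ rfl) (Cmd.arr_frame _ _ _ rfl) (Cmd.arr_frame _ _ _ rfl)
  unfold pushNode
  by_cases hν : ν ∈ l
  · rw [if_pos hν, Cmd.eval_ifz_neg (by simpa [hk] using (hQ.vis ν).2 hν)]
    exact hQ
  · have : u.arr .vis ν.key = 0 := by
      by_contra h; exact hν ((hQ.vis ν).1 h)
    rw [if_neg hν, Cmd.eval_ifz_pos (by simpa [hk] using this)]
    refine insertC_queue hQ hν ?_ ?_ ?_ ?_ hk
    · rw [hu, Cmd.reg_frame _ _ _ rfl, hM]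
    · rw [hu, Cmd.reg_frame _ _ _ rfl, h1]
    · rw [hu, Cmd.reg_frame _ _ _ rfl, h2]
    · rw [hu, Cmd.arr_frame _ _ _ rfl]; exact hc

/-! ### The tables of the search -/

/-- The variables that the search does not change. -/
def frozenVars : List Var := [.s, .w, .n1, .n2, .lam, .ac1, .ac2, .N, .M, .bnd]

/-- The arrays that the search does not change. -/
def frozenArrs : List Arr := [.wt, .memb, .row, .rowA, .rowB, .deg1, .deg2, .out1, .out2]

/-- `t` has the same tables as `s`. -/
structure Same (s t : St) : Prop where
  reg : ∀ v ∈ frozenVars, t.reg v = s.reg v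
  arr : ∀ k ∈ frozenArrs, t.arr k = s.arr k

/-- A command does not change the tables of the search. -/
def Cmd.keeps₃ (c : Cmd) : Bool :=
  frozenVars.all (fun v => !c.wr v) && frozenArrs.all (fun k => !c.wa k)

theorem Same.frame {s t u : St} {i : Var} {c : Cmd} (h : Same s t) (hF : Frame c i t u)
    (hc : c.keeps₃ = true) (hi : (Cmd.assign i 0).keeps₃ = true) : Same s u := by
  simp only [Cmd.keeps₃, Bool.and_eq_true, List.all_eq_true, Bool.not_eq_true'] at hc hi
  refine ⟨fun v hv => ?_, fun k hk => ?_⟩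
  · rw [hF.reg v (hc.1 v hv) (by simpa [Cmd.wr] using hi.1 v hv), h.reg v hv]
  · rw [hF.arr k (hc.2 k hk), h.arr k hk]

theorem Same.eval {s t : St} (h : Same s t) (c : Cmd) (hc : c.keeps₃ = true) :
    Same s (c.eval X t) :=
  h.frame (i := .k) ⟨fun u hu _ => c.reg_frame X t hu, fun k hk => c.arr_frame X t hk⟩ hc rfl

theorem Same.set {s t : St} (h : Same s t) (v : Var) (x : ℕ)
    (hv : (Cmd.assign v 0).keeps₃ = true) : Same s (t.set v x) := by
  have := h.eval (X := fun _ => 0) (.assign v (.lit x)) hv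
  exact this

/-- Tables for the transitions that leave a state: `src` gives the source of a transition and `pt`
its address. -/
structure Adj (n T : ℕ) (src : Fin T → Fin n) (pt : Fin T → ℕ) (deg row out : ℕ → ℕ) : Prop where
  fn : ∀ q : Fin n, ∃ f : Fin (deg q) → Fin T, (∀ j : Fin (deg q), out (row q + j) = pt (f j)) ∧
    ∀ i, src i = q ↔ ∃ j, f j = i
  sum : ∑ q : Fin n, deg q = T

/-- The transitions `tr` are listed from address `b` on, with blocks of length `lam`. -/
structure Listing (X : ℕ → ℕ) (e : α ≃ Fin S) {n T : ℕ} (lam b : ℕ)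
    (tr : Fin T → Fin n × Layer α w × Fin n) : Prop where
  src : ∀ i : Fin T, X (b + i * lam) = (tr i).1
  layer : ∀ i : Fin T, IsLayerAt X e (b + i * lam) (tr i).2.1
  tgt : ∀ i : Fin T, X (b + i * lam + lam - 1) = (tr i).2.2

section search

variable {T₁ T₂ N : ℕ} {WT MB : ℕ → ℕ} {e : α ≃ Fin S}

/-- What has to be known before the search starts. -/
structure Setup (X : ℕ → ℕ) (N : ℕ) (WT MB : ℕ → ℕ) (e : α ≃ Fin S) (b₁ b₂ : ℕ)
    (tr₁ : Fin T₁ → Fin n₁ × Layer α w × Fin n₁) (tr₂ : Fin T₂ → Fin n₂ × Layer α w × Fin n₂)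
    (acc₁ : Fin n₁ → Prop) (acc₂ : Fin n₂ → Prop) (s : St) : Prop where
  env : Env w S N WT MB s
  row : ∀ q : Fin n₁, s.arr .row q = q * n₂
  lst₁ : Listing X e (s.reg .lam) b₁ tr₁
  lst₂ : Listing X e (s.reg .lam) b₂ tr₂
  adj₁ : Adj n₁ T₁ (fun i => (tr₁ i).1) (fun i => b₁ + i * s.reg .lam)
    (s.arr .deg1) (s.arr .rowA) (s.arr .out1)
  adj₂ : Adj n₂ T₂ (fun i => (tr₂ i).1) (fun i => b₂ + i * s.reg .lam)
    (s.arr .deg2) (s.arr .rowB) (s.arr .out2)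
  acc₁ : ∀ q : Fin n₁, X (s.reg .ac1 + q) = bit (acc₁ q)
  acc₂ : ∀ q : Fin n₂, X (s.reg .ac2 + q) = bit (acc₂ q)
  bnd : s.reg .bnd = n₁ * n₂ * (N + N) ^ (N + N)

variable {b₁ b₂ : ℕ} {tr₁ : Fin T₁ → Fin n₁ × Layer α w × Fin n₁}
  {tr₂ : Fin T₂ → Fin n₂ × Layer α w × Fin n₂} {acc₁ : Fin n₁ → Prop} {acc₂ : Fin n₂ → Prop}

theorem Same.env {s t : St} (h : Same s t) (hs : Env w S N WT MB s) : Env w S N WT MB t :=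
  ⟨by rw [h.reg _ (by decide), hs.eqS], by rw [h.reg _ (by decide), hs.eqw],
    by rw [h.reg _ (by decide), hs.eqN], by rw [h.reg _ (by decide), hs.eqM],
    by rw [h.arr _ (by decide), hs.eqwt], by rw [h.arr _ (by decide), hs.eqmb]⟩

variable [NeZero N]

variable (N WT MB e tr₁ tr₂) in
/-- The node reached from a node by a pair of transitions. -/
noncomputable def succ (i₁ : Fin T₁) (i₂ : Fin T₂) (ν : Node n₁ n₂ (N + N)) :
    Node n₁ n₂ (N + N) :=
  ((tr₁ i₁).2.2, (tr₂ i₂).2.2, stepP N WT MB e (tr₁ i₁).2.1 (tr₂ i₂).2.1 ν.2.2)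

variable (N WT MB e tr₁ tr₂ acc₁ acc₂) in
/-- A pair of transitions witnesses a common language. -/
def Wins (i₁ : Fin T₁) (i₂ : Fin T₂) (ν : Node n₁ n₂ (N + N)) : Prop :=
  acc₁ (tr₁ i₁).2.2 ∧ acc₂ (tr₂ i₂).2.2 ∧ ∀ x, IsFin N MB (tr₁ i₁).2.1 (tr₂ i₂).2.1 x ↔
    IsFin N MB (tr₁ i₁).2.1 (tr₂ i₂).2.1 (stepP N WT MB e (tr₁ i₁).2.1 (tr₂ i₂).2.1 ν.2.2 x)

/-- The target of a transition is the last cell of its block, at offset `lam - 1`. The check for a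
win uses the partition behind the pair of layers, before the node is queued. -/
theorem edgeC_spec {s t : St} (hs : Setup X N WT MB e b₁ b₂ tr₁ tr₂ acc₁ acc₂ s) (ht : Same s t)
    {ν : Node n₁ n₂ (N + N)} (hc : Rep (t.arr .c) ν.2.2) {l : List (Node n₁ n₂ (N + N))}
    (hQ : Queue l t) {i₁ : Fin T₁} {i₂ : Fin T₂} (hp1 : t.reg .p1 = b₁ + i₁ * s.reg .lam)
    (hp2 : t.reg .p2 = b₂ + i₂ * s.reg .lam) :
    Queue (pushNode l (succ N WT MB e tr₁ tr₂ i₁ i₂ ν)) (edgeC.eval X t) ∧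
      ((edgeC.eval X t).reg .ans ≠ 0 ↔ t.reg .ans ≠ 0 ∨
        Wins N WT MB e tr₁ tr₂ acc₁ acc₂ i₁ i₂ ν) := by
  have hE : Edge X N WT MB e (tr₁ i₁).2.1 (tr₂ i₂).2.1 t :=
    ⟨ht.env hs.env, by rw [hp1]; exact hs.lst₁.layer i₁, by rw [hp2]; exact hs.lst₂.layer i₂⟩
  unfold edgeC
  simp only [Cmd.eval_seq]
  have hb := baseC_arr hE hc
  set t1 := baseC.eval X t with ht1
  have hE1 : Edge X N WT MB e (tr₁ i₁).2.1 (tr₂ i₂).2.1 t1 := hE.eval _ rfl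
  have hu := updC_arr hE1 hb
  set t2 := updC.eval X t1 with ht2
  have hE2 : Edge X N WT MB e (tr₁ i₁).2.1 (tr₂ i₂).2.1 t2 := hE1.eval _ rfl
  set t3 := (Var.g2 ≔ .inp (♯.p2 + ♯.lam - 1)).eval X
    ((Var.g1 ≔ .inp (♯.p1 + ♯.lam - 1)).eval X t2) with ht3
  have hE3 : Edge X N WT MB e (tr₁ i₁).2.1 (tr₂ i₂).2.1 t3 := (hE2.eval _ rfl).eval _ rfl
  have hs2 : Same s t2 := (ht.eval _ rfl).eval _ rfl
  have hs3 : Same s t3 := (hs2.eval _ rfl).eval _ rfl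
  have hlam : t2.reg .lam = s.reg .lam := hs2.reg _ (by decide)
  have hp12 : t2.reg .p1 = b₁ + i₁ * s.reg .lam := by
    rw [ht2, Cmd.reg_frame _ _ _ rfl, ht1, Cmd.reg_frame _ _ _ rfl, hp1]
  have hp22 : t2.reg .p2 = b₂ + i₂ * s.reg .lam := by
    rw [ht2, Cmd.reg_frame _ _ _ rfl, ht1, Cmd.reg_frame _ _ _ rfl, hp2]
  have hg1 : t3.reg .g1 = (tr₁ i₁).2.2 := by
    rw [← hs.lst₁.tgt i₁]
    simp [ht3, Cmd.eval, hlam, hp12]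
  have hg2 : t3.reg .g2 = (tr₂ i₂).2.2 := by
    rw [← hs.lst₂.tgt i₂]
    simp [ht3, Cmd.eval, hlam, hp22]
  have hcn3 : Rep (t3.arr .cn) (stepP N WT MB e (tr₁ i₁).2.1 (tr₂ i₂).2.1 ν.2.2) := by
    rw [ht3, Cmd.arr_frame _ _ _ rfl, Cmd.arr_frame _ _ _ rfl]; exact hu
  have hck := checkC_reg hE3 hcn3
  set t4 := checkC.eval X t3 with ht4
  have hs4 : Same s t4 := hs3.eval _ rfl
  have hQ4 : Queue l t4 := by
    refine hQ.congr ?_ ?_ ?_ ?_ ?_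
    · rw [ht4, Cmd.reg_frame _ _ _ rfl, ht3, Cmd.reg_frame _ _ _ rfl, Cmd.reg_frame _ _ _ rfl, ht2,
        Cmd.reg_frame _ _ _ rfl, ht1, Cmd.reg_frame _ _ _ rfl]
    all_goals
      rw [ht4, Cmd.arr_frame _ _ _ rfl, ht3, Cmd.arr_frame _ _ _ rfl, Cmd.arr_frame _ _ _ rfl, ht2,
        Cmd.arr_frame _ _ _ rfl, ht1, Cmd.arr_frame _ _ _ rfl]
  constructor
  · refine pushC_queue (ν := succ N WT MB e tr₁ tr₂ i₁ i₂ ν) hQ4 (hs4.env hs.env).eqM ?_ ?_ ?_ ?_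
    · rw [hs4.arr _ (by decide)]; exact hs.row _
    · rw [ht4, Cmd.reg_frame _ _ _ rfl, hg1]; rfl
    · rw [ht4, Cmd.reg_frame _ _ _ rfl, hg2]; rfl
    · rw [ht4, Cmd.arr_frame _ _ _ rfl]; exact hcn3
  · rw [Cmd.reg_frame _ _ _ rfl, hck, hs3.reg .ac1 (by decide), hs3.reg .ac2 (by decide), hg1, hg2,
      hs.acc₁, hs.acc₂, bit_ne_zero, bit_ne_zero]
    have : t3.reg .ans = t.reg .ans := by
      rw [ht3, Cmd.reg_frame _ _ _ rfl, Cmd.reg_frame _ _ _ rfl, ht2, Cmd.reg_frame _ _ _ rfl,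
        ht1, Cmd.reg_frame _ _ _ rfl]
    rw [this]
    rfl

end search

end SecondOrder

/-! ### Correctness and amortised running time of the search. -/

namespace SecondOrder

variable {α : Type*} {w S : ℕ} {X : ℕ → ℕ}

/-- Induction along a loop, with the running time. -/
theorem loop_spec {i n : Var} {c : Cmd} {s : St} (I : ℕ → ℕ → St → Prop) (h0 : I 0 0 s)
    (hs : ∀ j < s.reg n, ∀ C t, Frame c i s t → I j C t →
      I (j + 1) (C + (6 + c.cost X (t.set i j))) (c.eval X (t.set i j))) :
    ∃ C, (Cmd.loop i n c).cost X s = 5 + C ∧ I (s.reg n) C ((Cmd.loop i n c).eval X s) := by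
  refine ⟨_, rfl, ?_⟩
  have : ∀ m ≤ s.reg n, Frame c i s (iter (fun j t => c.eval X (t.set i j)) m s) ∧
      I m (∑ j ∈ Finset.range m,
        (6 + c.cost X ((iter (fun j t => c.eval X (t.set i j)) j s).set i j)))
        (iter (fun j t => c.eval X (t.set i j)) m s) := by
    intro m
    induction m with
    | zero => intro _; exact ⟨Frame.refl c i s, by simpa [iter] using h0⟩
    | succ m ih =>
      intro hm
      obtain ⟨h1, h2⟩ := ih (by omega)
      rw [Finset.sum_range_succ]
      exact ⟨h1.step X m, hs m (by omega) _ _ h1 h2⟩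
  exact (this _ le_rfl).2

section search

variable {n₁ n₂ T₁ T₂ N : ℕ} {WT MB : ℕ → ℕ} {e : α ≃ Fin S}
  {b₁ b₂ : ℕ} {tr₁ : Fin T₁ → Fin n₁ × Layer α w × Fin n₁}
  {tr₂ : Fin T₂ → Fin n₂ × Layer α w × Fin n₂} {acc₁ : Fin n₁ → Prop} {acc₂ : Fin n₂ → Prop}

/-- A command changes neither the tables nor the node under consideration, the queue and the
answer. -/
def Cmd.keeps₄ (c : Cmd) : Bool :=
  c.keeps₃ && [Var.q1, .q2, .d1, .d2, .cnt, .ans].all (fun v => !c.wr v) &&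
    [Arr.c, .Q1, .Q2, .QC, .vis].all (fun k => !c.wa k)

variable [NeZero N]

variable (N WT MB e tr₁ tr₂ acc₁ acc₂) in
/-- The node `ν` is being processed, starting from the queue `l` and the answer `a`; the pairs of
transitions in `P` are done. -/
structure Doing (s : St) (ν : Node n₁ n₂ (N + N)) (l : List (Node n₁ n₂ (N + N))) (a : Prop)
    (P : Set (Fin T₁ × Fin T₂)) (t : St) : Prop where
  same : Same s t
  q1 : t.reg .q1 = ν.1
  q2 : t.reg .q2 = ν.2.1
  d1 : t.reg .d1 = s.arr .deg1 ν.1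
  d2 : t.reg .d2 = s.arr .deg2 ν.2.1
  c : Rep (t.arr .c) ν.2.2
  queue : ∃ l', Queue l' t ∧ l <+: l' ∧
    ∀ ν', ν' ∈ l' ↔ ν' ∈ l ∨ ∃ p ∈ P, ν' = succ N WT MB e tr₁ tr₂ p.1 p.2 ν
  ans : t.reg .ans ≠ 0 ↔ a ∨ ∃ p ∈ P, Wins N WT MB e tr₁ tr₂ acc₁ acc₂ p.1 p.2 ν

variable {s t : St} {ν : Node n₁ n₂ (N + N)} {l : List (Node n₁ n₂ (N + N))} {a : Prop}
    {P : Set (Fin T₁ × Fin T₂)}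

theorem Doing.eval (h : Doing N WT MB e tr₁ tr₂ acc₁ acc₂ s ν l a P t) (k : Cmd)
    (hk : k.keeps₄ = true) : Doing N WT MB e tr₁ tr₂ acc₁ acc₂ s ν l a P (k.eval X t) := by
  simp only [Cmd.keeps₄, List.all_cons, List.all_nil, Bool.and_eq_true, Bool.not_eq_true',
    Bool.and_true] at hk
  obtain ⟨⟨h0, h1, h2, h3, h4, h5, h6⟩, h7, h8, h9, h10, h11⟩ := hk
  refine ⟨h.same.eval _ h0, ?_, ?_, ?_, ?_, ?_, ?_, ?_⟩
  · rw [k.reg_frame X _ h1, h.q1]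
  · rw [k.reg_frame X _ h2, h.q2]
  · rw [k.reg_frame X _ h3, h.d1]
  · rw [k.reg_frame X _ h4, h.d2]
  · rw [k.arr_frame X _ h7]; exact h.c
  · obtain ⟨l', hq, hl⟩ := h.queue
    exact ⟨l', hq.congr (k.reg_frame X _ h5) (k.arr_frame X _ h8) (k.arr_frame X _ h9)
      (k.arr_frame X _ h10) (k.arr_frame X _ h11), hl⟩
  · rw [k.reg_frame X _ h6]; exact h.ans

theorem Doing.set (h : Doing N WT MB e tr₁ tr₂ acc₁ acc₂ s ν l a P t) (v : Var) (x : ℕ)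
    (hk : (Cmd.assign v 0).keeps₄ = true) :
    Doing N WT MB e tr₁ tr₂ acc₁ acc₂ s ν l a P (t.set v x) :=
  h.eval (X := fun _ => 0) (.assign v (.lit x)) hk

theorem Doing.congr {P' : Set (Fin T₁ × Fin T₂)}
    (h : Doing N WT MB e tr₁ tr₂ acc₁ acc₂ s ν l a P t) (hP : P = P') :
    Doing N WT MB e tr₁ tr₂ acc₁ acc₂ s ν l a P' t := hP ▸ h

/-- The old queue is a prefix of the new one, so positions already handed out stay valid while nodes
are appended. -/
theorem Doing.edge (hs : Setup X N WT MB e b₁ b₂ tr₁ tr₂ acc₁ acc₂ s)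
    (h : Doing N WT MB e tr₁ tr₂ acc₁ acc₂ s ν l a P t) {i₁ : Fin T₁} {i₂ : Fin T₂}
    (hp1 : t.reg .p1 = b₁ + i₁ * s.reg .lam) (hp2 : t.reg .p2 = b₂ + i₂ * s.reg .lam) :
    Doing N WT MB e tr₁ tr₂ acc₁ acc₂ s ν l a (insert (i₁, i₂) P) (edgeC.eval X t) := by
  obtain ⟨l', hQ, hl, hl'⟩ := h.queue
  obtain ⟨h1, h2⟩ := edgeC_spec hs h.same h.c hQ hp1 hp2
  refine ⟨h.same.eval _ rfl, ?_, ?_, ?_, ?_, ?_, ⟨_, h1, ?_, ?_⟩, ?_⟩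
  · rw [Cmd.reg_frame _ _ _ rfl, h.q1]
  · rw [Cmd.reg_frame _ _ _ rfl, h.q2]
  · rw [Cmd.reg_frame _ _ _ rfl, h.d1]
  · rw [Cmd.reg_frame _ _ _ rfl, h.d2]
  · rw [Cmd.arr_frame _ _ _ rfl]; exact h.c
  · refine hl.trans ?_
    unfold pushNode
    split
    · exact List.prefix_rfl
    · exact List.prefix_append _ _
  · intro ν'
    rw [mem_pushNode, hl']
    simp only [Set.mem_insert_iff, exists_eq_or_imp]
    rw [or_assoc, or_comm (a := ∃ _, _)]
  · rw [h2, h.ans]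
    simp only [Set.mem_insert_iff, exists_eq_or_imp]
    rw [or_assoc, or_comm (a := ∃ _, _)]

/-- The number of rounds is the out-degree of the current state, which is not fixed during the
search. The static bound does not apply, and cost and effect are followed together. -/
theorem Doing.inner (hs : Setup X N WT MB e b₁ b₂ tr₁ tr₂ acc₁ acc₂ s)
    {E : ℕ} (hE : ∀ u, Same s u → edgeC.cost X u ≤ E)
    (h : Doing N WT MB e tr₁ tr₂ acc₁ acc₂ s ν l a P t) {i₁ : Fin T₁}
    (hp1 : t.reg .p1 = b₁ + i₁ * s.reg .lam) :
    Doing N WT MB e tr₁ tr₂ acc₁ acc₂ s ν l a (P ∪ {p | p.1 = i₁ ∧ (tr₂ p.2).1 = ν.2.1})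
      (innerC.eval X t) ∧ innerC.cost X t ≤ 5 + s.arr .deg2 ν.2.1 * (31 + E) := by
  obtain ⟨f, hf, hf'⟩ := hs.adj₂.fn ν.2.1
  have key := loop_spec (X := X) (i := .j2) (n := .d2)
    (c := .seq (.assign .p2 (.rd .out2 (.rd .rowB ♯.q2 + ♯.j2))) edgeC) (s := t)
    (fun j C u => Doing N WT MB e tr₁ tr₂ acc₁ acc₂ s ν l a
      (P ∪ {p | p.1 = i₁ ∧ ∃ j' : Fin _, (j' : ℕ) < j ∧ f j' = p.2}) u ∧ C ≤ j * (31 + E))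
    ⟨h.congr (by simp), by simp⟩ ?_
  · obtain ⟨C, hC, h1, h2⟩ := key
    rw [h.d2] at h1 h2
    refine ⟨h1.congr ?_, ?_⟩
    · congr 1; ext p
      simp only [Set.mem_ofPred_eq, hf']
      refine and_congr_right fun _ => ⟨?_, ?_⟩
      · rintro ⟨j', -, h⟩; exact ⟨j', h⟩
      · rintro ⟨j', h⟩; exact ⟨j', j'.2, h⟩
    · unfold innerC
      omega
  · rintro j hj C u hF ⟨hu, hC⟩
    rw [h.d2] at hj
    have hu1 := hu.set .j2 j rfl
    have hu2 := hu1.eval (X := X) (.assign .p2 (.rd .out2 (.rd .rowB ♯.q2 + ♯.j2))) rfl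
    have e1 : (u.set .j2 j).reg .q2 = ν.2.1 := hu1.q2
    have e2 : (u.set .j2 j).arr .rowB = s.arr .rowB := hu1.same.arr _ (by decide)
    have e3 : (u.set .j2 j).arr .out2 = s.arr .out2 := hu1.same.arr _ (by decide)
    have e4 : (u.set .j2 j).reg .j2 = j := by simp
    refine ⟨?_, ?_⟩
    · rw [Cmd.eval_seq]
      refine (hu2.edge hs (i₁ := i₁) (i₂ := f ⟨j, hj⟩) ?_ ?_).congr ?_
      · rw [Cmd.reg_frame _ _ _ rfl, St.set_reg, if_neg (by decide), hF.reg _ rfl (by decide), hp1]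
      · rw [← hf ⟨j, hj⟩, show ∀ u : St, ((Cmd.assign .p2 (.rd .out2 (.rd .rowB ♯.q2 + ♯.j2))).eval X
          u).reg .p2 = u.arr .out2 (u.arr .rowB (u.reg .q2) + u.reg .j2) by
            intro u; simp [Cmd.eval], e1, e2, e3, e4]
      · ext p
        simp only [Set.mem_insert_iff, Set.mem_union, Set.mem_ofPred_eq]
        constructor
        · rintro (rfl | h | ⟨h, j', h', h''⟩)
          · exact Or.inr ⟨rfl, ⟨j, hj⟩, Nat.lt_succ_self j, rfl⟩
          · exact Or.inl h
          · exact Or.inr ⟨h, j', by omega, h''⟩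
        · rintro (h | ⟨h, j', h', h''⟩)
          · exact Or.inr (Or.inl h)
          · rcases Nat.lt_succ_iff_lt_or_eq.1 h' with h3 | h3
            · exact Or.inr (Or.inr ⟨h, j', h3, h''⟩)
            · left
              have : j' = ⟨j, hj⟩ := Fin.ext h3
              subst this
              exact Prod.ext h h''.symm
    · have := hE _ hu2.same
      -- Fetching the address of the transition costs 25, and 6 for the round makes 31. In the outer
      -- loop the 5 of the inner loop is added, which gives 36.
      have e5 : (Cmd.seq (.assign .p2 (.rd .out2 (.rd .rowB ♯.q2 + ♯.j2))) edgeC).cost X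
          (u.set .j2 j) = 25 + edgeC.cost X ((Cmd.assign .p2
            (.rd .out2 (.rd .rowB ♯.q2 + ♯.j2))).eval X (u.set .j2 j)) := rfl
      rw [e5, add_mul]
      omega

theorem Doing.outer (hs : Setup X N WT MB e b₁ b₂ tr₁ tr₂ acc₁ acc₂ s)
    {E : ℕ} (hE : ∀ u, Same s u → edgeC.cost X u ≤ E)
    (h : Doing N WT MB e tr₁ tr₂ acc₁ acc₂ s ν l a ∅ t) :
    Doing N WT MB e tr₁ tr₂ acc₁ acc₂ s ν l a {p | (tr₁ p.1).1 = ν.1 ∧ (tr₂ p.2).1 = ν.2.1}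
      (outerC.eval X t) ∧
      outerC.cost X t ≤ 5 + s.arr .deg1 ν.1 * (36 + s.arr .deg2 ν.2.1 * (31 + E)) := by
  obtain ⟨f, hf, hf'⟩ := hs.adj₁.fn ν.1
  have key := loop_spec (X := X) (i := .j1) (n := .d1)
    (c := .seq (.assign .p1 (.rd .out1 (.rd .rowA ♯.q1 + ♯.j1))) innerC) (s := t)
    (fun j C u => Doing N WT MB e tr₁ tr₂ acc₁ acc₂ s ν l a
      {p | (∃ j' : Fin _, (j' : ℕ) < j ∧ f j' = p.1) ∧ (tr₂ p.2).1 = ν.2.1} u ∧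
      C ≤ j * (36 + s.arr .deg2 ν.2.1 * (31 + E)))
    ⟨h.congr (by simp), by simp⟩ ?_
  · obtain ⟨C, hC, h1, h2⟩ := key
    rw [h.d1] at h1 h2
    refine ⟨h1.congr ?_, ?_⟩
    · ext p
      simp only [Set.mem_ofPred_eq, hf']
      refine and_congr_left fun _ => ⟨?_, ?_⟩
      · rintro ⟨j', -, h⟩; exact ⟨j', h⟩
      · rintro ⟨j', h⟩; exact ⟨j', j'.2, h⟩
    · unfold outerC
      omega
  · rintro j hj C u hF ⟨hu, hC⟩
    rw [h.d1] at hj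
    have hu1 := hu.set .j1 j rfl
    have hu2 := hu1.eval (X := X) (.assign .p1 (.rd .out1 (.rd .rowA ♯.q1 + ♯.j1))) rfl
    have e1 : (u.set .j1 j).reg .q1 = ν.1 := hu1.q1
    have e2 : (u.set .j1 j).arr .rowA = s.arr .rowA := hu1.same.arr _ (by decide)
    have e3 : (u.set .j1 j).arr .out1 = s.arr .out1 := hu1.same.arr _ (by decide)
    have e4 : (u.set .j1 j).reg .j1 = j := by simp
    have e6 : ((Cmd.assign .p1 (.rd .out1 (.rd .rowA ♯.q1 + ♯.j1))).eval X (u.set .j1 j)).reg .p1 =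
        b₁ + f ⟨j, hj⟩ * s.reg .lam := by
      rw [← hf ⟨j, hj⟩, show ∀ u : St, ((Cmd.assign .p1 (.rd .out1 (.rd .rowA ♯.q1 + ♯.j1))).eval X
        u).reg .p1 = u.arr .out1 (u.arr .rowA (u.reg .q1) + u.reg .j1) by
          intro u; simp [Cmd.eval], e1, e2, e3, e4]
    obtain ⟨h3, h4⟩ := hu2.inner hs hE e6
    refine ⟨?_, ?_⟩
    · rw [Cmd.eval_seq]
      refine h3.congr ?_
      ext p
      simp only [Set.mem_union, Set.mem_ofPred_eq]
      constructor
      · rintro (⟨⟨j', h', h''⟩, h⟩ | ⟨h', h⟩)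
        · exact ⟨⟨j', by omega, h''⟩, h⟩
        · exact ⟨⟨⟨j, hj⟩, Nat.lt_succ_self j, h'.symm⟩, h⟩
      · rintro ⟨⟨j', h', h''⟩, h⟩
        rcases Nat.lt_succ_iff_lt_or_eq.1 h' with h3 | h3
        · exact Or.inl ⟨⟨j', h3, h''⟩, h⟩
        · have : j' = ⟨j, hj⟩ := Fin.ext h3
          subst this
          exact Or.inr ⟨h''.symm, h⟩
    · have e5 : (Cmd.seq (.assign .p1 (.rd .out1 (.rd .rowA ♯.q1 + ♯.j1))) innerC).cost X
          (u.set .j1 j) = 25 + innerC.cost X ((Cmd.assign .p1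
            (.rd .out1 (.rd .rowA ♯.q1 + ♯.j1))).eval X (u.set .j1 j)) := rfl
      rw [e5, add_mul]
      omega

theorem Doing.load (hs : Setup X N WT MB e b₁ b₂ tr₁ tr₂ acc₁ acc₂ s) (ht : Same s t)
    (hQ : Queue l t) {i : ℕ} (hi : i < l.length) (hti : t.reg .i = i) :
    Doing N WT MB e tr₁ tr₂ acc₁ acc₂ s l[i] l (t.reg .ans ≠ 0) ∅ (loadC.eval X t) := by
  have hS : Same s (loadC.eval X t) := ht.eval _ rfl
  refine ⟨hS, ?_, ?_, ?_, ?_, ?_, ⟨l, ?_, List.prefix_rfl, by simp⟩, ?_⟩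
  · unfold loadC
    rw [Cmd.eval_seq, Cmd.eval_seq, Cmd.reg_frame _ _ _ rfl, Cmd.reg_frame _ _ _ rfl]
    simp [Cmd.eval, hti, hQ.q1 i hi]
  · unfold loadC
    rw [Cmd.eval_seq, Cmd.eval_seq, Cmd.reg_frame _ _ _ rfl, Cmd.reg_frame _ _ _ rfl]
    simp [Cmd.eval, hti, hQ.q2 i hi]
  · unfold loadC
    rw [Cmd.eval_seq, Cmd.eval_seq, Cmd.reg_frame _ _ _ rfl, Cmd.reg_frame _ _ _ rfl]
    simp [Cmd.eval, hti, hQ.q1 i hi, ht.arr .deg1 (by decide)]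
  · unfold loadC
    rw [Cmd.eval_seq, Cmd.eval_seq, Cmd.reg_frame _ _ _ rfl, Cmd.reg_frame _ _ _ rfl]
    simp [Cmd.eval, hti, hQ.q2 i hi, ht.arr .deg2 (by decide)]
  · unfold loadC
    rw [Cmd.eval_seq, Cmd.eval_seq]
    set t1 := (Cmd.seq (.assign .q1 (.rd .Q1 ♯.i)) (.seq (.assign .q2 (.rd .Q2 ♯.i))
      (.seq (.assign .d1 (.rd .deg1 ♯.q1)) (.assign .d2 (.rd .deg2 ♯.q2))))).eval X t with ht1
    set t2 := (mulC .ad .i .M).eval X t1 with ht2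
    have hM1 : t1.reg .M = N + N := by rw [ht1, Cmd.reg_frame _ _ _ rfl, (ht.env hs.env).eqM]
    have hM2 : t2.reg .M = N + N := by rw [ht2, Cmd.reg_frame _ _ _ rfl, hM1]
    have hi1 : t1.reg .i = i := by rw [ht1, Cmd.reg_frame _ _ _ rfl, hti]
    have had : t2.reg .ad = i * (N + N) := by
      rw [ht2, mulC_reg (by decide) (by decide) (by decide) (by decide), hM1, hi1]
    have hqc : t2.arr .QC = t.arr .QC := by
      rw [ht2, Cmd.arr_frame _ _ _ rfl, ht1, Cmd.arr_frame _ _ _ rfl]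
    have := eval_loop_ind (X := X) (i := .j) (n := .M)
      (c := .write .c ♯.j (.rd .QC (♯.ad + ♯.j))) (s := t2)
      (fun j u => ∀ x : Fin (N + N), (x : ℕ) < j → u.arr .c x = l[i].2.2 x)
      (by intro x hx; omega) ?_
    · intro x
      exact this x (by rw [hM2]; exact x.2)
    · intro j hj u hF hu x hx
      have a1 : u.reg .ad = i * (N + N) := by rw [hF.reg _ rfl (by decide), had]
      have a2 : u.arr .QC = t.arr .QC := by rw [hF.arr _ rfl, hqc]
      simp only [Cmd.eval, St.put_arr, if_true, Exp.val_add, Exp.val_var, Exp.val_rd, St.set_reg,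
        St.set_arr, Function.update_apply, a2]
      have a1' : (if Var.ad = Var.j then j else u.reg .ad) = i * (N + N) := by
        rw [if_neg (by decide), a1]
      rw [a1']
      by_cases hxj : (x : ℕ) = j
      · rw [if_pos hxj, ← hxj, hQ.qc i hi]
      · rw [if_neg hxj]; exact hu x (by omega)
  · exact hQ.congr (Cmd.reg_frame _ _ _ rfl) (Cmd.arr_frame _ _ _ rfl) (Cmd.arr_frame _ _ _ rfl)
      (Cmd.arr_frame _ _ _ rfl) (Cmd.arr_frame _ _ _ rfl)
  · rw [Cmd.reg_frame _ _ _ rfl]; simp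

variable (N WT MB e tr₁ tr₂) in
/-- One step of the search. -/
def Next (ν ν' : Node n₁ n₂ (N + N)) : Prop :=
  ∃ i₁ i₂, (tr₁ i₁).1 = ν.1 ∧ (tr₂ i₂).1 = ν.2.1 ∧ ν' = succ N WT MB e tr₁ tr₂ i₁ i₂ ν

variable (N WT MB e tr₁ tr₂ acc₁ acc₂) in
/-- A common language is found at the node. -/
def Win (ν : Node n₁ n₂ (N + N)) : Prop :=
  ∃ i₁ i₂, (tr₁ i₁).1 = ν.1 ∧ (tr₂ i₂).1 = ν.2.1 ∧ Wins N WT MB e tr₁ tr₂ acc₁ acc₂ i₁ i₂ ν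

/-- The queue has no repetitions, so the cost of all processed nodes is at most a sum over all
nodes. -/
theorem sum_map_take_le {β : Type*} [Fintype β] {l : List β} (h : l.Nodup) (f : β → ℕ) (j : ℕ) :
    ((l.take j).map f).sum ≤ ∑ b, f b := by
  classical
  have h' : (l.take j).Nodup := h.sublist (List.take_sublist _ _)
  rw [← List.sum_toFinset f h']
  exact Finset.sum_le_sum_of_subset (Finset.subset_univ _)

/-- The queue consists of reachable nodes, and nodes before the current position have all their
successors in it. The loop makes as many rounds as there are nodes, so it certainly passes the end
of the queue, which is then closed under successors. -/
theorem searchC_spec (hs : Setup X N WT MB e b₁ b₂ tr₁ tr₂ acc₁ acc₂ s)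
    {E A : ℕ} (hE : ∀ u, Same s u → edgeC.cost X u ≤ E) (hA : ∀ u, Same s u → loadC.cost X u ≤ A)
    (hQ : Queue l s) (hans : s.reg .ans = 0) :
    ((searchC.eval X s).reg .ans ≠ 0 ↔ ∃ ν, (∃ ν₀ ∈ l,
      Relation.ReflTransGen (Next N WT MB e tr₁ tr₂) ν₀ ν) ∧
        Win N WT MB e tr₁ tr₂ acc₁ acc₂ ν) ∧
    searchC.cost X s ≤ 5 + (N + N) ^ (N + N) *
      (n₁ * n₂ * (A + 19) + T₁ * n₂ * 36 + T₁ * T₂ * (31 + E)) := by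
  set f : Node n₁ n₂ (N + N) → ℕ := fun ν =>
    A + 5 + s.arr .deg1 ν.1 * (36 + s.arr .deg2 ν.2.1 * (31 + E)) with hf
  have key := loop_spec (X := X) (i := .i)
    (n := .bnd) (c := .ifz (♯.cnt - ♯.i) .skip (.seq loadC outerC)) (s := s)
    (fun j C t => Same s t ∧ ∃ l', Queue l' t ∧ l <+: l' ∧
      (∀ ν ∈ l', ∃ ν₀ ∈ l, Relation.ReflTransGen (Next N WT MB e tr₁ tr₂) ν₀ ν) ∧
      (∀ i (hi : i < l'.length), i < j → ∀ ν', Next N WT MB e tr₁ tr₂ l'[i] ν' → ν' ∈ l') ∧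
      (t.reg .ans ≠ 0 ↔ ∃ i, ∃ hi : i < l'.length, i < j ∧
        Win N WT MB e tr₁ tr₂ acc₁ acc₂ l'[i]) ∧
      C ≤ j * 14 + ((l'.take j).map f).sum)
    ⟨⟨fun _ _ => rfl, fun _ _ => rfl⟩, l, hQ, List.prefix_rfl,
      fun ν hν => ⟨ν, hν, Relation.ReflTransGen.refl⟩, by simp, by simp [hans], by simp⟩ ?_
  · obtain ⟨C, hC, hS, l', hQ', hl', hreach, hdone, hans', hC'⟩ := key
    -- A list of nodes without repetition is no longer than the number n₁ n₂ M^M of nodes.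
    have hlen : l'.length ≤ s.reg .bnd := by
      rw [hs.bnd]
      have := List.Nodup.length_le_card hQ'.nodup
      simpa [Fintype.card_prod, mul_assoc] using this
    refine ⟨?_, ?_⟩
    · unfold searchC
      rw [hans']
      constructor
      · rintro ⟨i, hi, -, h⟩
        exact ⟨_, hreach _ (List.getElem_mem hi), h⟩
      · rintro ⟨ν, ⟨ν₀, hν₀, hr⟩, hw⟩
        have : ν ∈ l' := by
          clear hw
          induction hr with
          | refl => exact hl'.subset hν₀
          | tail _ h ih =>
            obtain ⟨i, hi, rfl⟩ := List.getElem_of_mem ih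
            exact hdone i hi (by omega) _ h
        obtain ⟨i, hi, rfl⟩ := List.getElem_of_mem this
        exact ⟨i, hi, by omega, hw⟩
    · unfold searchC
      rw [hC]
      refine Nat.add_le_add_left (hC'.trans ?_) 5
      refine (Nat.add_le_add_left (sum_map_take_le hQ'.nodup f _) _).trans (le_of_eq ?_)
      rw [hs.bnd, hf]
      -- The cost of a node does not depend on its partition, and the sum over pairs of states
      -- factors. Out-degrees add up to T₁ and T₂, whence T₁ T₂ in place of n₁ n₂ T₁ T₂.
      simp only [Fintype.sum_prod_type, Finset.sum_const, Finset.card_univ, Fintype.card_fun,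
        Fintype.card_fin, Fintype.card_prod, smul_eq_mul, mul_add, ← Finset.mul_sum, Finset.sum_add_distrib,
        ← Finset.sum_mul, hs.adj₁.sum, hs.adj₂.sum]
      ring
  · rintro j hj C t hF ⟨ht, l', hQ', hl', hreach, hdone, hans', hC'⟩
    have ht' : Same s (t.set .i j) := ht.set _ _ rfl
    have hQt : Queue l' (t.set .i j) := hQ'.congr rfl rfl rfl rfl rfl
    have hcost : (Cmd.ifz (♯.cnt - ♯.i) .skip (.seq loadC outerC)).cost X (t.set .i j) = 8 +
        if l'.length - j = 0 then 0 else (Cmd.seq loadC outerC).cost X (t.set .i j) := by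
      have : Exp.val X (t.set .i j) (♯.cnt - ♯.i) = l'.length - j := by simp [hQ'.cnt]
      rw [← this]; rfl
    have hval : Exp.val X (t.set .i j) (♯.cnt - ♯.i) = l'.length - j := by simp [hQ'.cnt]
    by_cases hlt : j < l'.length
    · rw [Cmd.eval_ifz_neg (by rw [hval]; omega), hcost, if_neg (by omega), Cmd.eval_seq]
      have hD := Doing.load (X := X) hs ht' hQt hlt (by simp)
      obtain ⟨h1, h2⟩ := hD.outer hs hE
      obtain ⟨l'', hQ'', hpre, hmem⟩ := h1.queue
      have hget : ∀ i (hi : i < l'.length), l''[i]'(hi.trans_le hpre.length_le) = l'[i] :=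
        fun i hi => (hpre.getElem hi).symm
      refine ⟨h1.same, l'', hQ'', hl'.trans hpre, ?_, ?_, ?_, ?_⟩
      · intro ν hν
        rcases (hmem ν).1 hν with h | ⟨p, ⟨hp1, hp2⟩, rfl⟩
        · exact hreach ν h
        · obtain ⟨ν₀, h3, h4⟩ := hreach _ (List.getElem_mem hlt)
          exact ⟨ν₀, h3, h4.tail ⟨p.1, p.2, hp1, hp2, rfl⟩⟩
      · intro i hi hij ν' hν'
        rw [hget i (by omega)] at hν'
        rw [hmem]
        rcases Nat.lt_succ_iff_lt_or_eq.1 hij with h3 | rfl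
        · exact Or.inl (hdone i (by omega) h3 ν' hν')
        · obtain ⟨i₁, i₂, h4, h5, h6⟩ := hν'
          exact Or.inr ⟨(i₁, i₂), ⟨h4, h5⟩, h6⟩
      · rw [h1.ans, St.set_reg, if_neg (by decide), hans']
        constructor
        · rintro (⟨i, hi, hij, hw⟩ | ⟨p, ⟨h4, h5⟩, hw⟩)
          · exact ⟨i, hi.trans_le hpre.length_le, by omega, by rw [hget i hi]; exact hw⟩
          · exact ⟨j, hlt.trans_le hpre.length_le, by omega, by
              rw [hget j hlt]; exact ⟨p.1, p.2, h4, h5, hw⟩⟩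
        · rintro ⟨i, hi, hij, hw⟩
          rw [hget i (by omega)] at hw
          rcases Nat.lt_succ_iff_lt_or_eq.1 hij with h3 | rfl
          · exact Or.inl ⟨i, by omega, h3, hw⟩
          · obtain ⟨i₁, i₂, h4, h5, h6⟩ := hw
            exact Or.inr ⟨(i₁, i₂), ⟨h4, h5⟩, h6⟩
      · have e1 : l''.take j = l'.take j := by
          obtain ⟨r, rfl⟩ := hpre
          rw [List.take_append_of_le_length hlt.le]
        have e2 : l''.take (j + 1) = l'.take j ++ [l'[j]] := by
          rw [List.take_add_one, e1, List.getElem?_eq_getElem (hlt.trans_le hpre.length_le),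
            hget j hlt]
          rfl
        have e3 : (Cmd.seq loadC outerC).cost X (t.set .i j) = loadC.cost X (t.set .i j) +
          outerC.cost X (loadC.eval X (t.set .i j)) := rfl
        have e4 := hA _ ht'
        rw [e2, e3, List.map_append, List.sum_append]
        simp only [List.map_cons, List.map_nil, List.sum_cons, List.sum_nil, hf]
        simp only [hf] at hC'
        omega
    -- Idle rounds after the end of the queue cost 14 each, which the term j * 14 pays for.
    · rw [Cmd.eval_ifz_pos (by rw [hval]; omega), hcost, if_pos (by omega)]
      refine ⟨ht', l', hQt, hl', hreach, fun i hi _ => hdone i hi (by omega), ?_, ?_⟩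
      · have : ((Cmd.skip.eval X (t.set .i j)).reg .ans) = t.reg .ans := by simp [Cmd.eval]
        rw [this, hans']
        constructor
        · rintro ⟨i, hi, hij, hw⟩; exact ⟨i, hi, by omega, hw⟩
        · rintro ⟨i, hi, hij, hw⟩; exact ⟨i, hi, by omega, hw⟩
      · rw [List.take_of_length_le (by omega)] at hC' ⊢
        omega

end search

end SecondOrder

namespace SecondOrder

/-! ### Numbering the sets of states -/

section code
open Var Arr Cmd Exp

/-- `N := 2 ^ w`, with the powers of two as weights. -/
def powC : Cmd := N ≔ 1 ⨾ loop i w (write wt ♯i ♯N ⨾ N ≔ ♯N + ♯N)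

/-- The members of the set with number `m`, from the binary digits of `m`. -/
def digitsC : Cmd :=
  (mulC ad m w ⨾ u ≔ ♯m) ⨾ loop i w (p ≔ ♯w - 1 - ♯i ⨾
    ifz (♯u + 1 - rd wt ♯p) skip (write memb (♯ad + ♯p) 1 ⨾ u ≔ ♯u - rd wt ♯p))

/-- The table of the members of all sets. -/
def membC : Cmd := loop m N digitsC

/-- The numbering of the one-element sets. -/
def singleC : Cmd :=
  N ≔ ♯w ⨾ loop i w (write wt ♯i ♯i ⨾ mulC ad i w ⨾ write memb (♯ad + ♯i) 1)

end code

variable {w : ℕ} {X : ℕ → ℕ}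

theorem powC_spec {t : St} (hw : t.reg .w = w) :
    (powC.eval X t).reg .N = 2 ^ w ∧ ∀ q < w, (powC.eval X t).arr .wt q = 2 ^ q := by
  unfold powC
  rw [Cmd.eval_seq]
  have := eval_loop_ind (X := X) (i := .i) (n := .w)
    (c := .seq (.write .wt ♯.i ♯.N) (.assign .N (♯.N + ♯.N))) (s := (Var.N ≔ 1).eval X t)
    (fun j u => u.reg .N = 2 ^ j ∧ ∀ q < j, u.arr .wt q = 2 ^ q)
    ⟨by simp [Cmd.eval], by simp⟩ ?_
  · rw [show ((Var.N ≔ 1).eval X t).reg .w = w by rw [Cmd.reg_frame _ _ _ rfl, hw]] at this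
    exact this
  · rintro j hj u hF ⟨h1, h2⟩
    refine ⟨by simp [Cmd.eval, h1]; ring, fun q hq => ?_⟩
    by_cases hqj : q = j
    · subst hqj; simp [Cmd.eval, h1]
    · simp [Cmd.eval, h1, Function.update_apply, hqj]
      exact h2 q (by omega)

/-- The lower places together stay below the next power of two, which makes the greedy choice of
digits correct. -/
theorem sum_pow_lt (A : Finset (Fin w)) {j : ℕ} (hj : j ≤ w) :
    ∑ q ∈ A.filter (fun q : Fin w => (q : ℕ) < j), 2 ^ (q : ℕ) < 2 ^ j := by
  induction j with
  | zero => simp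
  | succ j ih =>
    rw [sum_fin_range A (fun q => 2 ^ q) (by omega), pow_succ]
    have := ih (by omega)
    split <;> omega

/-- Digits are taken from the highest place down. The remainder is always the part of the sum in the
lower places, and comparing it with a power of two decides membership. The zeros from address m w on
make untouched entries count as non-members. -/
theorem digitsC_spec {t : St} (hw : t.reg .w = w) (hwt : ∀ q < w, t.arr .wt q = 2 ^ q) {m : ℕ}
    (hm : t.reg .m = m) (h0 : ∀ y, m * w ≤ y → t.arr .memb y = 0) :
    (∀ y < m * w, (digitsC.eval X t).arr .memb y = t.arr .memb y) ∧
    (∀ y, (m + 1) * w ≤ y → (digitsC.eval X t).arr .memb y = 0) ∧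
    ∀ A : Finset (Fin w), ∑ q ∈ A, 2 ^ (q : ℕ) = m →
      ∀ p : Fin w, (digitsC.eval X t).arr .memb (m * w + p) ≠ 0 ↔ p ∈ A := by
  unfold digitsC
  rw [Cmd.eval_seq]
  set t1 := (Cmd.seq (mulC .ad .m .w) (.assign .u ♯.m)).eval X t with ht1
  have had : t1.reg .ad = m * w := by
    rw [ht1, Cmd.eval_seq, Cmd.reg_frame _ _ _ rfl,
      mulC_reg (by decide) (by decide) (by decide) (by decide), hm, hw]
  have hu1 : t1.reg .u = m := by
    rw [ht1, Cmd.eval_seq]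
    simp only [Cmd.eval, St.set_reg, if_true, Exp.val_var]
    rw [Cmd.reg_frame _ _ _ rfl, hm]
  have hw1 : t1.reg .w = w := by rw [ht1, Cmd.reg_frame _ _ _ rfl, hw]
  have hwt1 : t1.arr .wt = t.arr .wt := by rw [ht1, Cmd.arr_frame _ _ _ rfl]
  have hmb1 : t1.arr .memb = t.arr .memb := by rw [ht1, Cmd.arr_frame _ _ _ rfl]
  have := eval_loop_ind (X := X) (i := .i) (n := .w)
    (c := .seq (.assign .p (♯.w - 1 - ♯.i)) (.ifz (♯.u + 1 - .rd .wt ♯.p) .skip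
      (.seq (.write .memb (♯.ad + ♯.p) 1) (.assign .u (♯.u - .rd .wt ♯.p))))) (s := t1)
    (fun j v => (∀ y < m * w, v.arr .memb y = t.arr .memb y) ∧
      (∀ y, (m + 1) * w ≤ y → v.arr .memb y = 0) ∧
      ∀ A : Finset (Fin w), ∑ q ∈ A, 2 ^ (q : ℕ) = m →
      v.reg .u = ∑ q ∈ A.filter (fun q : Fin w => (q : ℕ) < w - j), 2 ^ (q : ℕ) ∧
      ∀ p : Fin w, v.arr .memb (m * w + p) ≠ 0 ↔ p ∈ A ∧ w - j ≤ p)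
    ⟨by simp [hmb1], ?_, ?_⟩ ?_
  · rw [hw1] at this
    exact ⟨this.1, this.2.1, fun A hA p => by rw [(this.2.2 A hA).2 p]; simp⟩
  · intro y hy
    rw [hmb1]
    exact h0 y (by rw [add_mul] at hy; omega)
  · intro A hA
    refine ⟨by rw [Nat.sub_zero, sum_filter_lt_self A (fun q => 2 ^ q), hu1, hA], fun p => ?_⟩
    have := p.2
    rw [hmb1, h0 _ (by omega)]
    simp
  · rintro j hj v hF ⟨h1, h2, h3⟩
    rw [hw1] at hj
    have vw : v.reg .w = w := by rw [hF.reg _ rfl (by decide), hw1]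
    have vad : v.reg .ad = m * w := by rw [hF.reg _ rfl (by decide), had]
    have vwt : v.arr .wt (w - 1 - j) = 2 ^ (w - 1 - j) := by
      rw [hF.arr _ rfl, hwt1]; exact hwt _ (by omega)
    rw [Cmd.eval_seq]
    set v1 := (Cmd.assign .p (♯.w - 1 - ♯.i)).eval X (v.set .i j) with hv1
    have p1 : v1.reg .p = w - 1 - j := by simp [hv1, Cmd.eval, vw]
    have u1 : v1.reg .u = v.reg .u := by simp [hv1, Cmd.eval]
    have ad1 : v1.reg .ad = m * w := by simp [hv1, Cmd.eval, vad]
    have wt1 : v1.arr .wt (w - 1 - j) = 2 ^ (w - 1 - j) := by simp [hv1, Cmd.eval, vwt]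
    have mb1 : v1.arr .memb = v.arr .memb := by simp [hv1, Cmd.eval]
    have hval : Exp.val X v1 (♯.u + 1 - .rd .wt ♯.p) = v.reg .u + 1 - 2 ^ (w - 1 - j) := by
      simp [p1, u1, wt1]
    have hjw : w - 1 - j < w := by omega
    have hjj : w - j = w - 1 - j + 1 := by omega
    have hjs : w - (j + 1) = w - 1 - j := by omega
    have hmul : (m + 1) * w = m * w + w := by ring
    by_cases hlt : v.reg .u < 2 ^ (w - 1 - j)
    · rw [Cmd.eval_ifz_pos (by rw [hval]; omega)]
      simp only [Cmd.eval, mb1, u1]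
      refine ⟨h1, h2, fun A hA => ?_⟩
      obtain ⟨h4, h5⟩ := h3 A hA
      rw [hjj, sum_fin_range A (fun q => 2 ^ q) hjw] at h4
      have hnot : (⟨w - 1 - j, hjw⟩ : Fin w) ∉ A := by
        intro h; rw [if_pos h] at h4; omega
      rw [if_neg hnot, add_zero] at h4
      refine ⟨by rw [hjs]; exact h4, fun p => ?_⟩
      rw [h5]
      refine and_congr_right fun hp => ⟨by omega, fun h => ?_⟩
      by_contra hc
      have : p = ⟨w - 1 - j, hjw⟩ := Fin.ext (by simp only; omega)
      exact hnot (this ▸ hp)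
    · rw [Cmd.eval_ifz_neg (by rw [hval]; omega)]
      have hu : ((Cmd.seq (.write .memb (♯.ad + ♯.p) 1) (.assign .u (♯.u - .rd .wt ♯.p))).eval X
          v1).reg .u = v.reg .u - 2 ^ (w - 1 - j) := by
        simp [Cmd.eval, u1, p1, wt1]
      have hmb : ∀ y, ((Cmd.seq (.write .memb (♯.ad + ♯.p) 1)
          (.assign .u (♯.u - .rd .wt ♯.p))).eval X v1).arr .memb y =
          if y = m * w + (w - 1 - j) then 1 else v.arr .memb y := by
        intro y; simp [Cmd.eval, ad1, p1, mb1, Function.update_apply]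
      refine ⟨fun y hy => ?_, fun y hy => ?_, fun A hA => ?_⟩
      · rw [hmb, if_neg (by omega)]; exact h1 y hy
      · rw [hmb, if_neg (by omega)]; exact h2 y hy
      · obtain ⟨h4, h5⟩ := h3 A hA
        rw [hjj, sum_fin_range A (fun q => 2 ^ q) hjw] at h4
        have hs := sum_pow_lt A hjw.le
        have hin : (⟨w - 1 - j, hjw⟩ : Fin w) ∈ A := by
          by_contra h; rw [if_neg h] at h4; omega
        rw [if_pos hin] at h4
        refine ⟨by rw [hu, hjs, h4]; omega, fun p => ?_⟩
        rw [hmb]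
        by_cases hp : (p : ℕ) = w - 1 - j
        · rw [if_pos (by omega)]
          have : p = ⟨w - 1 - j, hjw⟩ := Fin.ext hp
          simp only [ne_eq, one_ne_zero, not_false_eq_true, true_iff]
          exact ⟨this ▸ hin, by omega⟩
        · rw [if_neg (by omega), h5]
          refine and_congr_right fun hp => ⟨by omega, by omega⟩

/-- All sums of weights are below 2^w, so the numbers are never replaced by 0 and every subset is
recovered. -/
theorem membC_spec {t : St} (hw : t.reg .w = w) (hwt : ∀ q < w, t.arr .wt q = 2 ^ q)
    (hN : t.reg .N = 2 ^ w) (h0 : ∀ y, t.arr .memb y = 0) (A : Finset (Fin w)) :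
    decS w ((membC.eval X t).arr .memb) (encS (2 ^ w) (t.arr .wt) A) = A := by
  have hsum : ∑ q ∈ A, t.arr .wt q = ∑ q ∈ A, 2 ^ (q : ℕ) :=
    Finset.sum_congr rfl fun q _ => hwt q q.2
  have hlt : ∀ A : Finset (Fin w), ∑ q ∈ A, 2 ^ (q : ℕ) < 2 ^ w := fun A => by
    rw [← sum_filter_lt_self A (fun q => 2 ^ q)]; exact sum_pow_lt A le_rfl
  have henc : encS (2 ^ w) (t.arr .wt) A = ∑ q ∈ A, 2 ^ (q : ℕ) := by
    unfold encS; rw [hsum, if_pos (hlt A)]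
  have := eval_loop_ind (X := X) (i := .m) (n := .N) (c := digitsC) (s := t)
    (fun j v => (∀ y, j * w ≤ y → v.arr .memb y = 0) ∧
      ∀ A : Finset (Fin w), ∑ q ∈ A, 2 ^ (q : ℕ) < j →
      ∀ p : Fin w, v.arr .memb ((∑ q ∈ A, 2 ^ (q : ℕ)) * w + p) ≠ 0 ↔ p ∈ A)
    ⟨fun y _ => h0 y, fun A h => absurd h (by omega)⟩ ?_
  · rw [hN] at this
    ext p
    rw [mem_decS, henc]
    exact this.2 A (hlt A) p
  · rintro j hj v hF ⟨h1, h2⟩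
    obtain ⟨h3, h4, h5⟩ := digitsC_spec (X := X) (w := w) (t := v.set .m j) (m := j)
      (by rw [St.set_reg, if_neg (by decide), hF.reg _ rfl (by decide), hw])
      (by rw [St.set_arr, hF.arr _ rfl]; exact hwt) (by simp) (by simpa using h1)
    refine ⟨h4, fun A hA p => ?_⟩
    rcases Nat.lt_succ_iff_lt_or_eq.1 hA with h | h
    · rw [h3, St.set_arr]
      · exact h2 A h p
      · have hp := p.2
        calc (∑ q ∈ A, 2 ^ (q : ℕ)) * w + p < (∑ q ∈ A, 2 ^ (q : ℕ) + 1) * w := by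
              rw [add_mul]; omega
          _ ≤ j * w := Nat.mul_le_mul_right _ h
    · rw [h]; exact h5 A h p

/-- State q has weight q and the table has ones exactly on its diagonal. Nothing is claimed about
sets with more or fewer elements: they never occur in deterministic complete diagrams. -/
theorem singleC_spec {t : St} (hw : t.reg .w = w) (h0 : ∀ y, t.arr .memb y = 0) :
    (singleC.eval X t).reg .N = w ∧ ∀ q : Fin w, decS w ((singleC.eval X t).arr .memb)
      (encS w ((singleC.eval X t).arr .wt) {q}) = {q} := by
  unfold singleC
  rw [Cmd.eval_seq]
  set t1 := (Var.N ≔ ♯.w).eval X t with ht1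
  have hw1 : t1.reg .w = w := by rw [ht1, Cmd.reg_frame _ _ _ rfl, hw]
  have hN1 : t1.reg .N = w := by simp [ht1, Cmd.eval, hw]
  have hmb1 : t1.arr .memb = t.arr .memb := by rw [ht1, Cmd.arr_frame _ _ _ rfl]
  refine ⟨by rw [Cmd.reg_frame _ _ _ rfl, hN1], fun q => ?_⟩
  have := eval_loop_ind (X := X) (i := .i) (n := .w)
    (c := .seq (.write .wt ♯.i ♯.i) (.seq (mulC .ad .i .w) (.write .memb (♯.ad + ♯.i) 1))) (s := t1)
    (fun j v => (∀ q < j, v.arr .wt q = q) ∧ ∀ y, v.arr .memb y ≠ 0 ↔ ∃ q < j, y = q * w + q)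
    ⟨by simp, fun y => by simp [hmb1, h0]⟩ ?_
  · rw [hw1] at this
    obtain ⟨h1, h2⟩ := this
    have henc : ∀ WT : ℕ → ℕ, WT q = q → encS w WT {q} = q := by
      intro WT h; simp [encS, h]
    rw [henc _ (h1 q q.2)]
    ext p
    rw [mem_decS, h2, Finset.mem_singleton]
    constructor
    · rintro ⟨q', hq', h⟩
      obtain ⟨h3, h4⟩ := mul_add_inj p.2 hq' h
      exact Fin.ext (by omega)
    · rintro rfl
      exact ⟨p, p.2, rfl⟩
  · rintro j hj v hF ⟨h1, h2⟩
    rw [hw1] at hj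
    have vw : v.reg .w = w := by rw [hF.reg _ rfl (by decide), hw1]
    simp only [Cmd.eval_seq]
    set v1 := (Cmd.write .wt ♯.i ♯.i).eval X (v.set .i j) with hv1
    set v2 := (mulC .ad .i .w).eval X v1 with hv2
    have had : v2.reg .ad = j * w := by
      rw [hv2, mulC_reg (by decide) (by decide) (by decide) (by decide)]
      simp [hv1, Cmd.eval, vw]
    have hi : v2.reg .i = j := by rw [hv2, Cmd.reg_frame _ _ _ rfl]; simp [hv1, Cmd.eval]
    have hwt : ∀ q, v2.arr .wt q = if q = j then j else v.arr .wt q := by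
      intro q; rw [hv2, Cmd.arr_frame _ _ _ rfl]; simp [hv1, Cmd.eval, Function.update_apply]
    have hmb : v2.arr .memb = v.arr .memb := by
      rw [hv2, Cmd.arr_frame _ _ _ rfl]; simp [hv1, Cmd.eval]
    refine ⟨fun q hq => ?_, fun y => ?_⟩
    · simp only [Cmd.eval, St.put_arr]
      rw [if_neg (by decide), hwt]
      split
      · omega
      · exact h1 q (by omega)
    · simp only [Cmd.eval, St.put_arr, if_true, Exp.val_add, Exp.val_var, had, hi,
        Function.update_apply, hmb, Exp.val_ofNat]
      by_cases hy : y = j * w + j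
      · rw [if_pos hy]
        simp only [ne_eq, one_ne_zero, not_false_eq_true, true_iff]
        exact ⟨j, by omega, hy⟩
      · rw [if_neg hy, h2]
        constructor
        · rintro ⟨q, hq, h⟩; exact ⟨q, by omega, h⟩
        · rintro ⟨q, hq, h⟩
          refine ⟨q, ?_, h⟩
          rcases Nat.lt_succ_iff_lt_or_eq.1 hq with h' | rfl
          · exact h'
          · exact absurd h hy

end SecondOrder

namespace SecondOrder

/-! ### Preparation of the search -/

section code
open Var Arr Cmd Exp

/-- Fills the array `a` with the multiples of `v`. -/
def rowC (a : Arr) (n v : Var) : Cmd := p ≔ 0 ⨾ loop i n (write a ♯i ♯p ⨾ p ≔ ♯p + ♯v)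

/-- The number of nodes of the search. -/
def bndC : Cmd := mulC bnd n1 n2 ⨾ loop i M (mulC u bnd M ⨾ bnd ≔ ♯u)

/-- Sorts the `n` transitions listed from address `b` on by their sources. -/
def adjC (dg rw ot : Arr) (b n : Var) : Cmd :=
  p ≔ ♯b ⨾ loop i n ((u ≔ inp ♯p ⨾ v ≔ rd dg ♯u ⨾ write ot (rd rw ♯u + ♯v) ♯p ⨾
    write dg ♯u (♯v + 1)) ⨾ p ≔ ♯p + ♯lam)

/-- Tables for the search. -/
def prepC : Cmd :=
  M ≔ ♯N + ♯N ⨾ rowC row n1 n2 ⨾ rowC rowA n1 t1 ⨾ rowC rowB n2 t2 ⨾ bndC ⨾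
    adjC deg1 rowA out1 tp1 t1 ⨾ adjC deg2 rowB out2 tp2 t2

/-- Puts the pairs of initial states into the queue. -/
def startC : Cmd :=
  loop x M (write cn ♯x ♯x) ⨾ loop q1 n1 (loop q2 n2 (
    ifz (inp (3 + ♯q1)) skip (ifz (inp (♯st2 + ♯q2)) skip (g1 ≔ ♯q1 ⨾ g2 ≔ ♯q2 ⨾ pushC))))

end code

variable {α : Type*} {w S : ℕ} {X : ℕ → ℕ}

theorem rowC_arr {a : Arr} {n v : Var} (hn : n ≠ .p) (hv : v ≠ .p) (hv' : v ≠ .i) (t : St) :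
    ∀ q < t.reg n, ((rowC a n v).eval X t).arr a q = q * t.reg v := by
  unfold rowC
  rw [Cmd.eval_seq]
  have := eval_loop_ind (X := X) (i := .i) (n := n)
    (c := .seq (.write a ♯.i ♯.p) (.assign .p (♯.p + ♯v))) (s := (Var.p ≔ 0).eval X t)
    (fun j u => u.reg v = t.reg v ∧ u.reg .p = j * t.reg v ∧ ∀ q < j, u.arr a q = q * t.reg v)
    ⟨by simp [Cmd.eval, hv], by simp [Cmd.eval], by simp⟩ ?_
  · rw [show ((Var.p ≔ 0).eval X t).reg n = t.reg n by simp [Cmd.eval, hn]] at this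
    exact this.2.2
  · rintro j hj u hF ⟨h1, h2, h3⟩
    refine ⟨by simp [Cmd.eval, hv, hv', h1], by simp [Cmd.eval, hv, hv', h1, h2]; ring, ?_⟩
    intro q hq
    by_cases hqj : q = j
    · subst hqj; simp [Cmd.eval, h2]
    · simp [Cmd.eval, h2, Function.update_apply, hqj]
      exact h3 q (by omega)

theorem bndC_reg (t : St) : (bndC.eval X t).reg .bnd =
    t.reg .n1 * t.reg .n2 * t.reg .M ^ t.reg .M := by
  unfold bndC
  rw [Cmd.eval_seq]
  have hM : ((mulC .bnd .n1 .n2).eval X t).reg .M = t.reg .M := Cmd.reg_frame _ _ _ rfl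
  have := eval_loop_ind (X := X) (i := .i) (n := .M)
    (c := .seq (mulC .u .bnd .M) (.assign .bnd ♯.u)) (s := (mulC .bnd .n1 .n2).eval X t)
    (fun j v => v.reg .bnd = t.reg .n1 * t.reg .n2 * t.reg .M ^ j)
    (by rw [mulC_reg (by decide) (by decide) (by decide) (by decide)]; simp) ?_
  · rw [hM] at this; exact this
  · intro j hj v hF hv
    have h1 : v.reg .M = t.reg .M := by rw [hF.reg _ rfl (by decide), hM]
    rw [Cmd.eval_seq]
    simp only [Cmd.eval, St.set_reg, if_true, Exp.val_var]
    rw [mulC_reg (by decide) (by decide) (by decide) (by decide)]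
    simp [hv, h1, pow_succ]; ring

/-- A bucket sort in one pass: each state has a row of T cells, filled as its transitions are met,
with the degree as fill level. The table may be large, but only cells that are used cost time. -/
theorem adjC_spec {dg rw ot : Arr} {b n : Var} (h1 : dg ≠ rw) (h2 : dg ≠ ot) (h3 : rw ≠ ot)
    (hn : n ≠ .p) (t : St) {n' T lam B : ℕ} {src : Fin T → Fin n'}
    (hb : t.reg b = B) (hT : t.reg n = T) (hlam : t.reg .lam = lam)
    (hsrc : ∀ i : Fin T, X (B + i * lam) = src i) (hrow : ∀ q < n', t.arr rw q = q * T)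
    (hdg : ∀ q, t.arr dg q = 0) :
    Adj n' T src (fun i => B + i * lam) (((adjC dg rw ot b n).eval X t).arr dg) (t.arr rw)
      (((adjC dg rw ot b n).eval X t).arr ot) := by
  unfold adjC
  rw [Cmd.eval_seq]
  have := eval_loop_ind (X := X) (i := .i) (n := n)
    (c := .seq (.seq (.assign .u (.inp ♯.p)) (.seq (.assign .v (.rd dg ♯.u))
      (.seq (.write ot (.rd rw ♯.u + ♯.v) ♯.p) (.write dg ♯.u (♯.v + 1)))))
      (.assign .p (♯.p + ♯.lam))) (s := (Var.p ≔ ♯b).eval X t)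
    (fun j u => u.reg .lam = lam ∧ u.arr rw = t.arr rw ∧ u.reg .p = B + j * lam ∧
      ∃ l : Fin n' → List (Fin T), (∀ q : Fin n', u.arr dg q = (l q).length) ∧
        (∀ q k (hk : k < (l q).length), u.arr ot (q * T + k) = B + (l q)[k] * lam) ∧
        (∀ q i, i ∈ l q ↔ (i : ℕ) < j ∧ src i = q) ∧ ∑ q, (l q).length = j)
    ⟨by simp [Cmd.eval, hlam], by simp [Cmd.eval], by simp [Cmd.eval, hb], fun _ => [],
      by simp [Cmd.eval, hdg], by simp, by simp, by simp⟩ ?_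
  · rw [show ((Var.p ≔ ♯b).eval X t).reg n = T by simp [Cmd.eval, hn, hT]] at this
    obtain ⟨-, -, -, l, g1, g2, g3, g4⟩ := this
    refine ⟨fun q => ?_, ?_⟩
    · refine ⟨fun j => (l q)[(j : ℕ)]'(by rw [← g1]; exact j.2), fun j => ?_, fun i => ?_⟩
      · rw [hrow q q.2]; exact g2 q j _
      · have := g3 q i
        simp only [i.2, true_and] at this
        rw [← this]
        constructor
        · intro h
          obtain ⟨k, hk, h'⟩ := List.getElem_of_mem h
          exact ⟨⟨k, by rw [g1]; exact hk⟩, h'⟩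
        · rintro ⟨k, rfl⟩
          exact List.getElem_mem _
    · simp only [g1, g4]
  · rintro j hj u hF ⟨g1, g2, g3, l, g4, g5, g6, g7⟩
    rw [show ((Var.p ≔ ♯b).eval X t).reg n = T by simp [Cmd.eval, hn, hT]] at hj
    set q := src ⟨j, hj⟩ with hq
    have hX : X (B + j * lam) = q := hsrc ⟨j, hj⟩
    -- After j transitions no row has more than j < T entries, so rows do not overflow into one
    -- another.
    have hle : ∀ q', (l q').length ≤ j := fun q' => by
      rw [← g7]; exact Finset.single_le_sum (f := fun q => (l q).length)
        (fun _ _ => Nat.zero_le _) (Finset.mem_univ q')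
    refine ⟨by simp [Cmd.eval, g1], by simp [Cmd.eval, h1.symm, h3, g2],
      by simp [Cmd.eval, g3, g1]; ring, fun q' => if q' = q then l q' ++ [⟨j, hj⟩] else l q',
      fun q' => ?_, fun q' k hk => ?_, fun q' i => ?_, ?_⟩
    · simp only [Cmd.eval, St.set_arr, St.put_arr, if_true, St.put_reg, St.set_reg, Exp.val_add,
        Exp.val_var, Exp.val_rd, Exp.val_inp, Exp.val_ofNat]
      by_cases hqq : q' = q
      · subst hqq
        simp [g3, hX, h2, g4]
      · have : (q' : ℕ) ≠ q := fun h => hqq (Fin.ext h)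
        simp [g3, hX, h2, g4, hqq, this, Function.update_apply]
    · have hot : (Cmd.eval X (.seq (.seq (.assign .u (.inp ♯.p)) (.seq (.assign .v (.rd dg ♯.u))
          (.seq (.write ot (.rd rw ♯.u + ♯.v) ♯.p) (.write dg ♯.u (♯.v + 1)))))
          (.assign .p (♯.p + ♯.lam))) (u.set .i j)).arr ot = Function.update (u.arr ot)
          (q * T + (l q).length) (B + j * lam) := by
        simp [Cmd.eval, h2.symm, g3, hX, g2, hrow q q.2, g4]
      rw [hot, Function.update_apply]
      by_cases hqq : q' = q
      · subst hqq
        simp only [if_true] at hk ⊢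
        rw [List.length_append, List.length_singleton] at hk
        by_cases hkl : k = (l q).length
        · subst hkl; simp
        · rw [if_neg (by omega), List.getElem_append_left (by omega)]
          exact g5 q k (by omega)
      · simp only [if_neg hqq] at hk ⊢
        rw [if_neg]
        · exact g5 q' k hk
        · intro h
          have hk' : k < T := by have := hle q'; omega
          have hl' : (l q).length < T := by have := hle q; omega
          exact hqq (Fin.ext (mul_add_inj hk' hl' h).1)
    · by_cases hqq : q' = q
      · subst hqq
        simp only [if_true, List.mem_append, List.mem_singleton, g6]
        constructor
        · rintro (⟨h, h'⟩ | rfl)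
          · exact ⟨by omega, h'⟩
          · exact ⟨Nat.lt_succ_self j, rfl⟩
        · rintro ⟨h, h'⟩
          rcases Nat.lt_succ_iff_lt_or_eq.1 h with h4 | h4
          · exact Or.inl ⟨h4, h'⟩
          · exact Or.inr (Fin.ext h4)
      · simp only [if_neg hqq, g6]
        refine ⟨fun h => ⟨by omega, h.2⟩, fun h => ⟨?_, h.2⟩⟩
        rcases Nat.lt_succ_iff_lt_or_eq.1 h.1 with h4 | h4
        · exact h4
        · exact absurd (h.2.symm.trans (congrArg src (Fin.ext h4))) hqq
    · have : ∀ q', (if q' = q then l q' ++ [(⟨j, hj⟩ : Fin T)] else l q').length =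
          (l q').length + if q' = q then 1 else 0 := by
        intro q'; split <;> simp
      simp only [this, Finset.sum_add_distrib, g7]
      simp

/-! ### From the layout of the input to the start of the search. -/

section search

variable {n₁ n₂ T₁ T₂ N : ℕ} {WT MB : ℕ → ℕ} {e : α ≃ Fin S}
  {b₁ b₂ : ℕ} {tr₁ : Fin T₁ → Fin n₁ × Layer α w × Fin n₁}
  {tr₂ : Fin T₂ → Fin n₂ × Layer α w × Fin n₂} {acc₁ ini₁ : Fin n₁ → Prop}
  {acc₂ ini₂ : Fin n₂ → Prop}

/-- The variables that describe the input. -/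
def inputVars : List Var := [.s, .w, .n1, .n2, .t1, .t2, .lam, .ac1, .ac2, .tp1, .tp2, .st2]

/-- The state describes the input. -/
structure Input (X : ℕ → ℕ) (e : α ≃ Fin S) (b₁ b₂ : ℕ)
    (tr₁ : Fin T₁ → Fin n₁ × Layer α w × Fin n₁) (tr₂ : Fin T₂ → Fin n₂ × Layer α w × Fin n₂)
    (acc₁ ini₁ : Fin n₁ → Prop) (acc₂ ini₂ : Fin n₂ → Prop) (s : St) : Prop where
  eqs : s.reg .s = S
  eqw : s.reg .w = w
  n1 : s.reg .n1 = n₁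
  n2 : s.reg .n2 = n₂
  t1 : s.reg .t1 = T₁
  t2 : s.reg .t2 = T₂
  tp1 : s.reg .tp1 = b₁
  tp2 : s.reg .tp2 = b₂
  lst₁ : Listing X e (s.reg .lam) b₁ tr₁
  lst₂ : Listing X e (s.reg .lam) b₂ tr₂
  acc₁ : ∀ q : Fin n₁, X (s.reg .ac1 + q) = bit (acc₁ q)
  acc₂ : ∀ q : Fin n₂, X (s.reg .ac2 + q) = bit (acc₂ q)
  ini₁ : ∀ q : Fin n₁, X (3 + q) = bit (ini₁ q)
  ini₂ : ∀ q : Fin n₂, X (s.reg .st2 + q) = bit (ini₂ q)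

theorem Input.congr {s t : St} (h : Input X e b₁ b₂ tr₁ tr₂ acc₁ ini₁ acc₂ ini₂ s)
    (hv : ∀ v ∈ inputVars, t.reg v = s.reg v) :
    Input X e b₁ b₂ tr₁ tr₂ acc₁ ini₁ acc₂ ini₂ t := by
  simp only [inputVars, List.mem_cons, List.not_mem_nil, or_false, forall_eq_or_imp,
    forall_eq] at hv
  obtain ⟨h1, h2, h3, h4, h5, h6, h7, h8, h9, h10, h11, h12⟩ := hv
  exact ⟨h1.trans h.eqs, h2.trans h.eqw, h3.trans h.n1, h4.trans h.n2, h5.trans h.t1, h6.trans h.t2,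
    h10.trans h.tp1, h11.trans h.tp2, h7 ▸ h.lst₁, h7 ▸ h.lst₂, h8 ▸ h.acc₁, h9 ▸ h.acc₂, h.ini₁,
    h12 ▸ h.ini₂⟩

theorem Input.eval {s : St} (h : Input X e b₁ b₂ tr₁ tr₂ acc₁ ini₁ acc₂ ini₂ s) (c : Cmd)
    (hc : inputVars.all (fun v => !c.wr v) = true) :
    Input X e b₁ b₂ tr₁ tr₂ acc₁ ini₁ acc₂ ini₂ (c.eval X s) := by
  simp only [List.all_eq_true, Bool.not_eq_true'] at hc
  exact h.congr fun v hv => c.reg_frame X s (hc v hv)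

theorem prepC_spec {s : St} (h : Input X e b₁ b₂ tr₁ tr₂ acc₁ ini₁ acc₂ ini₂ s)
    (hN : s.reg .N = N) (h1 : ∀ q, s.arr .deg1 q = 0) (h2 : ∀ q, s.arr .deg2 q = 0) :
    Setup X N (s.arr .wt) (s.arr .memb) e b₁ b₂ tr₁ tr₂ acc₁ acc₂ (prepC.eval X s) := by
  have hI : Input X e b₁ b₂ tr₁ tr₂ acc₁ ini₁ acc₂ ini₂ (prepC.eval X s) := h.eval _ rfl
  have hMr : (prepC.eval X s).reg .M = N + N := by
    unfold prepC
    rw [Cmd.eval_seq, Cmd.reg_frame _ _ _ rfl]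
    simp [Cmd.eval, hN]
  have hrow : ∀ q : Fin n₁, (prepC.eval X s).arr .row q = q * n₂ := by
    intro q
    unfold prepC
    rw [Cmd.eval_seq, Cmd.eval_seq, Cmd.arr_frame _ _ _ rfl]
    have hI' := h.eval (.M ≔ ♯.N + ♯.N) rfl
    rw [rowC_arr (by decide) (by decide) (by decide) _ _ (by rw [hI'.n1]; exact q.2), hI'.n2]
  have hbnd : (prepC.eval X s).reg .bnd = n₁ * n₂ * (N + N) ^ (N + N) := by
    unfold prepC
    simp only [Cmd.eval_seq]
    rw [Cmd.reg_frame _ _ _ rfl, Cmd.reg_frame _ _ _ rfl, bndC_reg]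
    have hI' := (((h.eval (.M ≔ ♯.N + ♯.N) rfl).eval (rowC .row .n1 .n2) rfl).eval
      (rowC .rowA .n1 .t1) rfl).eval (rowC .rowB .n2 .t2) rfl
    rw [hI'.n1, hI'.n2, Cmd.reg_frame _ _ _ rfl, Cmd.reg_frame _ _ _ rfl, Cmd.reg_frame _ _ _ rfl]
    simp [Cmd.eval, hN]
  refine ⟨⟨hI.eqs, hI.eqw, ?_, hMr, ?_, ?_⟩, hrow, hI.lst₁, hI.lst₂, ?_, ?_, hI.acc₁, hI.acc₂, hbnd⟩
  · rw [Cmd.reg_frame _ _ _ rfl, hN]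
  · rw [Cmd.arr_frame _ _ _ rfl]
  · rw [Cmd.arr_frame _ _ _ rfl]
  · rw [show (prepC.eval X s).reg .lam = s.reg .lam from Cmd.reg_frame _ _ _ rfl]
    unfold prepC
    simp only [Cmd.eval_seq]
    set u1 := (rowC .row .n1 .n2).eval X ((Cmd.assign .M (♯.N + ♯.N)).eval X s) with hu1
    have hI1 : Input X e b₁ b₂ tr₁ tr₂ acc₁ ini₁ acc₂ ini₂ u1 :=
      (h.eval (.M ≔ ♯.N + ♯.N) rfl).eval (rowC .row .n1 .n2) rfl
    set u2 := (rowC .rowA .n1 .t1).eval X u1 with hu2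
    have hI2 : Input X e b₁ b₂ tr₁ tr₂ acc₁ ini₁ acc₂ ini₂ u2 := hI1.eval _ rfl
    set u3 := bndC.eval X ((rowC .rowB .n2 .t2).eval X u2) with hu3
    have hI3 : Input X e b₁ b₂ tr₁ tr₂ acc₁ ini₁ acc₂ ini₂ u3 :=
      (hI2.eval (rowC .rowB .n2 .t2) rfl).eval bndC rfl
    have hlam : u3.reg .lam = s.reg .lam := by
      rw [hu3, Cmd.reg_frame _ _ _ rfl, Cmd.reg_frame _ _ _ rfl, hu2, Cmd.reg_frame _ _ _ rfl, hu1,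
        Cmd.reg_frame _ _ _ rfl, Cmd.reg_frame _ _ _ rfl]
    have hdg : u3.arr .deg1 = s.arr .deg1 := by
      rw [hu3, Cmd.arr_frame _ _ _ rfl, Cmd.arr_frame _ _ _ rfl, hu2, Cmd.arr_frame _ _ _ rfl, hu1,
        Cmd.arr_frame _ _ _ rfl, Cmd.arr_frame _ _ _ rfl]
    have hrw : ∀ q < n₁, u3.arr .rowA q = q * T₁ := by
      intro q hq
      rw [hu3, Cmd.arr_frame _ _ _ rfl, Cmd.arr_frame _ _ _ rfl, hu2,
        rowC_arr (by decide) (by decide) (by decide) _ _ (by rw [hI1.n1]; exact hq), hI1.t1]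
    have := adjC_spec (X := X) (dg := .deg1) (rw := .rowA) (ot := .out1) (b := .tp1) (n := .t1)
      (by decide) (by decide) (by decide) (by decide) u3 hI3.tp1 hI3.t1 hlam
      (src := fun i => (tr₁ i).1) h.lst₁.src hrw (by rw [hdg]; exact h1)
    rw [Cmd.arr_frame _ (adjC .deg2 .rowB .out2 .tp2 .t2) _ rfl,
      Cmd.arr_frame _ (adjC .deg2 .rowB .out2 .tp2 .t2) _ rfl,
      Cmd.arr_frame _ (adjC .deg2 .rowB .out2 .tp2 .t2) _ rfl]
    rwa [Cmd.arr_frame (u := .rowA) _ (adjC .deg1 .rowA .out1 .tp1 .t1) _ rfl]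
  · rw [show (prepC.eval X s).reg .lam = s.reg .lam from Cmd.reg_frame _ _ _ rfl]
    unfold prepC
    simp only [Cmd.eval_seq]
    set u2 := (rowC .rowA .n1 .t1).eval X
      ((rowC .row .n1 .n2).eval X ((Cmd.assign .M (♯.N + ♯.N)).eval X s)) with hu2
    have hI2 : Input X e b₁ b₂ tr₁ tr₂ acc₁ ini₁ acc₂ ini₂ u2 :=
      ((h.eval (.M ≔ ♯.N + ♯.N) rfl).eval (rowC .row .n1 .n2) rfl).eval (rowC .rowA .n1 .t1) rfl
    set u3 := (adjC .deg1 .rowA .out1 .tp1 .t1).eval X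
      (bndC.eval X ((rowC .rowB .n2 .t2).eval X u2)) with hu3
    have hI3 : Input X e b₁ b₂ tr₁ tr₂ acc₁ ini₁ acc₂ ini₂ u3 :=
      ((hI2.eval (rowC .rowB .n2 .t2) rfl).eval bndC rfl).eval
        (adjC .deg1 .rowA .out1 .tp1 .t1) rfl
    have hlam : u3.reg .lam = s.reg .lam := by
      rw [hu3, Cmd.reg_frame _ _ _ rfl, Cmd.reg_frame _ _ _ rfl, Cmd.reg_frame _ _ _ rfl, hu2,
        Cmd.reg_frame _ _ _ rfl, Cmd.reg_frame _ _ _ rfl, Cmd.reg_frame _ _ _ rfl]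
    have hdg : u3.arr .deg2 = s.arr .deg2 := by
      rw [hu3, Cmd.arr_frame _ _ _ rfl, Cmd.arr_frame _ _ _ rfl, Cmd.arr_frame _ _ _ rfl, hu2,
        Cmd.arr_frame _ _ _ rfl, Cmd.arr_frame _ _ _ rfl, Cmd.arr_frame _ _ _ rfl]
    have hrw : ∀ q < n₂, u3.arr .rowB q = q * T₂ := by
      intro q hq
      rw [hu3, Cmd.arr_frame _ _ _ rfl, Cmd.arr_frame _ _ _ rfl,
        rowC_arr (by decide) (by decide) (by decide) _ _ (by rw [hI2.n2]; exact hq), hI2.t2]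
    have := adjC_spec (X := X) (dg := .deg2) (rw := .rowB) (ot := .out2) (b := .tp2) (n := .t2)
      (by decide) (by decide) (by decide) (by decide) u3 hI3.tp2 hI3.t2 hlam
      (src := fun i => (tr₂ i).1) h.lst₂.src hrw (by rw [hdg]; exact h2)
    rwa [Cmd.arr_frame (u := .rowB) _ (adjC .deg2 .rowB .out2 .tp2 .t2) _ rfl]

/-- The partition of a starting node is the identity, though any would do, as the first layer resets
it. Pushing with a test for novelty establishes the invariant of the queue. -/
theorem startC_spec {s : St} (hI : Input X e b₁ b₂ tr₁ tr₂ acc₁ ini₁ acc₂ ini₂ s)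
    (hs : Setup X N WT MB e b₁ b₂ tr₁ tr₂ acc₁ acc₂ s) (hvis : ∀ y, s.arr .vis y = 0)
    (hcnt : s.reg .cnt = 0) :
    ∃ l : List (Node n₁ n₂ (N + N)), Queue l (startC.eval X s) ∧
      ∀ ν, ν ∈ l ↔ ini₁ ν.1 ∧ ini₂ ν.2.1 ∧ ν.2.2 = id := by
  unfold startC
  rw [Cmd.eval_seq]
  have hS1 : Same s ((Cmd.loop .x .M (.write .cn ♯.x ♯.x)).eval X s) :=
    Same.eval ⟨fun _ _ => rfl, fun _ _ => rfl⟩ _ rfl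
  have hI1 := hI.eval (Cmd.loop .x .M (.write .cn ♯.x ♯.x)) rfl
  have hcn : Rep (M := N + N) (((Cmd.loop .x .M (.write .cn ♯.x ♯.x)).eval X s).arr .cn) id := by
    have := eval_loop_ind (X := X) (i := .x) (n := .M) (c := .write .cn ♯.x ♯.x) (s := s)
      (fun j u => ∀ x < j, u.arr .cn x = x) (by simp) ?_
    · intro x
      exact this x (by rw [hs.env.eqM]; exact x.2)
    · intro j hj u hF hu x hx
      by_cases hxj : x = j
      · subst hxj; simp [Cmd.eval]
      · simp [Cmd.eval, Function.update_apply, hxj]; exact hu x (by omega)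
  have hQ1 : Queue ([] : List (Node n₁ n₂ (N + N)))
      ((Cmd.loop .x .M (.write .cn ♯.x ♯.x)).eval X s) := by
    refine ⟨?_, by simp, by simp, by simp, fun ν => ?_, List.nodup_nil⟩
    · rw [Cmd.reg_frame _ _ _ rfl, hcnt]; rfl
    · rw [Cmd.arr_frame _ _ _ rfl, hvis]; simp
  set s1 := (Cmd.loop .x .M (.write .cn ♯.x ♯.x)).eval X s with hs1
  have := eval_loop_ind (X := X) (i := .q1) (n := .n1) (c := .loop .q2 .n2 (
    .ifz (.inp (3 + ♯.q1)) .skip (.ifz (.inp (♯.st2 + ♯.q2)) .skip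
      (.seq (.assign .g1 ♯.q1) (.seq (.assign .g2 ♯.q2) pushC))))) (s := s1)
    (fun j u => ∃ l : List (Node n₁ n₂ (N + N)), Queue l u ∧
      ∀ ν, ν ∈ l ↔ (ν.1 : ℕ) < j ∧ ini₁ ν.1 ∧ ini₂ ν.2.1 ∧ ν.2.2 = id)
    ⟨[], hQ1, by simp⟩ ?_
  · obtain ⟨l, h1, h2⟩ := this
    refine ⟨l, h1, fun ν => ?_⟩
    rw [h2, hI1.n1]
    exact ⟨fun h => h.2, fun h => ⟨ν.1.2, h⟩⟩
  · rintro j hj u hF ⟨l, hQ, hl⟩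
    rw [hI1.n1] at hj
    have hS : Same s (u.set .q1 j) := (hS1.frame hF rfl rfl).set _ _ rfl
    have hn2 : (u.set .q1 j).reg .n2 = n₂ := by
      rw [St.set_reg, if_neg (by decide), hF.reg _ rfl (by decide), hI1.n2]
    have hst2 : (u.set .q1 j).reg .st2 = s.reg .st2 := by
      rw [St.set_reg, if_neg (by decide), hF.reg _ rfl (by decide), hs1, Cmd.reg_frame _ _ _ rfl]
    have hcn' : Rep (M := N + N) ((u.set .q1 j).arr .cn) id := by
      rw [St.set_arr, hF.arr _ rfl]; exact hcn
    -- The pairs treated so far are those lexicographically below (j, k).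
    have := eval_loop_ind (X := X) (i := .q2) (n := .n2) (c :=
      .ifz (.inp (3 + ♯.q1)) .skip (.ifz (.inp (♯.st2 + ♯.q2)) .skip
      (.seq (.assign .g1 ♯.q1) (.seq (.assign .g2 ♯.q2) pushC)))) (s := u.set .q1 j)
      (fun k v => ∃ l : List (Node n₁ n₂ (N + N)), Queue l v ∧
        ∀ ν, ν ∈ l ↔ ((ν.1 : ℕ) < j ∨ (ν.1 : ℕ) = j ∧ (ν.2.1 : ℕ) < k) ∧ ini₁ ν.1 ∧ ini₂ ν.2.1 ∧
          ν.2.2 = id)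
      ⟨l, hQ.congr rfl rfl rfl rfl rfl, by simpa using hl⟩ ?_
    · obtain ⟨l, h1, h2⟩ := this
      refine ⟨l, h1, fun ν => ?_⟩
      rw [h2, hn2]
      refine and_congr_left fun _ => ?_
      have := ν.2.1.2
      omega
    · rintro k hk v hF' ⟨l, hQ, hl⟩
      rw [hn2] at hk
      have hS' : Same s (v.set .q2 k) := (hS.frame hF' rfl rfl).set _ _ rfl
      have hQ' : Queue l (v.set .q2 k) := hQ.congr rfl rfl rfl rfl rfl
      have vq1 : (v.set .q2 k).reg .q1 = j := by
        rw [St.set_reg, if_neg (by decide), hF'.reg _ rfl (by decide), St.set_reg, if_pos rfl]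
      have vst2 : (v.set .q2 k).reg .st2 = s.reg .st2 := by
        rw [St.set_reg, if_neg (by decide), hF'.reg _ rfl (by decide), hst2]
      have vcn : Rep (M := N + N) ((v.set .q2 k).arr .cn) id := by
        rw [St.set_arr, hF'.arr _ rfl]; exact hcn'
      have v1 : Exp.val X (v.set .q2 k) (.inp (3 + ♯.q1)) = bit (ini₁ ⟨j, hj⟩) := by
        rw [← hI.ini₁]; simp only [Exp.val_inp, Exp.val_add, Exp.val_ofNat, Exp.val_var, vq1]
      have v2 : Exp.val X (v.set .q2 k) (.inp (♯.st2 + ♯.q2)) = bit (ini₂ ⟨k, hk⟩) := by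
        rw [← hI.ini₂]
        simp only [Exp.val_inp, Exp.val_add, Exp.val_ofNat, Exp.val_var, vst2]
        simp
      have no : ¬ (ini₁ ⟨j, hj⟩ ∧ ini₂ ⟨k, hk⟩) → ∀ ν : Node n₁ n₂ (N + N), ν ∈ l ↔
          ((ν.1 : ℕ) < j ∨ (ν.1 : ℕ) = j ∧ (ν.2.1 : ℕ) < k + 1) ∧ ini₁ ν.1 ∧ ini₂ ν.2.1 ∧
          ν.2.2 = id := by
        intro h ν
        rw [hl]
        refine and_congr_left fun h' => ?_
        have : ¬ ((ν.1 : ℕ) = j ∧ (ν.2.1 : ℕ) = k) := by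
          rintro ⟨h3, h4⟩
          have e1 : ν.1 = ⟨j, hj⟩ := Fin.ext h3
          have e2 : ν.2.1 = ⟨k, hk⟩ := Fin.ext h4
          exact h ⟨e1 ▸ h'.1, e2 ▸ h'.2.1⟩
        omega
      by_cases i1 : ini₁ ⟨j, hj⟩
      · rw [Cmd.eval_ifz_neg (by rw [v1]; exact bit_ne_zero.2 i1)]
        by_cases i2 : ini₂ ⟨k, hk⟩
        · rw [Cmd.eval_ifz_neg (by rw [v2]; exact bit_ne_zero.2 i2)]
          simp only [Cmd.eval_seq]
          set v3 := (Cmd.assign .g2 ♯.q2).eval X ((Cmd.assign .g1 ♯.q1).eval X (v.set .q2 k))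
            with hv3
          have hS3 : Same s v3 := (hS'.eval _ rfl).eval _ rfl
          have hQ3 : Queue l v3 := hQ'.congr (by simp [hv3, Cmd.eval]) rfl rfl rfl rfl
          refine ⟨_, pushC_queue (ν := ((⟨j, hj⟩, ⟨k, hk⟩, id) : Node n₁ n₂ (N + N))) hQ3
            ?_ ?_ ?_ ?_ ?_, fun ν => ?_⟩
          · rw [(hS3.env hs.env).eqM]
          · rw [hS3.arr _ (by decide)]; exact hs.row _
          · have : v3.reg .g1 = (v.set .q2 k).reg .q1 := by simp [hv3, Cmd.eval]
            rw [this, vq1]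
          · simp [hv3, Cmd.eval]
          · exact vcn
          · rw [mem_pushNode, hl]
            constructor
            · rintro (⟨h, h'⟩ | rfl)
              · exact ⟨by omega, h'⟩
              · exact ⟨Or.inr ⟨rfl, Nat.lt_succ_self k⟩, i1, i2, rfl⟩
            · rintro ⟨h, h'⟩
              by_cases hjk : (ν.1 : ℕ) = j ∧ (ν.2.1 : ℕ) = k
              · right
                exact Prod.ext (Fin.ext hjk.1) (Prod.ext (Fin.ext hjk.2) h'.2.2)
              · exact Or.inl ⟨by omega, h'⟩
        · rw [Cmd.eval_ifz_pos (by rw [v2]; exact bit_eq_zero.2 i2)]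
          exact ⟨l, hQ', no fun h => i2 h.2⟩
      · rw [Cmd.eval_ifz_pos (by rw [v1]; exact bit_eq_zero.2 i1)]
        exact ⟨l, hQ', no fun h => i1 h.1⟩

end search

end SecondOrder

namespace SecondOrder

/-! ### Reading the input -/

section code
open Var Arr Cmd Exp

/-- The layout of the input. -/
def preC : Cmd :=
  (s ≔ inp 0 ⨾ w ≔ inp 1) ⨾ mulC u s w ⨾ mulC v u w ⨾
  (lam ≔ ♯v + ♯w + ♯w + ♯w + ♯w + 4 ⨾ n1 ≔ inp 2 ⨾ ac1 ≔ 3 + ♯n1 ⨾ t1 ≔ inp (♯ac1 + ♯n1) ⨾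
    tp1 ≔ ♯ac1 + ♯n1 + 1) ⨾ mulC u lam t1 ⨾
  (st2 ≔ ♯tp1 + ♯u + 1 ⨾ n2 ≔ inp (♯st2 - 1) ⨾ ac2 ≔ ♯st2 + ♯n2 ⨾ t2 ≔ inp (♯ac2 + ♯n2) ⨾
    tp2 ≔ ♯ac2 + ♯n2 + 1) ⨾ mulC u lam t2 ⨾ len ≔ ♯tp2 + ♯u

end code

/-- The prelude computes its own loop bounds, so the static cost bound is not available there and
the cost is counted exactly. -/
theorem mulC_cost {X : ℕ → ℕ} {v a n : Var} (hn : n ≠ v) (t : St) :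
    (mulC v a n).cost X t = 8 + 13 * t.reg n := by
  have h : ((v ≔ 0).eval X t).reg n = t.reg n := by simp [Cmd.eval, hn]
  have h' : (mulC v a n).cost X t = 3 + (5 + ∑ j ∈ Finset.range (((v ≔ 0).eval X t).reg n),
    (6 + 7)) := rfl
  rw [h', h]
  simp
  ring

/-- The values that the prelude computes. -/
structure Layout (S w n₁ n₂ T₁ T₂ Λ : ℕ) (t : St) : Prop where
  eqs : t.reg .s = S
  eqw : t.reg .w = w
  eqlam : t.reg .lam = Λ
  n1 : t.reg .n1 = n₁
  t1 : t.reg .t1 = T₁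
  ac1 : t.reg .ac1 = 3 + n₁
  tp1 : t.reg .tp1 = 3 + n₁ + n₁ + 1
  n2 : t.reg .n2 = n₂
  t2 : t.reg .t2 = T₂
  st2 : t.reg .st2 = 3 + n₁ + n₁ + 1 + T₁ * Λ + 1
  ac2 : t.reg .ac2 = 3 + n₁ + n₁ + 1 + T₁ * Λ + 1 + n₂
  tp2 : t.reg .tp2 = 3 + n₁ + n₁ + 1 + T₁ * Λ + 1 + n₂ + n₂ + 1
  len : t.reg .len = 3 + n₁ + n₁ + 1 + T₁ * Λ + 1 + n₂ + n₂ + 1 + T₂ * Λ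

/-- The hypotheses give the cells holding the parameters. A transition takes S w² + 4w + 4 cells:
source, two flags, four sets, the transition bits and the target. Each multiplication is arranged
with w or a number of transitions as its number of rounds. -/
theorem preC_spec {X : ℕ → ℕ} {S w n₁ n₂ T₁ T₂ lam : ℕ} (hlam : lam = S * w * w + w + w + w + w + 4)
    (h0 : X 0 = S) (h1 : X 1 = w) (h2 : X 2 = n₁) (h3 : X (3 + n₁ + n₁) = T₁)
    (h4 : X (3 + n₁ + n₁ + 1 + T₁ * lam) = n₂)
    (h5 : X (3 + n₁ + n₁ + 1 + T₁ * lam + 1 + n₂ + n₂) = T₂) (t : St) :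
    Layout S w n₁ n₂ T₁ T₂ lam (preC.eval X t) ∧
      preC.cost X t ≤ 200 + 26 * w + 13 * T₁ + 13 * T₂ := by
  set u1 := (Cmd.seq (.assign .s (.inp 0)) (.assign .w (.inp 1))).eval X t with hu1
  have s1 : u1.reg .s = S := by simp [hu1, Cmd.eval, h0]
  have w1 : u1.reg .w = w := by simp [hu1, Cmd.eval, h1]
  set u2 := (mulC .u .s .w).eval X u1 with hu2
  have s2 : u2.reg .s = S := by rw [hu2, Cmd.reg_frame _ _ _ rfl, s1]
  have w2 : u2.reg .w = w := by rw [hu2, Cmd.reg_frame _ _ _ rfl, w1]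
  have x2 : u2.reg .u = S * w := by
    rw [hu2, mulC_reg (by decide) (by decide) (by decide) (by decide), s1, w1]
  set u3 := (mulC .v .u .w).eval X u2 with hu3
  have s3 : u3.reg .s = S := by rw [hu3, Cmd.reg_frame _ _ _ rfl, s2]
  have w3 : u3.reg .w = w := by rw [hu3, Cmd.reg_frame _ _ _ rfl, w2]
  have x3 : u3.reg .v = S * w * w := by
    rw [hu3, mulC_reg (by decide) (by decide) (by decide) (by decide), x2, w2]
  set u4 := (Cmd.seq (.assign .lam (♯.v + ♯.w + ♯.w + ♯.w + ♯.w + 4)) (.seq (.assign .n1 (.inp 2))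
    (.seq (.assign .ac1 (3 + ♯.n1)) (.seq (.assign .t1 (.inp (♯.ac1 + ♯.n1)))
      (.assign .tp1 (♯.ac1 + ♯.n1 + 1)))))).eval X u3 with hu4
  have s4 : u4.reg .s = S := by rw [hu4, Cmd.reg_frame _ _ _ rfl, s3]
  have w4 : u4.reg .w = w := by rw [hu4, Cmd.reg_frame _ _ _ rfl, w3]
  have lam4 : u4.reg .lam = lam := by simp [hu4, Cmd.eval, x3, w3, hlam]
  have n4 : u4.reg .n1 = n₁ := by simp [hu4, Cmd.eval, h2]
  have ac4 : u4.reg .ac1 = 3 + n₁ := by simp [hu4, Cmd.eval, h2]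
  have t4 : u4.reg .t1 = T₁ := by simp [hu4, Cmd.eval, h2, h3]
  have tp4 : u4.reg .tp1 = 3 + n₁ + n₁ + 1 := by simp [hu4, Cmd.eval, h2]
  set u5 := (mulC .u .lam .t1).eval X u4 with hu5
  have s5 : u5.reg .s = S := by rw [hu5, Cmd.reg_frame _ _ _ rfl, s4]
  have w5 : u5.reg .w = w := by rw [hu5, Cmd.reg_frame _ _ _ rfl, w4]
  have lam5 : u5.reg .lam = lam := by rw [hu5, Cmd.reg_frame _ _ _ rfl, lam4]
  have n5 : u5.reg .n1 = n₁ := by rw [hu5, Cmd.reg_frame _ _ _ rfl, n4]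
  have ac5 : u5.reg .ac1 = 3 + n₁ := by rw [hu5, Cmd.reg_frame _ _ _ rfl, ac4]
  have t5 : u5.reg .t1 = T₁ := by rw [hu5, Cmd.reg_frame _ _ _ rfl, t4]
  have tp5 : u5.reg .tp1 = 3 + n₁ + n₁ + 1 := by rw [hu5, Cmd.reg_frame _ _ _ rfl, tp4]
  have x5 : u5.reg .u = T₁ * lam := by
    rw [hu5, mulC_reg (by decide) (by decide) (by decide) (by decide), lam4, t4, mul_comm]
  set u6 := (Cmd.seq (.assign .st2 (♯.tp1 + ♯.u + 1)) (.seq (.assign .n2 (.inp (♯.st2 - 1)))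
    (.seq (.assign .ac2 (♯.st2 + ♯.n2)) (.seq (.assign .t2 (.inp (♯.ac2 + ♯.n2)))
      (.assign .tp2 (♯.ac2 + ♯.n2 + 1)))))).eval X u5 with hu6
  have st6 : u6.reg .st2 = 3 + n₁ + n₁ + 1 + T₁ * lam + 1 := by simp [hu6, Cmd.eval, tp5, x5]
  have n6 : u6.reg .n2 = n₂ := by simp [hu6, Cmd.eval, tp5, x5, h4]
  have ac6 : u6.reg .ac2 = 3 + n₁ + n₁ + 1 + T₁ * lam + 1 + n₂ := by
    simp [hu6, Cmd.eval, tp5, x5, h4]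
  have t6 : u6.reg .t2 = T₂ := by simp [hu6, Cmd.eval, tp5, x5, h4, h5]
  have tp6 : u6.reg .tp2 = 3 + n₁ + n₁ + 1 + T₁ * lam + 1 + n₂ + n₂ + 1 := by
    simp [hu6, Cmd.eval, tp5, x5, h4]
  have lam6 : u6.reg .lam = lam := by rw [hu6, Cmd.reg_frame _ _ _ rfl, lam5]
  set u7 := (mulC .u .lam .t2).eval X u6 with hu7
  have x7 : u7.reg .u = T₂ * lam := by
    rw [hu7, mulC_reg (by decide) (by decide) (by decide) (by decide), lam6, t6, mul_comm]
  have tp7 : u7.reg .tp2 = 3 + n₁ + n₁ + 1 + T₁ * lam + 1 + n₂ + n₂ + 1 := by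
    rw [hu7, Cmd.reg_frame _ _ _ rfl, tp6]
  have hfin : preC.eval X t = (Var.len ≔ ♯.tp2 + ♯.u).eval X u7 := rfl
  have hf : ∀ v, v ≠ .len → v ≠ .u → v ≠ .k → (preC.eval X t).reg v = u6.reg v := by
    intro v h h' h''
    rw [hfin, Cmd.reg_frame _ _ _ (by simpa [Cmd.wr] using h), hu7,
      Cmd.reg_frame _ _ _ (by simp [mulC, Cmd.wr, h', h''])]
  have hf5 : ∀ v ∈ [Var.s, .w, .lam, .n1, .t1, .ac1, .tp1], u6.reg v = u5.reg v := by
    intro v hv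
    rw [hu6]
    refine Cmd.reg_frame _ _ _ ?_
    revert v
    decide
  refine ⟨⟨?_, ?_, ?_, ?_, ?_, ?_, ?_, ?_, ?_, ?_, ?_, ?_, ?_⟩, ?_⟩
  · rw [hf _ (by decide) (by decide) (by decide), hf5 _ (by decide), s5]
  · rw [hf _ (by decide) (by decide) (by decide), hf5 _ (by decide), w5]
  · rw [hf _ (by decide) (by decide) (by decide), lam6]
  · rw [hf _ (by decide) (by decide) (by decide), hf5 _ (by decide), n5]
  · rw [hf _ (by decide) (by decide) (by decide), hf5 _ (by decide), t5]
  · rw [hf _ (by decide) (by decide) (by decide), hf5 _ (by decide), ac5]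
  · rw [hf _ (by decide) (by decide) (by decide), hf5 _ (by decide), tp5]
  · rw [hf _ (by decide) (by decide) (by decide), n6]
  · rw [hf _ (by decide) (by decide) (by decide), t6]
  · rw [hf _ (by decide) (by decide) (by decide), st6]
  · rw [hf _ (by decide) (by decide) (by decide), ac6]
  · rw [hf _ (by decide) (by decide) (by decide), tp6]
  · rw [hfin]; simp [Cmd.eval, x7, tp7]
  · have hc : preC.cost X t = 12 + ((mulC .u .s .w).cost X u1 + ((mulC .v .u .w).cost X u2 +
        (49 + ((mulC .u .lam .t1).cost X u4 + (44 + ((mulC .u .lam .t2).cost X u6 + 7)))))) := rfl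
    rw [hc, mulC_cost (by decide), mulC_cost (by decide), mulC_cost (by decide),
      mulC_cost (by decide), w1, w2, t4, t6]
    omega

/-- The list `l` is stored from address `p` on. -/
def Stored (X : ℕ → ℕ) (p : ℕ) (l : List ℕ) : Prop := ∀ (i : ℕ) (h : i < l.length), X (p + i) = l[i]

/-! ### Reading the presentation back from memory. -/

section stored
variable {X : ℕ → ℕ} {p : ℕ}

theorem Stored.left {l l' : List ℕ} (h : Stored X p (l ++ l')) : Stored X p l := by
  intro i hi
  rw [h i (by rw [List.length_append]; omega), List.getElem_append_left hi]

theorem Stored.right {l l' : List ℕ} (h : Stored X p (l ++ l')) :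
    Stored X (p + l.length) l' := by
  intro i hi
  rw [add_assoc, h (l.length + i) (by rw [List.length_append]; omega),
    List.getElem_append_right (by omega)]
  simp

theorem Stored.head {a : ℕ} {l : List ℕ} (h : Stored X p (a :: l)) : X p = a := h 0 (by simp)

theorem Stored.ofFn {n : ℕ} {g : Fin n → ℕ} (h : Stored X p (List.ofFn g)) (i : Fin n) :
    X (p + i) = g i := by
  rw [h i (by simp)]; simp

/-- Blocks of equal length c start at multiples of c. This is applied to transitions, and inside a
layer to sources and to symbols. -/
theorem Stored.flatten {c : ℕ} : ∀ {L : List (List ℕ)} {p : ℕ}, Stored X p L.flatten →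
    (∀ l ∈ L, l.length = c) → ∀ (i : ℕ) (h : i < L.length), Stored X (p + i * c) L[i] := by
  intro L
  induction L with
  | nil => intro p _ _ i h; simp at h
  | cons l L ih =>
    intro p h hc i hi
    rw [List.flatten_cons] at h
    have hl : l.length = c := hc l (List.mem_cons_self ..)
    cases i with
    | zero => simpa using h.left
    | succ i =>
      have h' := h.right
      rw [hl] at h'
      have := ih h' (fun l hl => hc l (List.mem_cons_of_mem _ hl)) i (by simpa using hi)
      rw [List.getElem_cons_succ]
      convert this using 1
      ring

theorem length_flatten {c : ℕ} : ∀ {L : List (List ℕ)}, (∀ l ∈ L, l.length = c) →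
    L.flatten.length = L.length * c := by
  intro L
  induction L with
  | nil => simp
  | cons l L ih =>
    intro hc
    rw [List.flatten_cons, List.length_append, ih fun l hl => hc l (List.mem_cons_of_mem _ hl),
      hc l (List.mem_cons_self ..), List.length_cons]
    ring

theorem encodeSet_length {ι : Type*} {n : ℕ} (e : ι ≃ Fin n) (S : Set ι) :
    (encodeSet e S).length = n := by simp [encodeSet]

theorem Stored.encodeSet {ι : Type*} {n : ℕ} {e : ι ≃ Fin n} {S : Set ι}
    (h : Stored X p (encodeSet e S)) (i : Fin n) : X (p + i) = bit (e.symm i ∈ S) := h.ofFn i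

variable {α : Type*} {w S : ℕ}

theorem encodeLayer_length (e : α ≃ Fin S) (B : Layer α w) :
    (encodeLayer e B).length = S * w * w + w + w + w + w + 2 := by
  have h1 : ∀ p : Fin w, (List.ofFn fun a : Fin S =>
      encodeSet (Equiv.refl _) {q : Fin w | (p, e.symm a, q) ∈ B.trans}).flatten.length = S * w := by
    intro p
    rw [length_flatten (c := w)]
    · simp
    · intro l hl
      obtain ⟨a, rfl⟩ := (List.mem_ofFn' _ _).1 hl
      exact encodeSet_length _ _
  unfold encodeLayer
  simp only [List.length_append, encodeSet_length]
  rw [length_flatten (c := S * w)]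
  · simp; ring
  · intro l hl
    obtain ⟨p, rfl⟩ := (List.mem_ofFn' _ _).1 hl
    exact h1 p

theorem Stored.layer {e : α ≃ Fin S} {B : Layer α w} (h : Stored X (p + 1) (encodeLayer e B)) :
    IsLayerAt X e p B := by
  have h1 : ∀ p : Fin w, (List.ofFn fun a : Fin S =>
      SecondOrder.encodeSet (Equiv.refl _)
        {q : Fin w | (p, e.symm a, q) ∈ B.trans}).flatten.length = S * w := by
    intro p
    rw [length_flatten (c := w)]
    · simp
    · intro l hl
      obtain ⟨a, rfl⟩ := (List.mem_ofFn' _ _).1 hl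
      exact encodeSet_length _ _
  unfold encodeLayer at h
  have hfin := h.left.right
  have hini := h.left.left.right
  have htr := h.right
  simp only [List.length_append, encodeSet_length, List.length_cons, List.length_nil] at hfin hini htr
  refine ⟨h.left.left.left.left.left.head, fun q => ?_, fun q => ?_, fun p' a q => ?_⟩
  · have := hini.encodeSet q
    simp only [Equiv.refl_symm, Equiv.refl_apply, Finset.mem_coe] at this
    rw [← this]; congr 1; ring
  · have := hfin.encodeSet q
    simp only [Equiv.refl_symm, Equiv.refl_apply, Finset.mem_coe] at this
    rw [← this]; congr 1; ring
  · have h2 := htr.flatten (c := S * w) (by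
      intro l hl
      obtain ⟨p, rfl⟩ := (List.mem_ofFn' _ _).1 hl
      exact h1 p) p' (by simp)
    rw [List.getElem_ofFn] at h2
    have h3 := h2.flatten (c := w) (by
      intro l hl
      obtain ⟨a, rfl⟩ := (List.mem_ofFn' _ _).1 hl
      exact encodeSet_length _ _) (e a) (by simp)
    rw [List.getElem_ofFn] at h3
    have := h3.encodeSet q
    simp only [Equiv.refl_symm, Equiv.refl_apply, Fin.eta, Equiv.symm_apply_apply] at this
    rw [show (q ∈ {q : Fin w | (p', a, q) ∈ B.trans}) = ((p', a, q) ∈ B.trans) from rfl] at this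
    rw [← this]; congr 1; ring

variable {σ : Type*} {n : ℕ}

theorem encodeNFA_length (e : α ≃ Fin S) (f : σ ≃ Fin n) (F : NFA (Layer α w) σ)
    (l : List (σ × Layer α w × σ)) : (encodeNFA e f F l).length =
      1 + n + n + 1 + l.length * (S * w * w + w + w + w + w + 4) := by
  unfold encodeNFA
  simp only [List.length_append, encodeSet_length]
  rw [length_flatten (c := S * w * w + w + w + w + w + 4)]
  · simp
  · intro b hb
    obtain ⟨t, -, rfl⟩ := List.mem_map.1 hb
    simp [encodeLayer_length]

theorem Stored.nfa {e : α ≃ Fin S} {f : σ ≃ Fin n} {F : NFA (Layer α w) σ}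
    {l : List (σ × Layer α w × σ)} (h : Stored X p (encodeNFA e f F l)) :
    X p = n ∧ (∀ q : Fin n, X (p + 1 + q) = bit (f.symm q ∈ F.start)) ∧
      (∀ q : Fin n, X (p + 1 + n + q) = bit (f.symm q ∈ F.accept)) ∧
      X (p + 1 + n + n) = l.length ∧
      Listing X e (S * w * w + w + w + w + w + 4) (p + 1 + n + n + 1)
        (fun i : Fin l.length => (f l[i].1, l[i].2.1, f l[i].2.2)) := by
  unfold encodeNFA at h
  have h1 := h.left.left.left.right
  have h2 := h.left.left.right
  have h3 := h.left.right
  have h4 := h.right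
  simp only [List.length_append, encodeSet_length, List.length_cons, List.length_nil, zero_add]
    at h1 h2 h3 h4
  have key : ∀ i : Fin l.length, Stored X (p + 1 + n + n + 1 +
      i * (S * w * w + w + w + w + w + 4))
      ([(f l[i].1 : ℕ)] ++ encodeLayer e l[i].2.1 ++ [(f l[i].2.2 : ℕ)]) := by
    intro i
    have := h4.flatten (c := S * w * w + w + w + w + w + 4) (by
      intro b hb
      obtain ⟨t, -, rfl⟩ := List.mem_map.1 hb
      simp [encodeLayer_length]) i (by simp)
    rw [List.getElem_map] at this
    convert this using 1
    · ring
    · rfl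
  refine ⟨h.left.left.left.left.head, h1.encodeSet, ?_, ?_, ⟨fun i => ?_, fun i => ?_, fun i => ?_⟩⟩
  · intro q
    have := h2.encodeSet q
    rw [← this]; congr 1; ring
  · rw [← h3.head]; congr 1; ring
  · exact (key i).left.left.head
  · exact (key i).left.right.layer
  · have := (key i).right.head
    rw [← this]
    congr 1
    simp [encodeLayer_length]

end stored

theorem stored_getD (x : List ℕ) : Stored (fun i => x.getD i 0) 0 x := by
  intro i hi
  simp [hi]

end SecondOrder

namespace SecondOrder

/-! ### Correctness -/

variable {α σ₁ σ₂ : Type*} {w S n₁ n₂ N : ℕ} [NeZero N] {WT MB : ℕ → ℕ} {e : α ≃ Fin S}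

theorem partition_concat {D D' : List (Layer α w)} (h : D.length = D'.length) (B B' : Layer α w) :
    partition N WT MB e ((D ++ [B]).zip (D' ++ [B'])) =
      stepP N WT MB e B B' (partition N WT MB e (D.zip D')) := by
  unfold partition
  rw [List.zip_append h, List.foldl_append]
  rfl

/-- The numbered transitions of an automaton. -/
def numbered {σ : Type*} {n : ℕ} (f : σ ≃ Fin n) (l : List (σ × Layer α w × σ)) :
    Fin l.length → Fin n × Layer α w × Fin n := fun i => (f l[i].1, l[i].2.1, f l[i].2.2)

/-! ### From numbered transitions to second languages. -/

section automata
variable {F₁ : NFA (Layer α w) σ₁} {F₂ : NFA (Layer α w) σ₂} {f₁ : σ₁ ≃ Fin n₁} {f₂ : σ₂ ≃ Fin n₂}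
  {l₁ : List (σ₁ × Layer α w × σ₁)} {l₂ : List (σ₂ × Layer α w × σ₂)}
  (h₁ : ∀ t, t ∈ l₁ ↔ t ∈ transitions F₁) (h₂ : ∀ t, t ∈ l₂ ↔ t ∈ transitions F₂)

omit [NeZero N] in
theorem step_iff {σ : Type*} {n : ℕ} {f : σ ≃ Fin n} {F : NFA (Layer α w) σ}
    {l : List (σ × Layer α w × σ)} (h : ∀ t, t ∈ l ↔ t ∈ transitions F) {q q' : Fin n}
    {B : Layer α w} : f.symm q' ∈ F.step (f.symm q) B ↔ ∃ i, numbered f l i = (q, B, q') := by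
  have : f.symm q' ∈ F.step (f.symm q) B ↔ (f.symm q, B, f.symm q') ∈ l := by rw [h]; rfl
  rw [this, List.mem_iff_get]
  unfold numbered
  refine exists_congr fun i => ?_
  have e1 : l.get i = l[i] := rfl
  rw [e1]
  constructor
  · intro h; rw [h]; simp
  · intro h
    simp only [Prod.mk.injEq] at h
    obtain ⟨h1, h2, h3⟩ := h
    rw [← h1, ← h2, ← h3]; simp

-- A path of the search reads two strings of layers of the same length, and its partition depends on
-- these strings alone. Both directions extend by the last pair of layers. The strings need not be
-- diagrams at this point.
include h₁ h₂ in
theorem reach_iff (ν : Node n₁ n₂ (N + N)) : (∃ ν₀ : Node n₁ n₂ (N + N),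
      (f₁.symm ν₀.1 ∈ F₁.start ∧ f₂.symm ν₀.2.1 ∈ F₂.start ∧ ν₀.2.2 = id) ∧
      Relation.ReflTransGen (Next N WT MB e (numbered f₁ l₁) (numbered f₂ l₂)) ν₀ ν) ↔
    ∃ D₁ D₂ : List (Layer α w), D₁.length = D₂.length ∧ f₁.symm ν.1 ∈ F₁.eval D₁ ∧
      f₂.symm ν.2.1 ∈ F₂.eval D₂ ∧ ν.2.2 = partition N WT MB e (D₁.zip D₂) := by
  constructor
  · rintro ⟨ν₀, ⟨h3, h4, h5⟩, hr⟩
    induction hr with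
    | refl => exact ⟨[], [], rfl, h3, h4, h5⟩
    | @tail ν ν' _ hn ih =>
      obtain ⟨D₁, D₂, hl, hq1, hq2, hp⟩ := ih
      obtain ⟨i₁, i₂, hi1, hi2, rfl⟩ := hn
      refine ⟨D₁ ++ [(numbered f₁ l₁ i₁).2.1], D₂ ++ [(numbered f₂ l₂ i₂).2.1], by simp [hl], ?_,
        ?_, ?_⟩
      · rw [NFA.eval_append_singleton, NFA.mem_stepSet]
        exact ⟨_, hq1, (step_iff h₁).2 ⟨i₁, by rw [← hi1]; rfl⟩⟩
      · rw [NFA.eval_append_singleton, NFA.mem_stepSet]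
        exact ⟨_, hq2, (step_iff h₂).2 ⟨i₂, by rw [← hi2]; rfl⟩⟩
      · rw [partition_concat hl, ← hp]; rfl
  · rintro ⟨D₁, D₂, hl, hq1, hq2, hp⟩
    induction D₁ using List.reverseRecOn generalizing D₂ ν with
    | nil =>
      have : D₂ = [] := List.eq_nil_of_length_eq_zero hl.symm
      subst this
      exact ⟨ν, ⟨hq1, hq2, hp⟩, .refl⟩
    | append_singleton D₁ B₁ ih =>
      rcases List.eq_nil_or_concat D₂ with rfl | ⟨D₂, B₂, rfl⟩
      · simp at hl
      rw [List.concat_eq_append] at *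
      have hl' : D₁.length = D₂.length := by simpa using hl
      rw [NFA.eval_append_singleton, NFA.mem_stepSet] at hq1 hq2
      obtain ⟨q1, hq1, hs1⟩ := hq1
      obtain ⟨q2, hq2, hs2⟩ := hq2
      rw [← f₁.symm_apply_apply q1] at hs1
      rw [← f₂.symm_apply_apply q2] at hs2
      obtain ⟨i₁, hi1⟩ := (step_iff h₁).1 hs1
      obtain ⟨i₂, hi2⟩ := (step_iff h₂).1 hs2
      obtain ⟨ν₀, h3, h4⟩ := ih (f₁ q1, f₂ q2, partition N WT MB e (D₁.zip D₂)) D₂ hl' (by simpa)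
        (by simpa) rfl
      refine ⟨ν₀, h3, h4.tail ⟨i₁, i₂, by rw [hi1], by rw [hi2], ?_⟩⟩
      unfold succ
      rw [hi1, hi2]
      refine Prod.ext rfl (Prod.ext rfl ?_)
      rw [hp, partition_concat hl']

-- A win is a last pair of transitions into accepting states whose partition passes the check. Equal
-- languages have equal lengths, so every common language is met along a synchronous pair of paths;
-- accepted diagrams are non-empty, so there is a last pair.
include h₁ h₂ in
theorem win_iff {G : Set (Finset (Fin w))} (hG : ∀ A ∈ G, decS w MB (encS N WT A) = A)
    (hF₁ : IsSOFA F₁) (hF₂ : IsSOFA F₂)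
    (hG₁ : ∀ D ∈ F₁.accepts, ∀ B ∈ D.head?, GoodRun G D B.init)
    (hG₂ : ∀ D ∈ F₂.accepts, ∀ B ∈ D.head?, GoodRun G D B.init) :
    (∃ ν : Node n₁ n₂ (N + N), (∃ ν₀ : Node n₁ n₂ (N + N),
      (f₁.symm ν₀.1 ∈ F₁.start ∧ f₂.symm ν₀.2.1 ∈ F₂.start ∧ ν₀.2.2 = id) ∧
      Relation.ReflTransGen (Next N WT MB e (numbered f₁ l₁) (numbered f₂ l₂)) ν₀ ν) ∧
      Win N WT MB e (numbered f₁ l₁) (numbered f₂ l₂) (fun q => f₁.symm q ∈ F₁.accept)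
        (fun q => f₂.symm q ∈ F₂.accept) ν) ↔
    secondLanguage F₁ ∩ secondLanguage F₂ ≠ ∅ := by
  rw [← Set.nonempty_iff_ne_empty]
  have key : ∀ {D₁ D₂ : List (Layer α w)} {B₁ B₂ : Layer α w}, D₁.length = D₂.length →
      D₁ ++ [B₁] ∈ F₁.accepts → D₂ ++ [B₂] ∈ F₂.accepts →
      ((∀ x, IsFin N MB B₁ B₂ x ↔ IsFin N MB B₁ B₂
        (stepP N WT MB e B₁ B₂ (partition N WT MB e (D₁.zip D₂)) x)) ↔
        oddLanguage (D₁ ++ [B₁]) = oddLanguage (D₂ ++ [B₂])) := by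
    intro D₁ D₂ B₁ B₂ hl ha1 ha2
    rw [← partition_concat hl]
    exact check_iff hG (hF₁ _ ha1) (hF₂ _ ha2) (by simp [hl]) (hG₁ _ ha1) (hG₂ _ ha2)
      (by simp) (by simp)
  constructor
  · rintro ⟨ν, hr, i₁, i₂, hi1, hi2, hw1, hw2, hw⟩
    obtain ⟨D₁, D₂, hl, hq1, hq2, hp⟩ := (reach_iff h₁ h₂ ν).1 hr
    have ha1 : D₁ ++ [(numbered f₁ l₁ i₁).2.1] ∈ F₁.accepts := by
      refine ⟨_, hw1, ?_⟩
      rw [NFA.eval_append_singleton, NFA.mem_stepSet]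
      exact ⟨_, hq1, (step_iff h₁).2 ⟨i₁, by rw [← hi1]⟩⟩
    have ha2 : D₂ ++ [(numbered f₂ l₂ i₂).2.1] ∈ F₂.accepts := by
      refine ⟨_, hw2, ?_⟩
      rw [NFA.eval_append_singleton, NFA.mem_stepSet]
      exact ⟨_, hq2, (step_iff h₂).2 ⟨i₂, by rw [← hi2]⟩⟩
    rw [hp] at hw
    exact ⟨_, ⟨_, ha1, rfl⟩, ⟨_, ha2, (key hl ha1 ha2).1 hw⟩⟩
  · rintro ⟨_, ⟨D₁, ha1, rfl⟩, ⟨D₂, ha2, heq⟩⟩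
    have hl : D₁.length = D₂.length := congrArg Sigma.fst heq
    rcases List.eq_nil_or_concat D₁ with rfl | ⟨D₁, B₁, rfl⟩
    · exact absurd rfl (hF₁ _ ha1).1
    rcases List.eq_nil_or_concat D₂ with rfl | ⟨D₂, B₂, rfl⟩
    · exact absurd rfl (hF₂ _ ha2).1
    rw [List.concat_eq_append] at ha1 ha2 heq hl
    rw [List.concat_eq_append] at heq hl
    have hl' : D₁.length = D₂.length := by simpa using hl
    have hk := (key hl' ha1 ha2).2 heq
    obtain ⟨r1, hr1, ha1⟩ := ha1
    obtain ⟨r2, hr2, ha2⟩ := ha2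
    change _ ∈ F₁.eval _ at ha1
    change _ ∈ F₂.eval _ at ha2
    rw [NFA.eval_append_singleton, NFA.mem_stepSet] at ha1 ha2
    obtain ⟨q1, hq1, hs1⟩ := ha1
    obtain ⟨q2, hq2, hs2⟩ := ha2
    rw [← f₁.symm_apply_apply q1, ← f₁.symm_apply_apply r1] at hs1
    rw [← f₂.symm_apply_apply q2, ← f₂.symm_apply_apply r2] at hs2
    obtain ⟨i₁, hi1⟩ := (step_iff h₁).1 hs1
    obtain ⟨i₂, hi2⟩ := (step_iff h₂).1 hs2
    refine ⟨(f₁ q1, f₂ q2, partition N WT MB e (D₁.zip D₂)), (reach_iff h₁ h₂ _).2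
      ⟨D₁, D₂, hl', by simpa, by simpa, rfl⟩, i₁, i₂, by rw [hi1], by rw [hi2], ?_, ?_, ?_⟩
    · rw [hi1]; simpa
    · rw [hi2]; simpa
    · rw [hi1, hi2]; exact hk

end automata

/-! ### The macro states that occur in runs. -/

theorem goodRun_univ (D : List (Layer α w)) : ∀ A, GoodRun Set.univ D A := by
  induction D with
  | nil => intro A; trivial
  | cons B D ih => exact fun A => ⟨trivial, fun a => ih _⟩

/-- Completeness gives a successor and determinism allows no second one. Matching frontiers make it
a left state of the next layer, where the argument repeats. -/
theorem goodRun_singleton (D : List (Layer α w)) : ∀ (q : Fin w),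
    (∀ B ∈ D, B.IsDeterministic ∧ B.IsComplete) →
    (∀ (i : ℕ) (hi : i + 1 < D.length), (D[i + 1]).left = (D[i]).right) →
    (∀ B ∈ D.head?, q ∈ B.left) → GoodRun {A | ∃ q, A = {q}} D {q} := by
  induction D with
  | nil => intro q _ _ _; exact ⟨q, rfl⟩
  | cons B D ih =>
    intro q hD hc hq
    have hq' : q ∈ B.left := hq B rfl
    obtain ⟨hdet, hcomp⟩ := hD B (List.mem_cons_self ..)
    refine ⟨⟨q, rfl⟩, fun a => ?_⟩
    obtain ⟨q', hr, ht⟩ := hcomp.2 q hq' a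
    have hs : stepS B a {q} = {q'} := by
      ext r
      rw [mem_stepS]
      simp only [Finset.mem_singleton, exists_eq_left]
      constructor
      · intro h
        exact hdet.2 q hq' a r (B.trans_subset _ h).2 q' hr h ht
      · rintro rfl; exact ht
    rw [hs]
    refine ih q' (fun C hC => hD C (List.mem_cons_of_mem _ hC)) (fun i hi => ?_) fun C hC => ?_
    · exact hc (i + 1) (by simpa using hi)
    · cases D with
      | nil => simp at hC
      | cons C' D =>
        have := hc 0 (by simp)
        simp only [List.head?_cons, Option.mem_def, Option.some.injEq] at hC
        simp only [List.getElem_cons_succ, List.getElem_cons_zero] at this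
        rw [← hC, this]; exact hr

/-- For a deterministic layer with the initial flag set, the initial states are all left states, of
which there is only one. -/
theorem goodRun_of_det {D : List (Layer α w)} (hD : IsODD D)
    (hdc : ∀ B ∈ D, B.IsDeterministic ∧ B.IsComplete) :
    ∀ B ∈ D.head?, GoodRun {A | ∃ q, A = {q}} D B.init := by
  intro B hB
  cases D with
  | nil => simp at hB
  | cons C D =>
    simp only [List.head?_cons, Option.mem_def, Option.some.injEq] at hB
    subst hB
    have hflag : C.initFlag = true := (hD.2.2.1 0 (by simp)).2 rfl
    obtain ⟨h1, h2⟩ := (hdc C (List.mem_cons_self ..)).1.1 hflag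
    obtain ⟨q, hq⟩ := Finset.card_eq_one.1 h2
    rw [h1, hq]
    refine goodRun_singleton _ q hdc hD.2.1 fun B hB => ?_
    simp only [List.head?_cons, Option.mem_def, Option.some.injEq] at hB
    rw [← hB, hq]; simp

end SecondOrder

namespace SecondOrder

/-! ### The decision procedure -/

section code
open Var Arr Cmd Exp

/-- The search with the numbering of macro states that is set up by `tab`. -/
def decideC (tab : Cmd) : Cmd := tab ⨾ prepC ⨾ startC ⨾ searchC

/-- The numbering of all sets of states. -/
def subsetsC : Cmd := powC ⨾ membC

end code

variable {X : ℕ → ℕ}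

theorem Cmd.cost_le_prod (F : Finset Var) (c : Cmd) (s : St) (h : c.static F = true) :
    c.cost X s ≤ c.K * ∏ v ∈ F, (s.reg v + 1) ^ c.deg v :=
  c.cost_le X (ρ := fun v => s.reg v + 1) (fun _ _ => Nat.le_add_left 1 _) s h
    fun _ _ => Nat.le_succ _

/-- The exponents are depths of nested loops. The alphabet enters twice, once as the loop over
letters and once in the multiplication that forms the address of a transition bit. -/
theorem edgeC_cost (s : St) : edgeC.cost X s ≤
    1332 * ((s.reg .s + 1) ^ 2 * ((s.reg .w + 1) ^ 3 * (s.reg .M + 1) ^ 2)) := by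
  have h := Cmd.cost_le_prod (X := X) {.s, .w, .M} edgeC s (by decide)
  rw [Finset.prod_insert (by decide), Finset.prod_insert (by decide), Finset.prod_singleton] at h
  exact h

theorem loadC_cost (s : St) : loadC.cost X s ≤ 109 * (s.reg .M + 1) := by
  have h := Cmd.cost_le_prod (X := X) {.M} loadC s (by decide)
  rw [Finset.prod_singleton, show loadC.deg .M = 1 from rfl, pow_one] at h
  exact h

theorem startC_cost (s : St) : startC.cost X s ≤
    startC.K * ((s.reg .n1 + 1) * ((s.reg .n2 + 1) * (s.reg .M + 1) ^ 2)) := by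
  have h := Cmd.cost_le_prod (X := X) {.n1, .n2, .M} startC s (by decide)
  rw [Finset.prod_insert (by decide), Finset.prod_insert (by decide), Finset.prod_singleton,
    show startC.deg .n1 = 1 from rfl, show startC.deg .n2 = 1 from rfl, pow_one, pow_one] at h
  exact h

theorem bndC_cost (s : St) : bndC.cost X s ≤
    bndC.K * ((s.reg .n2 + 1) * (s.reg .M + 1) ^ 2) := by
  have h := Cmd.cost_le_prod (X := X) {.n2, .M} bndC s (by decide)
  rw [Finset.prod_insert (by decide), Finset.prod_singleton,
    show bndC.deg .n2 = 1 from rfl, pow_one] at h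
  exact h

theorem singleC_cost (s : St) : singleC.cost X s ≤ 70 * (s.reg .w + 1) ^ 2 := by
  have h := Cmd.cost_le_prod (X := X) {.w} singleC s (by decide)
  rw [Finset.prod_singleton] at h
  exact h.trans (Nat.mul_le_mul_right _ (by decide))

/-- The bound N of the second loop is computed by the first part, so the static estimate is applied
to the two parts separately. -/
theorem subsetsC_cost {w : ℕ} {s : St} (hw : s.reg .w = w) :
    subsetsC.cost X s ≤ 300 * ((w + 1) * (2 ^ w + 1)) := by
  have h1 := Cmd.cost_le_prod (X := X) {.w} powC s (by decide)
  have h2 := Cmd.cost_le_prod (X := X) {.w, .N} membC (powC.eval X s) (by decide)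
  have hw' : (powC.eval X s).reg .w = w := by rw [Cmd.reg_frame _ _ _ rfl, hw]
  rw [Finset.prod_insert (by decide), Finset.prod_singleton, (powC_spec hw).1, hw',
    show membC.deg .w = 1 from rfl, show membC.deg .N = 1 from rfl, pow_one, pow_one] at h2
  rw [Finset.prod_singleton, show powC.deg .w = 1 from rfl, pow_one, hw] at h1
  have h3 : subsetsC.cost X s = powC.cost X s + membC.cost X (powC.eval X s) := rfl
  have h4 : powC.K ≤ 100 := by decide
  have h5 : membC.K ≤ 200 := by decide
  rw [h3]
  calc _ ≤ 100 * ((w + 1) * (2 ^ w + 1)) + 200 * ((w + 1) * (2 ^ w + 1)) := by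
        refine add_le_add (h1.trans (Nat.mul_le_mul h4 ?_)) (h2.trans (Nat.mul_le_mul_right _ h5))
        exact Nat.le_mul_of_pos_right _ (Nat.succ_pos _)
    _ = _ := by ring

section decide

variable {α σ₁ σ₂ : Type*} {w S n₁ n₂ N : ℕ} {e : α ≃ Fin S}
  {F₁ : NFA (Layer α w) σ₁} {F₂ : NFA (Layer α w) σ₂} {f₁ : σ₁ ≃ Fin n₁} {f₂ : σ₂ ≃ Fin n₂}
  {l₁ : List (σ₁ × Layer α w × σ₁)} {l₂ : List (σ₂ × Layer α w × σ₂)} {b₁ b₂ : ℕ}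

theorem prepC_cost {T₁ T₂ : ℕ} {tr₁ : Fin T₁ → Fin n₁ × Layer α w × Fin n₁}
    {tr₂ : Fin T₂ → Fin n₂ × Layer α w × Fin n₂} {acc₁ ini₁ : Fin n₁ → Prop}
    {acc₂ ini₂ : Fin n₂ → Prop} {s : St}
    (h : Input X e b₁ b₂ tr₁ tr₂ acc₁ ini₁ acc₂ ini₂ s) (hN : s.reg .N = N) :
    prepC.cost X s ≤ 7 + (34 * (n₁ + 1) + (34 * (n₁ + 1) + (34 * (n₂ + 1) +
      (57 * ((n₂ + 1) * (N + N + 1) ^ 2) + (82 * (T₁ + 1) + 82 * (T₂ + 1)))))) := by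
  set s1 := (Cmd.assign .M (♯.N + ♯.N)).eval X s with hs1
  have h1 : Input X e b₁ b₂ tr₁ tr₂ acc₁ ini₁ acc₂ ini₂ s1 := h.eval _ rfl
  have hM1 : s1.reg .M = N + N := by simp [hs1, Cmd.eval, hN]
  set s2 := (rowC .row .n1 .n2).eval X s1 with hs2
  have h2 : Input X e b₁ b₂ tr₁ tr₂ acc₁ ini₁ acc₂ ini₂ s2 := h1.eval _ rfl
  have hM2 : s2.reg .M = N + N := by rw [hs2, Cmd.reg_frame _ _ _ rfl, hM1]
  set s3 := (rowC .rowA .n1 .t1).eval X s2 with hs3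
  have h3 : Input X e b₁ b₂ tr₁ tr₂ acc₁ ini₁ acc₂ ini₂ s3 := h2.eval _ rfl
  have hM3 : s3.reg .M = N + N := by rw [hs3, Cmd.reg_frame _ _ _ rfl, hM2]
  set s4 := (rowC .rowB .n2 .t2).eval X s3 with hs4
  have h4 : Input X e b₁ b₂ tr₁ tr₂ acc₁ ini₁ acc₂ ini₂ s4 := h3.eval _ rfl
  have hM4 : s4.reg .M = N + N := by rw [hs4, Cmd.reg_frame _ _ _ rfl, hM3]
  set s5 := bndC.eval X s4 with hs5
  have h5 : Input X e b₁ b₂ tr₁ tr₂ acc₁ ini₁ acc₂ ini₂ s5 := h4.eval _ rfl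
  set s6 := (adjC .deg1 .rowA .out1 .tp1 .t1).eval X s5 with hs6
  have h6 : Input X e b₁ b₂ tr₁ tr₂ acc₁ ini₁ acc₂ ini₂ s6 := h5.eval _ rfl
  have hc : prepC.cost X s = 7 + ((rowC .row .n1 .n2).cost X s1 + ((rowC .rowA .n1 .t1).cost X s2 +
    ((rowC .rowB .n2 .t2).cost X s3 + (bndC.cost X s4 + ((adjC .deg1 .rowA .out1 .tp1 .t1).cost X s5
      + (adjC .deg2 .rowB .out2 .tp2 .t2).cost X s6))))) := rfl
  have c1 := Cmd.cost_le_prod (X := X) {.n1} (rowC .row .n1 .n2) s1 (by decide)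
  have c2 := Cmd.cost_le_prod (X := X) {.n1} (rowC .rowA .n1 .t1) s2 (by decide)
  have c3 := Cmd.cost_le_prod (X := X) {.n2} (rowC .rowB .n2 .t2) s3 (by decide)
  have c4 := bndC_cost (X := X) s4
  have c5 := Cmd.cost_le_prod (X := X) {.t1} (adjC .deg1 .rowA .out1 .tp1 .t1) s5 (by decide)
  have c6 := Cmd.cost_le_prod (X := X) {.t2} (adjC .deg2 .rowB .out2 .tp2 .t2) s6 (by decide)
  rw [Finset.prod_singleton, h1.n1,
    show (rowC .row .n1 .n2).deg .n1 = 1 from rfl, pow_one,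
    show (rowC .row .n1 .n2).K = 34 from rfl] at c1
  rw [Finset.prod_singleton, h2.n1,
    show (rowC .rowA .n1 .t1).deg .n1 = 1 from rfl, pow_one,
    show (rowC .rowA .n1 .t1).K = 34 from rfl] at c2
  rw [Finset.prod_singleton, h3.n2,
    show (rowC .rowB .n2 .t2).deg .n2 = 1 from rfl, pow_one,
    show (rowC .rowB .n2 .t2).K = 34 from rfl] at c3
  rw [h4.n2, hM4, show bndC.K = 57 from rfl] at c4
  rw [Finset.prod_singleton, h5.t1,
    show (adjC .deg1 .rowA .out1 .tp1 .t1).deg .t1 = 1 from rfl, pow_one,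
    show (adjC .deg1 .rowA .out1 .tp1 .t1).K = 82 from rfl] at c5
  rw [Finset.prod_singleton, h6.t2,
    show (adjC .deg2 .rowB .out2 .tp2 .t2).deg .t2 = 1 from rfl, pow_one,
    show (adjC .deg2 .rowB .out2 .tp2 .t2).K = 82 from rfl] at c6
  rw [hc]
  gcongr

/-- The numerical estimate behind the running time. -/
theorem total_le {T₁ T₂ D : ℕ} (hn₁ : 1 ≤ n₁) (hn₂ : 1 ≤ n₂) (hS : 1 ≤ S) (hw : w ≤ N + N)
    (hD : 1 ≤ D) :
    (7 + (34 * (n₁ + 1) + (34 * (n₁ + 1) + (34 * (n₂ + 1) +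
      (57 * ((n₂ + 1) * (N + N + 1) ^ 2) + (82 * (T₁ + 1) + 82 * (T₂ + 1))))))) +
    (254 * ((n₁ + 1) * ((n₂ + 1) * (N + N + 1) ^ 2)) +
    (5 + D * (n₁ * n₂ * (109 * (N + N + 1) + 19) + T₁ * n₂ * 36 + T₁ * T₂ *
      (31 + 1332 * ((S + 1) ^ 2 * ((w + 1) ^ 3 * (N + N + 1) ^ 2)))))) ≤
    8000 * (N + N + 1) ^ 5 * D * (n₁ + T₁ * S) * (n₂ + T₂ * S) := by
  set Z := N + N + 1 with hZ
  have hZ1 : 1 ≤ Z := by omega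
  have hwZ : w + 1 ≤ Z := by omega
  set P := n₁ + T₁ * S with hP
  set Q := n₂ + T₂ * S with hQ
  have hTS₁ : T₁ ≤ T₁ * S := Nat.le_mul_of_pos_right _ hS
  have hTS₂ : T₂ ≤ T₂ * S := Nat.le_mul_of_pos_right _ hS
  have hP1 : 1 ≤ P := by omega
  have hQ1 : 1 ≤ Q := by omega
  set V := Z ^ 5 * D * P * Q with hV
  have pw : ∀ k ≤ 5, Z ^ k ≤ Z ^ 5 := fun k hk => Nat.pow_le_pow_right hZ1 hk
  have up : ∀ a b c d : ℕ, a ≤ Z ^ 5 → b ≤ D → c ≤ P → d ≤ Q → a * b * c * d ≤ V := by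
    intro a b c d ha hb hc hd
    rw [hV]; gcongr
  have Z51 : 1 ≤ Z ^ 5 := Nat.one_le_pow _ _ hZ1
  have v0 : 1 ≤ V := by simpa using up 1 1 1 1 Z51 hD hP1 hQ1
  have v1 : P ≤ V := by simpa using up 1 1 P 1 Z51 hD le_rfl hQ1
  have v2 : Q ≤ V := by simpa using up 1 1 1 Q Z51 hD hP1 le_rfl
  have v3 : Z ^ 2 * Q ≤ V := by simpa using up (Z ^ 2) 1 1 Q (pw 2 (by omega)) hD hP1 le_rfl
  have v4 : Z ^ 2 * P * Q ≤ V := by simpa using up (Z ^ 2) 1 P Q (pw 2 (by omega)) hD le_rfl le_rfl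
  have v5 : Z * D * n₁ * n₂ ≤ V :=
    up Z D n₁ n₂ (by simpa using pw 1 (by omega)) le_rfl (by omega) (by omega)
  have v6 : D * n₁ * n₂ ≤ V := by
    simpa using up 1 D n₁ n₂ Z51 le_rfl (by omega) (by omega)
  have v7 : D * T₁ * n₂ ≤ V := by
    simpa using up 1 D T₁ n₂ Z51 le_rfl (by omega) (by omega)
  have v8 : D * T₁ * T₂ ≤ V := by
    simpa using up 1 D T₁ T₂ Z51 le_rfl (by omega) (by omega)
  have v9 : Z ^ 5 * D * (T₁ * S) * (T₂ * S) ≤ V := up _ D _ _ le_rfl le_rfl (by omega) (by omega)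
  have x1 : (n₂ + 1) * Z ^ 2 ≤ 2 * V := by
    calc (n₂ + 1) * Z ^ 2 ≤ (2 * Q) * Z ^ 2 := by gcongr; omega
      _ = 2 * (Z ^ 2 * Q) := by ring
      _ ≤ 2 * V := by gcongr
  have x2 : (n₁ + 1) * ((n₂ + 1) * Z ^ 2) ≤ 4 * V := by
    calc (n₁ + 1) * ((n₂ + 1) * Z ^ 2) ≤ (2 * P) * ((2 * Q) * Z ^ 2) := by gcongr <;> omega
      _ = 4 * (Z ^ 2 * P * Q) := by ring
      _ ≤ 4 * V := by gcongr
  -- The dominant term: (S + 1)² ≤ 4 S² gives each number of transitions its own factor S, matching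
  -- the two sizes, and (w + 1)³ Z² ≤ Z⁵ fixes the exponent 5.
  have x3 : D * T₁ * T₂ * ((S + 1) ^ 2 * ((w + 1) ^ 3 * Z ^ 2)) ≤ 4 * V := by
    calc _ ≤ D * T₁ * T₂ * ((2 * S) ^ 2 * (Z ^ 3 * Z ^ 2)) := by gcongr; omega
      _ = 4 * (Z ^ 5 * D * (T₁ * S) * (T₂ * S)) := by ring
      _ ≤ 4 * V := by gcongr
  have e1 : D * (n₁ * n₂ * (109 * Z + 19) + T₁ * n₂ * 36 + T₁ * T₂ *
      (31 + 1332 * ((S + 1) ^ 2 * ((w + 1) ^ 3 * Z ^ 2)))) = 109 * (Z * D * n₁ * n₂) +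
      19 * (D * n₁ * n₂) + 36 * (D * T₁ * n₂) + 31 * (D * T₁ * T₂) +
      1332 * (D * T₁ * T₂ * ((S + 1) ^ 2 * ((w + 1) ^ 3 * Z ^ 2))) := by ring
  have e2 : 8000 * Z ^ 5 * D * P * Q = 8000 * V := by rw [hV]; ring
  rw [e1, e2]
  omega

/-- A set-up of macro states for the search. -/
structure Cmd.IsTable (tab : Cmd) : Prop where
  input : inputVars.all (fun v => !tab.wr v) = true
  cnt : tab.wr .cnt = false
  ans : tab.wr .ans = false
  deg1 : tab.wa .deg1 = false
  deg2 : tab.wa .deg2 = false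
  vis : tab.wa .vis = false

/-- The table `tab` enters only through its number N of macro states, the recovery of the sets in
`G` and its cost. Both claims of the theorem are instances. -/
theorem decideC_spec [NeZero N] {tab : Cmd} (htab : tab.IsTable) {s : St}
    (hI : Input X e b₁ b₂ (numbered f₁ l₁) (numbered f₂ l₂) (fun q => f₁.symm q ∈ F₁.accept)
      (fun q => f₁.symm q ∈ F₁.start) (fun q => f₂.symm q ∈ F₂.accept)
      (fun q => f₂.symm q ∈ F₂.start) s)
    (h₁ : ∀ t, t ∈ l₁ ↔ t ∈ transitions F₁) (h₂ : ∀ t, t ∈ l₂ ↔ t ∈ transitions F₂)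
    (hcnt : s.reg .cnt = 0) (hans : s.reg .ans = 0) (harr : ∀ k y, s.arr k y = 0)
    (hN : (tab.eval X s).reg .N = N) {G : Set (Finset (Fin w))}
    (hG : ∀ A ∈ G, decS w ((tab.eval X s).arr .memb) (encS N ((tab.eval X s).arr .wt) A) = A)
    (hF₁ : IsSOFA F₁) (hF₂ : IsSOFA F₂)
    (hG₁ : ∀ D ∈ F₁.accepts, ∀ B ∈ D.head?, GoodRun G D B.init)
    (hG₂ : ∀ D ∈ F₂.accepts, ∀ B ∈ D.head?, GoodRun G D B.init)
    (hn₁ : 1 ≤ n₁) (hn₂ : 1 ≤ n₂) (hS : 1 ≤ S) (hw : w ≤ N + N) :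
    (((decideC tab).eval X s).reg .ans ≠ 0 ↔ secondLanguage F₁ ∩ secondLanguage F₂ ≠ ∅) ∧
    (decideC tab).cost X s ≤ tab.cost X s + 8000 * (N + N + 1) ^ 5 * (N + N) ^ (N + N) *
      (n₁ + l₁.length * S) * (n₂ + l₂.length * S) := by
  unfold decideC
  simp only [Cmd.eval_seq]
  set s1 := tab.eval X s with hs1
  have hI1 := hI.eval tab htab.input
  rw [← hs1] at hI1
  set s2 := prepC.eval X s1 with hs2
  have hSet := prepC_spec (X := X) hI1 hN
    (fun q => by rw [hs1, Cmd.arr_frame _ _ _ htab.deg1, harr])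
    (fun q => by rw [hs1, Cmd.arr_frame _ _ _ htab.deg2, harr])
  rw [← hs2] at hSet
  have hI2 := hI1.eval prepC rfl
  rw [← hs2] at hI2
  obtain ⟨l, hQ, hl⟩ := startC_spec (X := X) hI2 hSet
    (fun y => by rw [hs2, Cmd.arr_frame _ _ _ rfl, hs1, Cmd.arr_frame _ _ _ htab.vis, harr])
    (by rw [hs2, Cmd.reg_frame _ _ _ rfl, hs1, Cmd.reg_frame _ _ _ htab.cnt, hcnt])
  set s3 := startC.eval X s2 with hs3
  have hsame : Same s2 s3 := Same.eval ⟨fun _ _ => rfl, fun _ _ => rfl⟩ startC rfl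
  have hSet3 : Setup X N (s1.arr .wt) (s1.arr .memb) e b₁ b₂ (numbered f₁ l₁) (numbered f₂ l₂)
      (fun q => f₁.symm q ∈ F₁.accept) (fun q => f₂.symm q ∈ F₂.accept) s3 := by
    have hlam : s3.reg .lam = s2.reg .lam := hsame.reg _ (by decide)
    refine ⟨hsame.env hSet.env, ?_, ?_, ?_, ?_, ?_, ?_, ?_, ?_⟩
    · rw [hsame.arr _ (by decide)]; exact hSet.row
    · rw [hlam]; exact hSet.lst₁
    · rw [hlam]; exact hSet.lst₂
    · rw [hlam, hsame.arr .deg1 (by decide), hsame.arr .rowA (by decide),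
        hsame.arr .out1 (by decide)]
      exact hSet.adj₁
    · rw [hlam, hsame.arr .deg2 (by decide), hsame.arr .rowB (by decide),
        hsame.arr .out2 (by decide)]
      exact hSet.adj₂
    · rw [hsame.reg .ac1 (by decide)]; exact hSet.acc₁
    · rw [hsame.reg .ac2 (by decide)]; exact hSet.acc₂
    · rw [hsame.reg .bnd (by decide)]; exact hSet.bnd
  have hE : ∀ u, Same s3 u → edgeC.cost X u ≤
      1332 * ((S + 1) ^ 2 * ((w + 1) ^ 3 * (N + N + 1) ^ 2)) := by
    intro u hu
    have he := hu.env hSet3.env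
    have := edgeC_cost (X := X) u
    rwa [he.eqS, he.eqw, he.eqM] at this
  have hA : ∀ u, Same s3 u → loadC.cost X u ≤ 109 * (N + N + 1) := by
    intro u hu
    have := loadC_cost (X := X) u
    rwa [(hu.env hSet3.env).eqM] at this
  obtain ⟨h3, h4⟩ := searchC_spec hSet3 hE hA hQ (by
    rw [hs3, Cmd.reg_frame _ _ _ rfl, hs2, Cmd.reg_frame _ _ _ rfl, hs1,
      Cmd.reg_frame _ _ _ htab.ans, hans])
  constructor
  · rw [h3, ← win_iff (e := e) (f₁ := f₁) (f₂ := f₂) h₁ h₂ hG hF₁ hF₂ hG₁ hG₂]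
    simp only [hl]
  · have c1 := prepC_cost hI1 hN
    have c2 := startC_cost (X := X) s2
    rw [hI2.n1, hI2.n2, hSet.env.eqM, show startC.K = 254 from rfl] at c2
    have hc : (Cmd.seq tab (.seq prepC (.seq startC searchC))).cost X s = tab.cost X s +
      (prepC.cost X s1 + (startC.cost X s2 + searchC.cost X s3)) := rfl
    rw [hc]
    refine Nat.add_le_add_left (le_trans ?_ (total_le hn₁ hn₂ hS hw
      (Nat.one_le_pow _ _ (by have := NeZero.ne N; omega)))) _
    exact add_le_add c1 (add_le_add c2 h4)

end decide

end SecondOrder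

/-! ### The whole program, and its running time in terms of the sizes. -/

namespace SecondOrder

variable {α σ₁ σ₂ : Type*} {w S n₁ n₂ : ℕ} {e : α ≃ Fin S}
  {F₁ : NFA (Layer α w) σ₁} {F₂ : NFA (Layer α w) σ₂} {f₁ : σ₁ ≃ Fin n₁} {f₂ : σ₂ ≃ Fin n₂}
  {l₁ : List (σ₁ × Layer α w × σ₁)} {l₂ : List (σ₂ × Layer α w × σ₂)}

/-- The prelude reads a presentation of two automata correctly. -/
theorem preC_input {x : List ℕ}
    (hx : x = [S, w] ++ encodeNFA e f₁ F₁ l₁ ++ encodeNFA e f₂ F₂ l₂) (t : St) :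
    (∃ b₁ b₂, Input (fun i => x.getD i 0) e b₁ b₂ (numbered f₁ l₁) (numbered f₂ l₂)
      (fun q => f₁.symm q ∈ F₁.accept) (fun q => f₁.symm q ∈ F₁.start)
      (fun q => f₂.symm q ∈ F₂.accept) (fun q => f₂.symm q ∈ F₂.start)
      (preC.eval (fun i => x.getD i 0) t)) ∧
    x.length ≤ (preC.eval (fun i => x.getD i 0) t).reg .len ∧
    preC.cost (fun i => x.getD i 0) t ≤ 200 + 26 * w + 13 * l₁.length + 13 * l₂.length := by
  have h0 := stored_getD x
  have hlen : x.length = 2 + (1 + n₁ + n₁ + 1 + l₁.length * (S * w * w + w + w + w + w + 4)) +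
      (1 + n₂ + n₂ + 1 + l₂.length * (S * w * w + w + w + w + w + 4)) := by
    rw [hx]
    simp only [List.length_append, encodeNFA_length, List.length_cons, List.length_nil]
  set X : ℕ → ℕ := fun i => x.getD i 0 with hX
  rw [hx] at h0
  have ha := h0.left.left
  obtain ⟨a1, a2, a3, a4, a5⟩ := h0.left.right.nfa
  obtain ⟨c1, c2, c3, c4, c5⟩ := h0.right.nfa
  simp only [List.length_append, encodeNFA_length, List.length_cons, List.length_nil, zero_add]
    at a1 a2 a3 a4 a5 c1 c2 c3 c4 c5
  have x0 : X 0 = S := ha.head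
  have x1 : X 1 = w := ha 1 (by simp)
  set Λ := S * w * w + w + w + w + w + 4 with hΛ
  have r1 : 0 + (1 + 1 + (1 + n₁ + n₁ + 1 + l₁.length * Λ)) = 3 + n₁ + n₁ + 1 + l₁.length * Λ := by
    ring
  simp only [zero_add] at r1
  rw [r1] at c1 c2 c3 c4 c5
  obtain ⟨L, hcost⟩ := preC_spec (X := X) hΛ x0 x1 a1 a4 c1 c4 t
  set s := preC.eval X t with hs
  refine ⟨⟨s.reg .tp1, s.reg .tp2, L.eqs, L.eqw, L.n1, L.n2, L.t1, L.t2, rfl, rfl, ?_, ?_, ?_, ?_,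
    a2, ?_⟩, ?_, hcost⟩
  · rw [L.eqlam, L.tp1]; exact a5
  · rw [L.eqlam, L.tp2]; exact c5
  · rw [L.ac1]; exact a3
  · rw [L.ac2]; exact c3
  · rw [L.st2]; exact c2
  · rw [hlen, L.len]
    omega

theorem decides [NeZero S] {N K : ℕ} [NeZero N] {tab : Cmd} (htab : tab.IsTable)
    (hcost : ∀ (X : ℕ → ℕ) (s : St), s.reg .w = w → tab.cost X s ≤ K)
    (hN : ∀ (X : ℕ → ℕ) (s : St), s.reg .w = w → (∀ y, s.arr .memb y = 0) →
      (tab.eval X s).reg .N = N) {G : Set (Finset (Fin w))}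
    (hG : ∀ (X : ℕ → ℕ) (s : St), s.reg .w = w → (∀ y, s.arr .memb y = 0) → ∀ A ∈ G,
      decS w ((tab.eval X s).arr .memb) (encS N ((tab.eval X s).arr .wt) A) = A)
    (hF₁ : IsSOFA F₁) (hF₂ : IsSOFA F₂)
    (hG₁ : ∀ D ∈ F₁.accepts, ∀ B ∈ D.head?, GoodRun G D B.init)
    (hG₂ : ∀ D ∈ F₂.accepts, ∀ B ∈ D.head?, GoodRun G D B.init)
    (hn₁ : 1 ≤ n₁) (hn₂ : 1 ≤ n₂) (hw : w ≤ N)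
    (h₁ : ∀ t, t ∈ l₁ ↔ t ∈ transitions F₁) (h₂ : ∀ t, t ∈ l₂ ↔ t ∈ transitions F₂) {x : List ℕ}
    (hx : x = [S, w] ++ encodeNFA e f₁ F₁ l₁ ++ encodeNFA e f₂ F₂ l₂) {T : ℝ}
    (hT : ((204 + 26 * w + 13 * l₁.length + 13 * l₂.length + K + 8000 * (N + N + 1) ^ 5 *
      (N + N) ^ (N + N) * (n₁ + l₁.length * S) * (n₂ + l₂.length * S) : ℕ) : ℝ) ≤ T) :
    DecidesWithin (program preC (decideC tab)) x (secondLanguage F₁ ∩ secondLanguage F₂ ≠ ∅) T := by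
  obtain ⟨⟨b₁, b₂, hI⟩, hlen, hc⟩ := preC_input hx St.zero
  obtain ⟨t, ht, hrun⟩ := run_program preC (decideC tab) x rfl hlen
  set X : ℕ → ℕ := fun i => x.getD i 0 with hX
  set s := preC.eval X St.zero with hs
  have harr : s.arr = St.zero.arr := Cmd.eval_arr_of_noArr X preC St.zero rfl
  obtain ⟨h3, h4⟩ := decideC_spec htab hI h₁ h₂ (Cmd.reg_frame _ _ _ rfl)
    (Cmd.reg_frame _ _ _ rfl) (fun k y => by rw [harr]; rfl)
    (hN X s hI.eqw fun y => by rw [harr]; rfl) (hG X s hI.eqw fun y => by rw [harr]; rfl) hF₁ hF₂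
    hG₁ hG₂ hn₁ hn₂ (Nat.one_le_iff_ne_zero.2 (NeZero.ne S)) (by omega)
  refine ⟨t, _, le_trans ?_ hT, hrun, ?_⟩
  · have := hcost X s hI.eqw
    exact_mod_cast (by omega)
  · rw [decide_eq_true_eq, h3]

/-! ### The size of automata -/

theorem two_pow_le_card_layer [Fintype α] (hw : 0 < w) :
    2 ^ Fintype.card α ≤ Nat.card (Layer α w) := by
  classical
  let z : Fin w := ⟨0, hw⟩
  let g : Finset α → Layer α w := fun A =>
    { left := {z}, right := {z}, trans := A.image fun a => (z, a, z), init := ∅, final := ∅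
      initFlag := false, finalFlag := false
      trans_subset := by
        intro t ht
        obtain ⟨a, -, rfl⟩ := Finset.mem_image.1 ht
        simp
      init_subset := by simp
      final_subset := by simp
      init_eq_empty := fun _ => rfl
      final_eq_empty := fun _ => rfl }
  have hg : Function.Injective g := by
    intro A A' h
    have h' : A.image (fun a => (z, a, z)) = A'.image fun a => (z, a, z) := congrArg Layer.trans h
    refine Finset.image_injective (fun a b hab => ?_) h'
    simpa using hab
  have := Nat.card_le_card_of_injective g hg
  rwa [Nat.card_eq_fintype_card, Fintype.card_finset] at this

/-- The number of symbols is at most the logarithm of the number of layers. This is where the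
logarithmic factor in the definition of size pays for the quadratic dependence on the alphabet. -/
theorem le_size [Fintype α] (hw : 0 < w) (hS : Fintype.card α = S) (hl : l₁.Nodup)
    (h₁ : ∀ t, t ∈ l₁ ↔ t ∈ transitions F₁) (f₁ : σ₁ ≃ Fin n₁) :
    ((n₁ + l₁.length * S : ℕ) : ℝ) ≤ size F₁ := by
  classical
  have e1 : Nat.card σ₁ = n₁ := by rw [Nat.card_congr f₁, Nat.card_fin]
  have e2 : (transitions F₁).ncard = l₁.length := by
    have : transitions F₁ = (l₁.toFinset : Set _) := by ext t; simp [h₁]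
    rw [this, Set.ncard_coe_finset, List.toFinset_card_of_nodup hl]
  have e3 : (S : ℝ) ≤ Real.logb 2 (Nat.card (Layer α w)) := by
    have hc := two_pow_le_card_layer (α := α) hw
    rw [hS] at hc
    rw [Real.le_logb_iff_rpow_le (by norm_num) (by
      exact_mod_cast lt_of_lt_of_le (pow_pos (by norm_num) _) hc), Real.rpow_natCast]
    exact_mod_cast hc
  unfold size
  rw [e1, e2]
  push_cast
  gcongr

theorem le_mul_size {V P Q c : ℕ} {s₁ s₂ B : ℝ} (h₁ : (P : ℝ) ≤ s₁) (h₂ : (Q : ℝ) ≤ s₂)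
    (hV : (V : ℝ) ≤ B) (hc : c ≤ V * P * Q) : (c : ℝ) ≤ B * s₁ * s₂ := by
  have hB : 0 ≤ B := (Nat.cast_nonneg V).trans hV
  have hs : 0 ≤ s₁ := (Nat.cast_nonneg P).trans h₁
  calc (c : ℝ) ≤ ((V * P * Q : ℕ) : ℝ) := by exact_mod_cast hc
    _ = (V : ℝ) * P * Q := by push_cast; ring
    _ ≤ B * s₁ * s₂ := by gcongr

theorem overhead_le {N T₁ T₂ K D : ℕ} (hn₁ : 1 ≤ n₁) (hn₂ : 1 ≤ n₂) (hS : 1 ≤ S) (hw : w ≤ N)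
    (hK : K ≤ 1200 * (N + N + 1) ^ 2) (hD : 1 ≤ D) :
    204 + 26 * w + 13 * T₁ + 13 * T₂ + K + 8000 * (N + N + 1) ^ 5 * D * (n₁ + T₁ * S) *
      (n₂ + T₂ * S) ≤ (10000 * (N + N + 1) ^ 5 * D) * (n₁ + T₁ * S) * (n₂ + T₂ * S) := by
  set Z := N + N + 1 with hZ
  have hZ1 : 1 ≤ Z := by omega
  set P := n₁ + T₁ * S with hP
  set Q := n₂ + T₂ * S with hQ
  have hTS₁ : T₁ ≤ T₁ * S := Nat.le_mul_of_pos_right _ hS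
  have hTS₂ : T₂ ≤ T₂ * S := Nat.le_mul_of_pos_right _ hS
  have hP1 : 1 ≤ P := by omega
  have hQ1 : 1 ≤ Q := by omega
  set V := Z ^ 5 * D * P * Q with hV
  have pw : ∀ k ≤ 5, Z ^ k ≤ Z ^ 5 := fun k hk => Nat.pow_le_pow_right hZ1 hk
  have up : ∀ a c d : ℕ, a ≤ Z ^ 5 → c ≤ P → d ≤ Q → a * 1 * c * d ≤ V := by
    intro a c d ha hc hd
    rw [hV]; gcongr
  have Z51 : 1 ≤ Z ^ 5 := Nat.one_le_pow _ _ hZ1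
  have v0 : 1 ≤ V := by simpa using up 1 1 1 Z51 hP1 hQ1
  have v1 : P ≤ V := by simpa using up 1 P 1 Z51 le_rfl hQ1
  have v2 : Q ≤ V := by simpa using up 1 1 Q Z51 hP1 le_rfl
  have v3 : Z ^ 2 ≤ V := by simpa using up (Z ^ 2) 1 1 (pw 2 (by omega)) hP1 hQ1
  have v4 : Z ≤ V := by simpa using up Z 1 1 (by simpa using pw 1 (by omega)) hP1 hQ1
  have e1 : 8000 * Z ^ 5 * D * P * Q = 8000 * V := by rw [hV]; ring
  have e2 : 10000 * Z ^ 5 * D * P * Q = 10000 * V := by rw [hV]; ring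
  rw [e1, e2]
  omega

/-- 10000 ≤ 2^14, and the exponent 14 + 5 (w + 2) + (w + 1) 2^(w+1) is linear in S w 2^w ≥ 1. The
constant is absorbed, so the first claim needs no multiplicative factor. -/
theorem bound_subsets {w S : ℕ} (hw : 1 ≤ w) (hS : 1 ≤ S) :
    10000 * (2 ^ w + 2 ^ w + 1) ^ 5 * (2 ^ w + 2 ^ w) ^ (2 ^ w + 2 ^ w) ≤
      2 ^ (34 * (S * w * 2 ^ w)) := by
  have h1 : 2 ^ w + 2 ^ w = 2 ^ (w + 1) := by ring
  have h2 : 2 ^ (w + 1) + 1 ≤ 2 ^ (w + 2) := by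
    have := Nat.one_le_two_pow (n := w)
    rw [pow_succ, pow_add]; omega
  set B := S * w * 2 ^ w with hB
  have hB1 : w * 2 ^ w ≤ B := by
    rw [hB, mul_assoc]; exact Nat.le_mul_of_pos_left _ hS
  have hB2 : w ≤ w * 2 ^ w := Nat.le_mul_of_pos_right _ (by positivity)
  have hB3 : (w + 1) * 2 ^ (w + 1) ≤ 4 * (w * 2 ^ w) := by
    calc (w + 1) * 2 ^ (w + 1) ≤ (2 * w) * 2 ^ (w + 1) := by gcongr; omega
      _ = 4 * (w * 2 ^ w) := by ring
  rw [h1]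
  calc 10000 * (2 ^ (w + 1) + 1) ^ 5 * (2 ^ (w + 1)) ^ 2 ^ (w + 1)
      ≤ 2 ^ 14 * (2 ^ (w + 2)) ^ 5 * (2 ^ (w + 1)) ^ 2 ^ (w + 1) := by gcongr; norm_num
    _ = 2 ^ (14 + (w + 2) * 5 + (w + 1) * 2 ^ (w + 1)) := by
        rw [← pow_mul, ← pow_mul, ← pow_add, ← pow_add]
    _ ≤ 2 ^ (34 * B) := Nat.pow_le_pow_right (by norm_num) (by omega)

/-- A factor in front is kept, since w^(9w) = 1 for w = 1 absorbs nothing. The constant 40960000 is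
10000 · 4^5 · 4, from 2w + 1 ≤ 4w and 4^w ≤ 4 w^(2w); the exponent is 5 + 4w ≤ 9w. -/
theorem bound_single {w : ℕ} (hw : 1 ≤ w) :
    10000 * (w + w + 1) ^ 5 * (w + w) ^ (w + w) ≤ 40960000 * w ^ (9 * w) := by
  have h4 : 4 ^ w ≤ 4 * w ^ (w + w) := by
    rcases Nat.lt_or_ge 1 w with h | h
    · calc 4 ^ w = 2 ^ (w + w) := by rw [← two_mul, pow_mul]; norm_num
        _ ≤ w ^ (w + w) := Nat.pow_le_pow_left h _
        _ ≤ 4 * w ^ (w + w) := by omega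
    · have : w = 1 := by omega
      subst this; norm_num
  calc 10000 * (w + w + 1) ^ 5 * (w + w) ^ (w + w)
      ≤ 10000 * (4 * w) ^ 5 * (w + w) ^ (w + w) := by gcongr; omega
    _ = 10000 * 4 ^ 5 * w ^ 5 * (4 ^ w * w ^ (w + w)) := by
        rw [mul_pow, ← two_mul w, mul_pow, pow_mul 2 2 w]; norm_num; ring
    _ ≤ 10000 * 4 ^ 5 * w ^ 5 * (4 * w ^ (w + w) * w ^ (w + w)) := by gcongr
    _ = 40960000 * w ^ (5 + 4 * w) := by rw [pow_add, show 4 * w = (w + w) + (w + w) by ring, pow_add]; ring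
    _ ≤ 40960000 * w ^ (9 * w) := by
        gcongr
        omega

theorem isTable_subsetsC : subsetsC.IsTable := ⟨rfl, rfl, rfl, rfl, rfl, rfl⟩

theorem isTable_singleC : singleC.IsTable := ⟨rfl, rfl, rfl, rfl, rfl, rfl⟩

theorem subsetsC_spec {X : ℕ → ℕ} {s : St} (hw : s.reg .w = w) (h0 : ∀ y, s.arr .memb y = 0) :
    (subsetsC.eval X s).reg .N = 2 ^ w ∧ ∀ A : Finset (Fin w),
      decS w ((subsetsC.eval X s).arr .memb) (encS (2 ^ w) ((subsetsC.eval X s).arr .wt) A) = A := by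
  unfold subsetsC
  rw [Cmd.eval_seq]
  obtain ⟨h1, h2⟩ := powC_spec (X := X) hw
  refine ⟨by rw [Cmd.reg_frame _ _ _ rfl, h1], fun A => ?_⟩
  rw [Cmd.arr_frame (u := .wt) _ membC _ rfl]
  exact membC_spec (by rw [Cmd.reg_frame _ _ _ rfl, hw]) h2 h1
    (fun y => by rw [Cmd.arr_frame _ _ _ rfl, h0]) A

end SecondOrder

open SecondOrder in
theorem mainTheorem9 :
    (∃ (P : List SecondOrder.Instr) (C : ℝ),
      ∀ (α : Type) [Fintype α] [Nonempty α] (w : ℕ), 0 < w →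
      ∀ (σ₁ σ₂ : Type) [Fintype σ₁] [Nonempty σ₁] [Fintype σ₂] [Nonempty σ₂]
        (F₁ : NFA (SecondOrder.Layer α w) σ₁) (F₂ : NFA (SecondOrder.Layer α w) σ₂),
        SecondOrder.IsSOFA F₁ → SecondOrder.IsSOFA F₂ →
        ∀ x : List ℕ, SecondOrder.IsPresentation F₁ F₂ x →
          SecondOrder.DecidesWithin P x
            (SecondOrder.secondLanguage F₁ ∩ SecondOrder.secondLanguage F₂ ≠ ∅)
            ((2 : ℝ) ^ (C * ((Fintype.card α : ℝ) * (w : ℝ) * (2 : ℝ) ^ w)) *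
              SecondOrder.size F₁ * SecondOrder.size F₂)) ∧
    (∃ (P : List SecondOrder.Instr) (K C : ℝ),
      ∀ (α : Type) [Fintype α] [Nonempty α] (w : ℕ), 0 < w →
      ∀ (σ₁ σ₂ : Type) [Fintype σ₁] [Nonempty σ₁] [Fintype σ₂] [Nonempty σ₂]
        (F₁ : NFA (SecondOrder.Layer α w) σ₁) (F₂ : NFA (SecondOrder.Layer α w) σ₂),
        SecondOrder.IsSOFA F₁ → SecondOrder.IsSOFA F₂ →
        SecondOrder.AllDetComplete F₁ → SecondOrder.AllDetComplete F₂ →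
        ∀ x : List ℕ, SecondOrder.IsPresentation F₁ F₂ x →
          SecondOrder.DecidesWithin P x
            (SecondOrder.secondLanguage F₁ ∩ SecondOrder.secondLanguage F₂ ≠ ∅)
            (K * (2 : ℝ) ^ (C * ((Fintype.card α : ℝ) * (w : ℝ) * Real.logb 2 (w : ℝ))) *
              SecondOrder.size F₁ * SecondOrder.size F₂)) := by
  have card_pos : ∀ {σ : Type} [Nonempty σ] {n : ℕ}, σ ≃ Fin n → 1 ≤ n := by
    intro σ _ n f
    exact Nat.one_le_iff_ne_zero.2 fun h => by
      subst h; exact (f (Classical.arbitrary σ)).elim0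
  constructor
  -- All subsets are numbered, so every run is good and no property of the layers is needed.
  · refine ⟨program preC (decideC subsetsC), 34, ?_⟩
    intro α _ _ w hw σ₁ σ₂ _ _ _ _ F₁ F₂ hF₁ hF₂ x hx
    obtain ⟨S, n₁, n₂, e, f₁, f₂, l₁, l₂, hl₁, h₁, hl₂, h₂, hx⟩ := hx
    have hS : Fintype.card α = S := by rw [Fintype.card_congr e, Fintype.card_fin]
    have hS1 := card_pos e
    have hn₁ := card_pos f₁
    have hn₂ := card_pos f₂
    have : NeZero S := ⟨by omega⟩
    have hwN : w ≤ 2 ^ w := Nat.lt_two_pow_self.le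
    refine decides (N := 2 ^ w) (K := 300 * ((w + 1) * (2 ^ w + 1))) (G := Set.univ)
      isTable_subsetsC
      (fun X s h => subsetsC_cost h) (fun X s h h' => (subsetsC_spec h h').1)
      (fun X s h h' A _ => (subsetsC_spec h h').2 A) hF₁ hF₂ (fun D _ B _ => goodRun_univ D _)
      (fun D _ B _ => goodRun_univ D _) hn₁ hn₂ hwN h₁ h₂ hx ?_
    refine le_mul_size (le_size hw hS hl₁ h₁ f₁) (le_size hw hS hl₂ h₂ f₂)
      (V := 10000 * (2 ^ w + 2 ^ w + 1) ^ 5 * (2 ^ w + 2 ^ w) ^ (2 ^ w + 2 ^ w)) ?_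
      (overhead_le hn₁ hn₂ hS1 hwN ?_ (Nat.one_le_pow _ _ (by positivity)))
    · have hb := bound_subsets (S := S) hw hS1
      have he : (34 : ℝ) * ((Fintype.card α : ℝ) * (w : ℝ) * (2 : ℝ) ^ w) =
          ((34 * (S * w * 2 ^ w) : ℕ) : ℝ) := by rw [hS]; push_cast; ring
      rw [he, Real.rpow_natCast]
      exact_mod_cast hb
    · calc 300 * ((w + 1) * (2 ^ w + 1)) ≤
          1200 * ((2 ^ w + 2 ^ w + 1) * (2 ^ w + 2 ^ w + 1)) := by
            gcongr <;> omega
        _ = _ := by ring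
  -- Only one-element sets are numbered; determinism and completeness enter through `goodRun_of_det`
  -- alone.
  · refine ⟨program preC (decideC singleC), 40960000, 9, ?_⟩
    intro α _ _ w hw σ₁ σ₂ _ _ _ _ F₁ F₂ hF₁ hF₂ hd₁ hd₂ x hx
    obtain ⟨S, n₁, n₂, e, f₁, f₂, l₁, l₂, hl₁, h₁, hl₂, h₂, hx⟩ := hx
    have hS : Fintype.card α = S := by rw [Fintype.card_congr e, Fintype.card_fin]
    have hS1 := card_pos e
    have hn₁ := card_pos f₁
    have hn₂ := card_pos f₂
    have : NeZero S := ⟨by omega⟩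
    have : NeZero w := ⟨by omega⟩
    refine decides (N := w) (K := 70 * (w + 1) ^ 2) (G := {A | ∃ q, A = {q}}) isTable_singleC
      (fun X s h => by simpa [h] using singleC_cost (X := X) s)
      (fun X s h h' => (singleC_spec h h').1) (fun X s h h' A hA => ?_) hF₁ hF₂
      (fun D hD => goodRun_of_det (hF₁ D hD) (hd₁ D hD))
      (fun D hD => goodRun_of_det (hF₂ D hD) (hd₂ D hD)) hn₁ hn₂ le_rfl h₁ h₂ hx ?_
    · obtain ⟨q, rfl⟩ := hA
      exact (singleC_spec h h').2 q
    refine le_mul_size (le_size hw hS hl₁ h₁ f₁) (le_size hw hS hl₂ h₂ f₂)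
      (V := 10000 * (w + w + 1) ^ 5 * (w + w) ^ (w + w)) ?_
      (overhead_le hn₁ hn₂ hS1 le_rfl ?_ (Nat.one_le_pow _ _ (by omega)))
    · have hb := bound_single (w := w) hw
      have hw0 : (0 : ℝ) < w := by exact_mod_cast hw
      have hlog : 0 ≤ Real.logb 2 (w : ℝ) :=
        Real.logb_nonneg (by norm_num) (by exact_mod_cast hw)
      have he : ((w : ℝ)) ^ (9 * w) = (2 : ℝ) ^ (9 * ((w : ℝ) * Real.logb 2 (w : ℝ))) := by
        rw [← Real.rpow_natCast]
        conv_lhs => rw [← Real.rpow_logb (b := 2) (by norm_num) (by norm_num) hw0]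
        rw [← Real.rpow_mul (by norm_num)]
        congr 1
        push_cast
        ring
      -- The number of partitions does not depend on the alphabet, so the factor |Σ| in the exponent
      -- is pure slack.
      have hS' : (1 : ℝ) ≤ S := by exact_mod_cast hS1
      calc ((10000 * (w + w + 1) ^ 5 * (w + w) ^ (w + w) : ℕ) : ℝ)
          ≤ ((40960000 * w ^ (9 * w) : ℕ) : ℝ) := by exact_mod_cast hb
        _ = 40960000 * (2 : ℝ) ^ (9 * ((w : ℝ) * Real.logb 2 (w : ℝ))) := by push_cast; rw [he]
        _ ≤ _ := by
            gcongr
            · norm_num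
            · rw [hS]
              exact le_mul_of_one_le_left hw0.le hS'
    · calc 70 * (w + 1) ^ 2 ≤ 1200 * (w + w + 1) ^ 2 := by gcongr <;> omega
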